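/- Let $r,R>1$, $\mathbb A=\{z\in\mathbb C:1\le|z|\le r\}$, $\mathbb B=\{w\in\mathbb C:1\le|w|\le R\}$. Let $\mathcal F(\mathbb A,\mathbb B)$ be the class of orientation-preserving homeomorphisms $h$ of $\mathbb A$ onto $\mathbb B$ that map the inner (outer) boundary circle to the inner (outer) boundary circle and are such that $h$ and $h^{-1}$ belong to $W^{1,1}$. For $a,b>0$ put $$\mathcal E[a,b][h]=\int_{\mathbb A}\bigl(a^2|h_N|^2+b^2|h_T|^2\bigr)\,dx\,dy\in[0,\infty],\qquad h_N=\frac{\partial h(te^{i\theta})}{\partial t},\quad h_T=\frac1t\frac{\partial h(te^{i\theta})}{\partial\theta},$$ with weak derivatives, and define $\mathcal E[b,a][h^{-1}]$ in the same way on $\mathbb B$. For $\alpha,\beta>0$ let $$\mathfrak E[h]=\alpha\,\mathcal E[a,b][h]+\beta\,\mathcal E[b,a][h^{-1}],\qquad c=\frac ab,\quad \gamma=\frac\alpha\beta .$$ A radial solution is a function $H\in C^2[1,r]$ with $H'>0$, $H(1)=1$, $H(r)=R$ and $$H''(t)=\frac{H'(t)^2\,\bigl(H(t)-c^2tH'(t)\bigr)\,\bigl(t+\gamma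 H(t)H'(t)\bigr)}{t\,H(t)\,\bigl(H(t)+c^2\gamma\,tH'(t)^3\bigr)},\qquad 1\le t\le r$$ (the Euler–Lagrange equation of $\mathfrak E$ on radial maps). (1) Let $H$ be a radial solution, and assume either $c\le1$ and $c^2tH'(t)\ge H(t)$ for all $t\in[1,r]$ (concavity condition), or $c\ge1$ and $c^2tH'(t)\le H(t)$ for all $t\in[1,r]$ (convexity condition). Then the radial map $h_\circ(te^{i\theta})=H(t)e^{i\theta}$ belongs to $\mathcal F(\mathbb A,\mathbb B)$, has finite energy, and $\mathfrak E[h_\circ]\le\mathfrak E[h]$ for all $h\in\mathcal F(\mathbb A,\mathbb B)$; the minimizer is unique up to rotation, i.e. $h\in\mathcal F(\mathbb A,\mathbb B)$ satisfies $\mathfrak E[h]=\mathfrak E[h_\circ]$ if and only if $h=e^{i\varphi}h_\circ$ for some $\varphi\in\mathbb R$. (2) If $R=r^{1/c}$ (balanced case), the conclusion of (1) holds with $H(t)=t^{1/c}$, for every $c>0$. (3) For the given pair of annuli there is a constant $\varepsilon\ge0$ (independent of $a,b,\alpha,\beta$), with $\varepsilon>0$ if $\operatorname{Mod}\mathbb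 A/\operatorname{Mod}\mathbb B\ne1$, where $\operatorname{Mod}\mathbb A=\frac{1}{2\pi}\log r$ and $\operatorname{Mod}\mathbb B=\frac1{2\pi}\log R$, such that for all $a,b,\alpha,\beta>0$ with $|c-1|\le\varepsilon$ there is a radial solution $H$ for which the conclusion of (1) holds. -/

import Mathlib

open MeasureTheory Set Filter Topology
open scoped ContDiff ENNReal

noncomputable section

namespace CombinedEnergy

/-- The closed round annulus `{z : 1 ≤ |z| ≤ ρ}` in the complex plane. -/
def annulus (ρ : ℝ) : Set ℂ := {z | 1 ≤ ‖z‖ ∧ ‖z‖ ≤ ρ}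

/-- The open round annulus `{z : 1 < |z| < ρ}`. -/
def openAnnulus (ρ : ℝ) : Set ℂ := {z | 1 < ‖z‖ ∧ ‖z‖ < ρ}

/-- The modulus of the annulus `{z : 1 ≤ |z| ≤ ρ}`. -/
def modulus (ρ : ℝ) : ℝ := Real.log ρ / (2 * Real.pi)

/-- `Df` is a weak (distributional) derivative of `f` on `U`: for every test function `φ` supported
in `U` and every direction `v`, `∫ (∂_v φ) f = - ∫ φ (Df v)`. -/
structure HasWeakDeriv (U : Set ℂ) (f : ℂ → ℂ) (Df : ℂ → ℂ →L[ℝ] ℂ) : Prop where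
  locallyIntegrable : LocallyIntegrableOn f U
  locallyIntegrable_deriv : LocallyIntegrableOn Df U
  integral_eq : ∀ φ : ℂ → ℝ, ContDiff ℝ ∞ φ → HasCompactSupport φ → tsupport φ ⊆ U →
    ∀ v : ℂ, ∫ z in U, (fderiv ℝ φ z v) • f z = - ∫ z in U, φ z • Df z v

/-- The Sobolev class `W^{1,1}(U)`. -/
def MemW11 (U : Set ℂ) (f : ℂ → ℂ) : Prop :=
  IntegrableOn f U ∧ ∃ Df : ℂ → ℂ →L[ℝ] ℂ, HasWeakDeriv U f Df ∧ IntegrableOn Df U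

open Classical in
/-- A chosen representative of the weak derivative (it is unique up to null sets on an open set);
`0` if there is no weak derivative. -/
def weakDeriv (U : Set ℂ) (f : ℂ → ℂ) : ℂ → ℂ →L[ℝ] ℂ :=
  if h : ∃ Df, HasWeakDeriv U f Df then h.choose else 0

open Classical in
/-- A homeomorphism between closed annuli, as a function on the plane (`0` off the annulus). -/
def toPlane {r R : ℝ} (h : annulus r ≃ₜ annulus R) : ℂ → ℂ :=
  fun z => if hz : z ∈ annulus r then (h ⟨z, hz⟩ : ℂ) else 0

/-- The image under `f` of the circle of centre `z₀` and radius `ε` winds exactly once, in the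
positive sense, around `f z₀`: the argument of `f (z₀ + ε e^{iθ}) - f z₀` has a continuous branch
that grows by `2π` along the circle. -/
def WindsOnce (f : ℂ → ℂ) (z₀ : ℂ) (ε : ℝ) : Prop :=
  ∃ ψ : ℝ → ℝ, Continuous ψ ∧ ψ (2 * Real.pi) = ψ 0 + 2 * Real.pi ∧
    ∀ θ : ℝ, f (circleMap z₀ ε θ) - f z₀ =
      (‖f (circleMap z₀ ε θ) - f z₀‖ : ℂ) * Complex.exp (ψ θ * Complex.I)

/-- An injective continuous map preserves the orientation on the open set `U` if its local degree
is `1` at every point of `U`. -/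
def PreservesOrientation (U : Set ℂ) (f : ℂ → ℂ) : Prop :=
  ∀ z₀ ∈ U, ∀ᶠ ε in 𝓝[>] (0 : ℝ), WindsOnce f z₀ ε

/-- The class `𝓕(𝔸, 𝔹)` for `𝔸 = {1 ≤ |z| ≤ r}` and `𝔹 = {1 ≤ |w| ≤ R}`: orientation preserving
homeomorphisms of `𝔸` onto `𝔹` that keep the order of the boundary circles and belong, together
with their inverses, to `W^{1,1}`. -/
structure IsDeformation {r R : ℝ} (h : annulus r ≃ₜ annulus R) : Prop where
  inner_circle : ∀ z : annulus r, ‖(z : ℂ)‖ = 1 → ‖(h z : ℂ)‖ = 1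
  outer_circle : ∀ z : annulus r, ‖(z : ℂ)‖ = r → ‖(h z : ℂ)‖ = R
  orientation : PreservesOrientation (openAnnulus r) (toPlane h)
  sobolev : MemW11 (openAnnulus r) (toPlane h)
  sobolev_symm : MemW11 (openAnnulus R) (toPlane h.symm)

/-- The normal (radial) derivative `h_N = ∂h/∂t` at `z = t e^{iθ}`. -/
def normalDeriv {r R : ℝ} (h : annulus r ≃ₜ annulus R) (z : ℂ) : ℂ :=
  weakDeriv (openAnnulus r) (toPlane h) z (z / ‖z‖)

/-- The tangential (angular) derivative `h_T = t⁻¹ ∂h/∂θ` at `z = t e^{iθ}`. -/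
def tangentialDeriv {r R : ℝ} (h : annulus r ≃ₜ annulus R) (z : ℂ) : ℂ :=
  weakDeriv (openAnnulus r) (toPlane h) z (Complex.I * z / ‖z‖)

/-- The combined energy `𝓔[a,b][h] = ∫ (a² |h_N|² + b² |h_T|²)`, with values in `[0, ∞]`. -/
def combinedEnergy (a b : ℝ) {r R : ℝ} (h : annulus r ≃ₜ annulus R) : ℝ≥0∞ :=
  ∫⁻ z in openAnnulus r,
    ENNReal.ofReal (a ^ 2 * ‖normalDeriv h z‖ ^ 2 + b ^ 2 * ‖tangentialDeriv h z‖ ^ 2)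

/-- The total combined energy `α 𝓔[a,b][h] + β 𝓔[b,a][h⁻¹]`. -/
def totalEnergy (a b α β : ℝ) {r R : ℝ} (h : annulus r ≃ₜ annulus R) : ℝ≥0∞ :=
  ENNReal.ofReal α * combinedEnergy a b h + ENNReal.ofReal β * combinedEnergy b a h.symm

/-- `H` is an increasing `C²` diffeomorphism of `[1, r]` onto `[1, R]` that solves the radial
Euler–Lagrange equation of the total combined energy, where `c = a/b` and `γ = α/β`. -/
structure IsRadialSolution (c γ r R : ℝ) (H : ℝ → ℝ) : Prop where
  contDiffOn : ContDiffOn ℝ 2 H (Icc 1 r)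
  deriv_pos : ∀ t ∈ Icc 1 r, 0 < derivWithin H (Icc 1 r) t
  left : H 1 = 1
  right : H r = R
  ode : ∀ t ∈ Icc 1 r,
    derivWithin (derivWithin H (Icc 1 r)) (Icc 1 r) t =
      (derivWithin H (Icc 1 r) t) ^ 2 * (H t - c ^ 2 * t * derivWithin H (Icc 1 r) t) *
          (t + γ * H t * derivWithin H (Icc 1 r) t) /
        (t * H t * (H t + c ^ 2 * γ * t * (derivWithin H (Icc 1 r) t) ^ 3))

/-- The concavity condition (`c ≤ 1`) on the radial solution `H`. -/
def ConcavityCondition (c r : ℝ) (H : ℝ → ℝ) : Prop :=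
  c ≤ 1 ∧ ∀ t ∈ Icc 1 r, H t ≤ c ^ 2 * t * derivWithin H (Icc 1 r) t

/-- The convexity condition (`1 ≤ c`) on the radial solution `H`. -/
def ConvexityCondition (c r : ℝ) (H : ℝ → ℝ) : Prop :=
  1 ≤ c ∧ ∀ t ∈ Icc 1 r, c ^ 2 * t * derivWithin H (Icc 1 r) t ≤ H t

/-- The radial map `h₀ (t e^{iθ}) = H(t) e^{iθ}` is a deformation of finite energy, it minimizes the
total combined energy among all deformations, and the minimizers are exactly its rotations. -/
def IsRadialMinimizer (a b α β r R : ℝ) (H : ℝ → ℝ) : Prop :=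
  ∃ h₀ : annulus r ≃ₜ annulus R,
    (∀ z : annulus r, (h₀ z : ℂ) = (H ‖(z : ℂ)‖ : ℂ) * ((z : ℂ) / ‖(z : ℂ)‖)) ∧
    IsDeformation h₀ ∧
    totalEnergy a b α β h₀ < ⊤ ∧
    (∀ h : annulus r ≃ₜ annulus R, IsDeformation h →
      totalEnergy a b α β h₀ ≤ totalEnergy a b α β h) ∧
    (∀ h : annulus r ≃ₜ annulus R, IsDeformation h →
      (totalEnergy a b α β h = totalEnergy a b α β h₀ ↔
        ∃ φ : ℝ, ∀ z : annulus r, (h z : ℂ) = Complex.exp (φ * Complex.I) * (h₀ z : ℂ)))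

end CombinedEnergy

end

open scoped ComplexConjugate


namespace CombinedEnergy

/-! ### Radial profiles and the slope system -/

/-! The proof is by calibration. Let t = |z|, ρ = |h|, and let p, s (q, u) be the components of the
radial (angular) derivative of `h` along h/|h| and along its rotation by a right angle; J = pu - qs
is the Jacobian. For a deformation of finite energy, transporting the energy of the inverse to the
domain makes the total energy equal to β b² times the integral of a pointwise function L(p, q, s,
u), the `lagrangian`. A free Lagrangian F = A(ρ) p/t + B(t) u/ρ + C(ρ) J + D(t) has the same
integral for every such deformation: the first term comes from the radial derivative of a function
of |h|, the second is the same thing for the inverse, the third is a change of variables, the fourth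
does not involve `h`. Hence coefficients with F ≤ L everywhere and F = L along the radial map prove
minimality (`IsCalibration.isRadialMinimizer`).

In terms of the slope k = c t H'/H the equation becomes a first order system for which k = 1 is at
rest. Concavity gives k ≥ 1 with c ≤ 1, convexity gives k ≤ 1 with c ≥ 1, and the balanced case is k
= 1. Passing to the inverse map replaces c, γ, k by their reciprocals, so k ≤ 1 suffices. If k = 1,
then L - 2cγJ - 2c is a sum of squares. If k < 1, then L is bounded below by a family of functions
of u and J alone, indexed by the values of k; choosing the best index and using the monotonicity of
a few functions of one variable gives the calibration (`reduced_bound`, `exists_strictCalibration`).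
This needs only c ≥ 1/2.

For c near 1 a radial solution is found by shooting with k(1) in [0, 1], which reaches every R ≤
r^(1/c); the other radii are reached through the inverse problem. As both c and 1/c have to be at
least 1/2, ε = 1/2 serves for every pair of annuli.

The integral identities rest on planar Sobolev theory. Finite energy puts `h` and its inverse in
W^{1,2}. The oscillation of a homeomorphism on a disc is controlled by that on a nearby circle
(`IsPlanarHomeo.norm_sub_le`); this yields differentiability almost everywhere, Lusin's condition,
and thus the change of variables in both directions. In the case of equality the quotient of `h` by
the radial map has vanishing derivative almost everywhere, so it is a constant of modulus one. -/

theorem lt_of_deriv_sign {g g' : ℝ → ℝ} {a b m : ℝ} (hm : m ∈ Icc a b)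
    (hg : ∀ x ∈ Icc a b, HasDerivWithinAt g (g' x) (Icc a b) x)
    (neg : ∀ x ∈ Ioo a m, g' x < 0) (pos : ∀ x ∈ Ioo m b, 0 < g' x) :
    ∀ x ∈ Icc a b, x ≠ m → g m < g x := by
  have hd : ∀ x ∈ Ioo a b, deriv g x = g' x := fun x hx =>
    ((hg x (Ioo_subset_Icc_self hx)).hasDerivAt (Icc_mem_nhds hx.1 hx.2)).deriv
  have hc : ContinuousOn g (Icc a b) := fun x hx => (hg x hx).continuousWithinAt
  intro x hx hne
  rcases lt_or_gt_of_ne hne with h | h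
  · have : StrictAntiOn g (Icc a m) := by
      refine strictAntiOn_of_deriv_neg (convex_Icc _ _) (hc.mono (Icc_subset_Icc_right hm.2)) ?_
      intro y hy
      rw [interior_Icc] at hy
      rw [hd y ⟨hy.1, hy.2.trans_le hm.2⟩]
      exact neg y hy
    exact this ⟨hx.1, h.le⟩ ⟨hm.1, le_rfl⟩ h
  · have : StrictMonoOn g (Icc m b) := by
      refine strictMonoOn_of_deriv_pos (convex_Icc _ _) (hc.mono (Icc_subset_Icc_left hm.1)) ?_
      intro y hy
      rw [interior_Icc] at hy
      rw [hd y ⟨hm.1.trans_lt hy.1, hy.2⟩]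
      exact pos y hy
    exact this ⟨le_rfl, hm.2⟩ ⟨h.le, hx.2⟩ h

/-- `H` is an increasing `C¹` diffeomorphism of `[1, r]` onto `[1, R]` with derivative `H'`. -/
structure IsRadialProfile (r R : ℝ) (H H' : ℝ → ℝ) : Prop where
  hasDeriv : ∀ t ∈ Icc 1 r, HasDerivWithinAt H (H' t) (Icc 1 r) t
  continuousOn_deriv : ContinuousOn H' (Icc 1 r)
  deriv_pos : ∀ t ∈ Icc 1 r, 0 < H' t
  left : H 1 = 1
  right : H r = R

namespace IsRadialProfile

variable {r R : ℝ} {H H' : ℝ → ℝ}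

theorem continuousOn (h : IsRadialProfile r R H H') : ContinuousOn H (Icc 1 r) :=
  fun t ht => (h.hasDeriv t ht).continuousWithinAt

theorem strictMonoOn (h : IsRadialProfile r R H H') : StrictMonoOn H (Icc 1 r) := by
  refine strictMonoOn_of_deriv_pos (convex_Icc _ _) h.continuousOn fun x hx => ?_
  rw [interior_Icc] at hx
  rw [((h.hasDeriv x (Ioo_subset_Icc_self hx)).hasDerivAt (Icc_mem_nhds hx.1 hx.2)).deriv]
  exact h.deriv_pos x (Ioo_subset_Icc_self hx)

theorem mapsTo (h : IsRadialProfile r R H H') : MapsTo H (Icc 1 r) (Icc 1 R) := by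
  intro t ht
  have h1r : (1 : ℝ) ≤ r := ht.1.trans ht.2
  constructor
  · rw [← h.left]
    exact h.strictMonoOn.monotoneOn ⟨le_rfl, h1r⟩ ht ht.1
  · rw [← h.right]
    exact h.strictMonoOn.monotoneOn ht ⟨h1r, le_rfl⟩ ht.2

theorem surjOn (h : IsRadialProfile r R H H') (hr : 1 < r) : SurjOn H (Icc 1 r) (Icc 1 R) := by
  have := intermediate_value_Icc hr.le h.continuousOn
  rwa [h.left, h.right] at this

theorem exists_inverse (h : IsRadialProfile r R H H') (hr : 1 < r) :
    ∃ K : ℝ → ℝ, IsRadialProfile R r K (fun ρ => (H' (K ρ))⁻¹) ∧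
      (∀ t ∈ Icc 1 r, K (H t) = t) ∧ (∀ ρ ∈ Icc 1 R, H (K ρ) = ρ) := by
  have hinj := h.strictMonoOn.injOn
  have hsurj := h.surjOn hr
  set K := Function.invFunOn H (Icc 1 r) with hK
  have hHK : ∀ ρ ∈ Icc 1 R, H (K ρ) = ρ := fun ρ hρ => hsurj.rightInvOn_invFunOn hρ
  have hKm : ∀ ρ ∈ Icc 1 R, K ρ ∈ Icc 1 r := fun ρ hρ => hsurj.mapsTo_invFunOn hρ
  have hKH : ∀ t ∈ Icc 1 r, K (H t) = t := fun t ht => hinj.leftInvOn_invFunOn ht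
  -- Preimages under the inverse are images under `H` of compact sets, hence closed.
  have hKc : ContinuousOn K (Icc 1 R) := by
    rw [continuousOn_iff_isClosed]
    intro s hs
    refine ⟨H '' (Icc 1 r ∩ s), ?_, ?_⟩
    · exact ((isCompact_Icc.inter_right hs).image_of_continuousOn
        (h.continuousOn.mono inter_subset_left)).isClosed
    · ext ρ
      constructor
      · rintro ⟨h1, h2⟩; exact ⟨⟨K ρ, ⟨hKm ρ h2, h1⟩, hHK ρ h2⟩, h2⟩
      · rintro ⟨⟨t, ⟨ht, hts⟩, rfl⟩, h2⟩
        refine ⟨?_, h2⟩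
        rw [mem_preimage, hKH t ht]; exact hts
  have hd : ∀ ρ ∈ Icc 1 R, HasDerivWithinAt K (H' (K ρ))⁻¹ (Icc 1 R) ρ := by
    intro ρ hρ
    have h0 := (h.deriv_pos _ (hKm ρ hρ)).ne'
    have h1 : Tendsto K (𝓝[Icc 1 R] ρ) (𝓝[Icc 1 r] (K ρ)) :=
      (hKc ρ hρ).tendsto_nhdsWithin hKm
    have h2 := (h.hasDeriv (K ρ) (hKm ρ hρ)).hasFDerivWithinAt
    have h3 := HasFDerivWithinAt.of_local_left_inverse
      (f' := ContinuousLinearEquiv.unitsEquivAut ℝ (Units.mk0 (H' (K ρ)) h0)) h1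
      (h2.congr_fderiv (by ext; simp)) hρ
      (eventually_nhdsWithin_of_forall fun x hx => hHK x hx)
    exact h3.hasDerivWithinAt.congr_deriv (by simp)
  refine ⟨K, ⟨hd, ?_, fun ρ hρ => inv_pos.2 (h.deriv_pos _ (hKm ρ hρ)), ?_, ?_⟩, hKH, hHK⟩
  · exact ContinuousOn.inv₀ (h.continuousOn_deriv.comp hKc hKm) fun ρ hρ =>
      (h.deriv_pos _ (hKm ρ hρ)).ne'
  · have := hKH 1 ⟨le_rfl, hr.le⟩; rwa [h.left] at this
  · have := hKH r ⟨hr.le, le_rfl⟩; rwa [h.right] at this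

end IsRadialProfile

end CombinedEnergy

namespace CombinedEnergy

/-- The derivative of the logarithmic slope `k = c t H' / H` of a radial solution `H`. -/
noncomputable def slopeRate (c γ t H k : ℝ) : ℝ :=
  k / t * (1 - k ^ 2) * (1 + γ * H ^ 2 / (c * t ^ 2) * k ^ 2 / c) /
    (1 + γ * H ^ 2 / (c * t ^ 2) * k ^ 3)

/-- The radial Euler–Lagrange equation as a first order system for `H` and its logarithmic slope
`k = c t H' / H`. -/
structure IsSlopeSystem (c γ r R : ℝ) (H k : ℝ → ℝ) : Prop where
  hasDeriv : ∀ t ∈ Icc 1 r, HasDerivWithinAt H (k t * H t / (c * t)) (Icc 1 r) t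
  hasDeriv_slope : ∀ t ∈ Icc 1 r, HasDerivWithinAt k (slopeRate c γ t (H t) (k t)) (Icc 1 r) t
  pos : ∀ t ∈ Icc 1 r, 0 < H t
  slope_pos : ∀ t ∈ Icc 1 r, 0 < k t
  left : H 1 = 1
  right : H r = R

theorem IsRadialSolution.isRadialProfile {c γ r R : ℝ} {H : ℝ → ℝ}
    (h : IsRadialSolution c γ r R H) (hr : 1 < r) :
    IsRadialProfile r R H (derivWithin H (Icc 1 r)) where
  hasDeriv t ht := ((h.contDiffOn.differentiableOn (by norm_num)) t ht).hasDerivWithinAt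
  continuousOn_deriv :=
    h.contDiffOn.continuousOn_derivWithin (uniqueDiffOn_Icc hr) (by norm_num)
  deriv_pos := h.deriv_pos
  left := h.left
  right := h.right

/-- Inserting the equation into the derivative of c t H'/H eliminates the second derivative and
leaves a multiple of k (1 - k²), which shows the role of the value 1. -/
theorem IsRadialSolution.isSlopeSystem {c γ r R : ℝ} {H : ℝ → ℝ}
    (h : IsRadialSolution c γ r R H) (hr : 1 < r) (hc : 0 < c) (hγ : 0 < γ) :
    IsSlopeSystem c γ r R H (fun t => c * t * derivWithin H (Icc 1 r) t / H t) := by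
  have hp := h.isRadialProfile hr
  have hpos : ∀ t ∈ Icc 1 r, 0 < H t := fun t ht => zero_lt_one.trans_le (hp.mapsTo ht).1
  have hd2 : DifferentiableOn ℝ (derivWithin H (Icc 1 r)) (Icc 1 r) := by
    have h1 : ContDiffOn ℝ 1 (derivWithin H (Icc 1 r)) (Icc 1 r) :=
      h.contDiffOn.derivWithin (uniqueDiffOn_Icc hr) (by norm_num)
    exact h1.differentiableOn (by norm_num)
  refine ⟨fun t ht => ?_, fun t ht => ?_, hpos, fun t ht => ?_, h.left, h.right⟩
  · have ht0 : 0 < t := zero_lt_one.trans_le ht.1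
    refine (hp.hasDeriv t ht).congr_deriv ?_
    have := (hpos t ht).ne'
    field_simp
  · have ht0 : 0 < t := zero_lt_one.trans_le ht.1
    have h1 := (((hasDerivWithinAt_id t (Icc 1 r)).const_mul c).mul
      (hd2 t ht).hasDerivWithinAt).div (hp.hasDeriv t ht) (hpos t ht).ne'
    refine h1.congr_deriv ?_
    rw [h.ode t ht]
    simp only [Pi.mul_apply, id]
    have hH := hpos t ht
    have hpp := h.deriv_pos t ht
    generalize derivWithin H (Icc 1 r) t = p at *
    generalize H t = y at *
    simp only [slopeRate]
    have e1 : y + c ^ 2 * γ * t * p ^ 3 ≠ 0 := by positivity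
    have e2 : 1 + γ * y ^ 2 / (c * t ^ 2) * (c * t * p / y) ^ 3 = (y + c ^ 2 * γ * t * p ^ 3) / y := by
      field_simp
    rw [e2]
    field_simp
    ring
  · have := hpos t ht
    have := h.deriv_pos t ht
    have : 0 < t := zero_lt_one.trans_le ht.1
    positivity

namespace IsSlopeSystem

variable {c γ r R : ℝ} {H k : ℝ → ℝ}

theorem isRadialProfile (h : IsSlopeSystem c γ r R H k) (hc : 0 < c) :
    IsRadialProfile r R H (fun t => k t * H t / (c * t)) where
  hasDeriv := h.hasDeriv
  continuousOn_deriv := by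
    have h1 : ContinuousOn H (Icc 1 r) := fun t ht => (h.hasDeriv t ht).continuousWithinAt
    have h2 : ContinuousOn k (Icc 1 r) := fun t ht => (h.hasDeriv_slope t ht).continuousWithinAt
    refine (h2.mul h1).div (by fun_prop) fun t ht => ?_
    have : 0 < t := zero_lt_one.trans_le ht.1
    positivity
  deriv_pos t ht := by
    have := h.pos t ht
    have := h.slope_pos t ht
    have : 0 < t := zero_lt_one.trans_le ht.1
    positivity
  left := h.left
  right := h.right

theorem continuousOn_slope (h : IsSlopeSystem c γ r R H k) : ContinuousOn k (Icc 1 r) :=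
  fun t ht => (h.hasDeriv_slope t ht).continuousWithinAt

theorem isRadialSolution (h : IsSlopeSystem c γ r R H k) (hr : 1 < r) (hc : 0 < c) (hγ : 0 < γ) :
    IsRadialSolution c γ r R H := by
  have hp := h.isRadialProfile hc
  have hu := uniqueDiffOn_Icc hr
  have hd : ∀ t ∈ Icc 1 r, derivWithin H (Icc 1 r) t = k t * H t / (c * t) := fun t ht =>
    (h.hasDeriv t ht).derivWithin (hu t ht)
  have hne : ∀ t ∈ Icc 1 r, c * t ≠ 0 := fun t ht => by
    have : 0 < t := zero_lt_one.trans_le ht.1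
    positivity
  have hcH := hp.continuousOn
  have hck := h.continuousOn_slope
  have hpos := h.pos
  have hkpos := h.slope_pos
  have hd2 : ∀ t ∈ Icc 1 r, HasDerivWithinAt (derivWithin H (Icc 1 r))
      (((slopeRate c γ t (H t) (k t) * H t + k t * (k t * H t / (c * t))) * (c * t)
        - (k t * H t) * c) / (c * t) ^ 2) (Icc 1 r) t := by
    intro t ht
    have h1 := ((h.hasDeriv_slope t ht).mul (h.hasDeriv t ht)).div
      ((hasDerivWithinAt_id t (Icc 1 r)).const_mul c) (hne t ht)
    refine (h1.congr_of_mem (fun x hx => ?_) ht).congr_deriv ?_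
    · rw [hd x hx]; rfl
    · simp
  -- Bootstrapping: H' = kH/(ct) is again differentiable, with a derivative that is continuous
  -- because it is expressed through H and k.
  have hC2 : ContDiffOn ℝ 2 H (Icc 1 r) := by
    have e2 : (2 : WithTop ℕ∞) = 1 + 1 := by norm_num
    rw [e2, contDiffOn_succ_iff_derivWithin hu]
    refine ⟨fun t ht => (h.hasDeriv t ht).differentiableWithinAt, by simp, ?_⟩
    have e1 : (1 : WithTop ℕ∞) = 0 + 1 := by norm_num
    rw [e1, contDiffOn_succ_iff_derivWithin hu]
    refine ⟨fun t ht => (hd2 t ht).differentiableWithinAt, by simp, ?_⟩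
    rw [contDiffOn_zero]
    have hrate : ContinuousOn (fun t => slopeRate c γ t (H t) (k t)) (Icc 1 r) := by
      unfold slopeRate
      have ht0 : ∀ t ∈ Icc (1 : ℝ) r, t ≠ 0 := fun t ht => (zero_lt_one.trans_le ht.1).ne'
      have hw : ContinuousOn (fun t => γ * H t ^ 2 / (c * t ^ 2)) (Icc 1 r) :=
        ((hcH.pow 2).const_mul γ).div (by fun_prop) fun t ht => by
          have : 0 < t := zero_lt_one.trans_le ht.1
          positivity
      refine ContinuousOn.div ?_ ?_ fun t ht => ?_
      · exact ((hck.div continuousOn_id ht0).mul (continuousOn_const.sub (hck.pow 2))).mul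
          (continuousOn_const.add ((hw.mul (hck.pow 2)).div_const c))
      · exact continuousOn_const.add (hw.mul (hck.pow 3))
      · have := hpos t ht
        have := hkpos t ht
        have : 0 < t := zero_lt_one.trans_le ht.1
        positivity
    refine ContinuousOn.congr (f := fun t => ((slopeRate c γ t (H t) (k t) * H t
        + k t * (k t * H t / (c * t))) * (c * t) - (k t * H t) * c) / (c * t) ^ 2) ?_
      (fun t ht => (hd2 t ht).derivWithin (hu t ht))
    refine ContinuousOn.div ?_ (by fun_prop) fun t ht => pow_ne_zero _ (hne t ht)
    exact (((hrate.mul hcH).add (hck.mul hp.continuousOn_deriv)).mul (by fun_prop)).sub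
      ((hck.mul hcH).mul continuousOn_const)
  refine ⟨hC2, fun t ht => ?_, h.left, h.right, fun t ht => ?_⟩
  · rw [hd t ht]; exact hp.deriv_pos t ht
  · rw [(hd2 t ht).derivWithin (hu t ht), hd t ht]
    have hH := hpos t ht
    have hk := hkpos t ht
    have ht0 : 0 < t := zero_lt_one.trans_le ht.1
    generalize H t = y at *
    generalize k t = k at *
    simp only [slopeRate]
    have e1 : c * t ^ 2 + γ * y ^ 2 * k ^ 3 ≠ 0 := by positivity
    have e2 : 1 + γ * y ^ 2 / (c * t ^ 2) * k ^ 3 = (c * t ^ 2 + γ * y ^ 2 * k ^ 3) / (c * t ^ 2) := by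
      field_simp
    have e3 : y + c ^ 2 * γ * t * (k * y / (c * t)) ^ 3 =
        y * (c * t ^ 2 + γ * y ^ 2 * k ^ 3) / (c * t ^ 2) := by
      field_simp
    rw [e2, e3]
    field_simp
    ring

/-- The functional is symmetric under exchange of a map and its inverse, with a, b and α, β
exchanged. This is what reduces slopes above one to slopes below one. -/
theorem inverse (h : IsSlopeSystem c γ r R H k) (hr : 1 < r) (hc : 0 < c) (hγ : 0 < γ) :
    ∃ K : ℝ → ℝ, IsSlopeSystem c⁻¹ γ⁻¹ R r K (fun ρ => (k (K ρ))⁻¹) ∧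
      (∀ t ∈ Icc 1 r, K (H t) = t) ∧ (∀ ρ ∈ Icc 1 R, H (K ρ) = ρ) := by
  obtain ⟨K, hK, hKH, hHK⟩ := (h.isRadialProfile hc).exists_inverse hr
  refine ⟨K, ⟨fun ρ hρ => ?_, fun ρ hρ => ?_, fun ρ hρ => zero_lt_one.trans_le (hK.mapsTo hρ).1,
    fun ρ hρ => inv_pos.2 (h.slope_pos _ (hK.mapsTo hρ)), hK.left, hK.right⟩, hKH, hHK⟩
  · refine (hK.hasDeriv ρ hρ).congr_deriv ?_
    rw [hHK ρ hρ]
    field_simp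
  · have h1 := ((h.hasDeriv_slope (K ρ) (hK.mapsTo hρ)).comp ρ (hK.hasDeriv ρ hρ) hK.mapsTo).inv
      (h.slope_pos _ (hK.mapsTo hρ)).ne'
    refine h1.congr_deriv ?_
    have hk := h.slope_pos _ (hK.mapsTo hρ)
    have ht0 : 0 < K ρ := zero_lt_one.trans_le (hK.mapsTo hρ).1
    have hρ0 : 0 < ρ := zero_lt_one.trans_le hρ.1
    simp only [Function.comp, hHK ρ hρ]
    generalize k (K ρ) = k at *
    generalize K ρ = t at *
    simp only [slopeRate]
    have e1 : c * t ^ 2 + γ * ρ ^ 2 * k ^ 3 ≠ 0 := by positivity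
    have e2 : 1 + γ * ρ ^ 2 / (c * t ^ 2) * k ^ 3 = (c * t ^ 2 + γ * ρ ^ 2 * k ^ 3) / (c * t ^ 2) := by
      field_simp
    have e3 : 1 + γ⁻¹ * t ^ 2 / (c⁻¹ * ρ ^ 2) * k⁻¹ ^ 3 =
        (c * t ^ 2 + γ * ρ ^ 2 * k ^ 3) / (γ * ρ ^ 2 * k ^ 3) := by
      field_simp
      ring
    rw [e2, e3]
    field_simp
    ring

/-- Either the slope is identically `1` or it stays below `1`. -/
theorem slope_eq_one_or_lt_one (h : IsSlopeSystem c γ r R H k) (hr : 1 < r) (hc : 0 < c)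
    (hγ : 0 < γ) (hk : ∀ t ∈ Icc 1 r, k t ≤ 1) :
    (∀ t ∈ Icc 1 r, k t = 1) ∨ (∀ t ∈ Icc 1 r, k t < 1) := by
  have hp := h.isRadialProfile hc
  have hd : ∀ x ∈ Ioo 1 r, HasDerivAt k (slopeRate c γ x (H x) (k x)) x := fun x hx =>
    (h.hasDeriv_slope x (Ioo_subset_Icc_self hx)).hasDerivAt (Icc_mem_nhds hx.1 hx.2)
  have h1 : (1 : ℝ) ∈ Icc 1 r := ⟨le_rfl, hr.le⟩
  -- As k ≤ 1, the slope is nondecreasing, so a start at 1 remains at 1. For a start below 1 a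
  -- Grönwall argument shows that (1 - k) exp(M t) is nondecreasing, which keeps 1 - k positive.
  rcases (hk 1 h1).eq_or_lt with h0 | h0
  · left
    have hmono : MonotoneOn k (Icc 1 r) := by
      refine monotoneOn_of_deriv_nonneg (convex_Icc _ _) h.continuousOn_slope ?_ ?_
      · rw [interior_Icc]
        exact fun x hx => (hd x hx).differentiableAt.differentiableWithinAt
      · rw [interior_Icc]
        intro x hx
        rw [(hd x hx).deriv]
        have hx' := Ioo_subset_Icc_self hx
        have := h.slope_pos x hx'
        have := h.pos x hx'
        have : 0 < x := zero_lt_one.trans hx.1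
        have : 0 ≤ 1 - k x ^ 2 := by nlinarith [hk x hx']
        unfold slopeRate
        positivity
    intro t ht
    exact le_antisymm (hk t ht) (h0 ▸ hmono h1 ht ht.1)
  · right
    -- M bounds k' / (1 - k): the 2 comes from 1 + k ≤ 2, the other factor from H ≤ R and k ≤ 1 ≤ t.
    set M : ℝ := 2 * (1 + γ * R ^ 2 / (c * c)) with hM
    have hmono : MonotoneOn (fun t => (1 - k t) * Real.exp (M * t)) (Icc 1 r) := by
      have hd' : ∀ x ∈ Ioo 1 r, HasDerivAt (fun t => (1 - k t) * Real.exp (M * t))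
          ((0 - slopeRate c γ x (H x) (k x)) * Real.exp (M * x) +
            (1 - k x) * (Real.exp (M * x) * (M * 1))) x := fun x hx =>
        ((hasDerivAt_const x (1 : ℝ)).sub (hd x hx)).mul
          (((hasDerivAt_id x).const_mul M).exp)
      refine monotoneOn_of_deriv_nonneg (convex_Icc _ _) ?_ ?_ ?_
      · exact (continuousOn_const.sub h.continuousOn_slope).mul (by fun_prop)
      · rw [interior_Icc]
        exact fun x hx => (hd' x hx).differentiableAt.differentiableWithinAt
      · rw [interior_Icc]
        intro x hx
        rw [(hd' x hx).deriv]
        have hx' := Ioo_subset_Icc_self hx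
        have hk0 := h.slope_pos x hx'
        have hk1 := hk x hx'
        have hH0 := h.pos x hx'
        have hHR := (hp.mapsTo hx').2
        have hx1 : 1 < x := hx.1
        have key : slopeRate c γ x (H x) (k x) ≤ (1 - k x) * M := by
          generalize k x = k at *
          generalize H x = y at *
          unfold slopeRate
          have hx0 : 0 < x := by linarith
          have a1 : γ * y ^ 2 / (c * x ^ 2) * k ^ 2 / c ≤ γ * R ^ 2 / (c * c) := by
            rw [div_mul_eq_mul_div, div_div, div_le_div_iff₀ (by positivity) (by positivity)]
            have b1 : y ^ 2 ≤ R ^ 2 := by gcongr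
            have b2 : k ^ 2 ≤ x ^ 2 := by gcongr; linarith
            calc γ * y ^ 2 * k ^ 2 * (c * c) ≤ γ * R ^ 2 * x ^ 2 * (c * c) := by gcongr
              _ = _ := by ring
          have a2 : k / x ≤ 1 := by rw [div_le_one hx0]; linarith
          have a3 : 1 - k ^ 2 ≤ 2 * (1 - k) := by nlinarith
          have a4 : 0 ≤ 1 - k ^ 2 := by nlinarith
          calc _ ≤ k / x * (1 - k ^ 2) * (1 + γ * y ^ 2 / (c * x ^ 2) * k ^ 2 / c) := by
                apply div_le_self (by positivity)
                have : 0 ≤ γ * y ^ 2 / (c * x ^ 2) * k ^ 3 := by positivity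
                linarith
            _ ≤ 1 * (2 * (1 - k)) * (1 + γ * R ^ 2 / (c * c)) := by gcongr
            _ = _ := by rw [hM]; ring
        have := Real.exp_pos (M * x)
        nlinarith
    intro t ht
    have h2 := hmono h1 ht ht.1
    have h3 : 0 < (1 - k 1) * Real.exp (M * 1) := mul_pos (by linarith) (Real.exp_pos _)
    have h4 : 0 < (1 - k t) * Real.exp (M * t) := h3.trans_le h2
    have := pos_of_mul_pos_left h4 (Real.exp_pos _).le
    linarith

end IsSlopeSystem

end CombinedEnergy

namespace CombinedEnergy

/-! ### Calibrations -/

/-- The coefficients of a free Lagrangian. -/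
structure FreeLagrangian where
  A : ℝ → ℝ
  B : ℝ → ℝ
  C : ℝ → ℝ
  D : ℝ → ℝ

/-- The value of a free Lagrangian at radius `t`, image radius `ρ` and the differential with matrix
`!![p, q; s, u]` in the polar frames. -/
noncomputable def FreeLagrangian.eval (F : FreeLagrangian) (t ρ p q s u : ℝ) : ℝ :=
  F.A ρ * p / t + F.B t * u / ρ + F.C ρ * (p * u - q * s) + F.D t

/-- Continuity of the coefficients of a free Lagrangian. -/
structure FreeLagrangian.IsCont (F : FreeLagrangian) (r R : ℝ) : Prop where
  A : ContinuousOn F.A (Icc 1 R)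
  B : ContinuousOn F.B (Icc 1 r)
  C : ContinuousOn F.C (Icc 1 R)
  D : ContinuousOn F.D (Icc 1 r)

/-- The integrand of the (normalized) total energy on the domain, the energy of the inverse being
transported by the change of variables. -/
noncomputable def lagrangian (c γ p q s u : ℝ) : ℝ :=
  γ * (c ^ 2 * (p ^ 2 + s ^ 2) + (q ^ 2 + u ^ 2)) +
    (c ^ 2 * (p ^ 2 + q ^ 2) + (u ^ 2 + s ^ 2)) / (p * u - q * s)

/-- `F` calibrates the radial map `H`, and `G` gives rigidity in the equality case. -/
structure IsCalibration (c γ r R : ℝ) (H H' : ℝ → ℝ) (F G : FreeLagrangian) : Prop where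
  cont : F.IsCont r R
  cont' : G.IsCont r R
  le : ∀ t ∈ Icc 1 r, ∀ ρ ∈ Icc 1 R, ∀ p q s u : ℝ, 0 < p * u - q * s →
    F.eval t ρ p q s u ≤ lagrangian c γ p q s u
  eq : ∀ t ∈ Icc 1 r, F.eval t (H t) (H' t) 0 0 (H t / t) = lagrangian c γ (H' t) 0 0 (H t / t)
  eq' : ∀ t ∈ Icc 1 r, G.eval t (H t) (H' t) 0 0 (H t / t) = 0
  nonneg : ∀ t ∈ Icc 1 r, ∀ ρ ∈ Icc 1 R, ∀ p q s u : ℝ, 0 < p * u - q * s →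
    F.eval t ρ p q s u = lagrangian c γ p q s u → 0 ≤ G.eval t ρ p q s u
  rigid : ∀ t ∈ Icc 1 r, ∀ ρ ∈ Icc 1 R, ∀ p q s u : ℝ, 0 < p * u - q * s →
    F.eval t ρ p q s u = lagrangian c γ p q s u → G.eval t ρ p q s u = 0 →
    p * H t = H' t * ρ ∧ q = 0 ∧ s = 0 ∧ u * t = ρ

/-- Completing squares (`hsplit`) shows that F = 2cγJ + 2c is a calibration, but equality only gives
u = cp and q = -cs and says nothing of p, s and ρ. The second free Lagrangian `G` removes this
freedom. -/
theorem IsSlopeSystem.exists_calibration_of_slope_eq_one {c γ r R : ℝ} {H k : ℝ → ℝ}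
    (h : IsSlopeSystem c γ r R H k) (hc : 0 < c) (hγ : 0 < γ) (hk : ∀ t ∈ Icc 1 r, k t = 1) :
    ∃ F G, IsCalibration c γ r R H (fun t => k t * H t / (c * t)) F G := by
  have hsplit : ∀ p q s u : ℝ, 0 < p * u - q * s →
      lagrangian c γ p q s u - (2 * c * γ * (p * u - q * s) + 2 * c) =
        γ * ((c * p - u) ^ 2 + (c * s + q) ^ 2) +
          ((c * p - u) ^ 2 + (c * q + s) ^ 2) / (p * u - q * s) := by
    intro p q s u hJ
    unfold lagrangian
    obtain ⟨J, hJ'⟩ : ∃ J, J = p * u - q * s := ⟨_, rfl⟩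
    rw [← hJ'] at hJ ⊢
    field_simp
    rw [hJ']
    ring
  have hzero : ∀ p q s u : ℝ, 0 < p * u - q * s →
      lagrangian c γ p q s u = 2 * c * γ * (p * u - q * s) + 2 * c →
      u = c * p ∧ q = - (c * s) := by
    intro p q s u hJ he
    have h1 := hsplit p q s u hJ
    rw [he, sub_self] at h1
    have h2 : 0 ≤ ((c * p - u) ^ 2 + (c * q + s) ^ 2) / (p * u - q * s) := by positivity
    have h3 : 0 ≤ γ * ((c * p - u) ^ 2 + (c * s + q) ^ 2) := by positivity
    have h4 : γ * ((c * p - u) ^ 2 + (c * s + q) ^ 2) = 0 := by linarith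
    have h5 : (c * p - u) ^ 2 + (c * s + q) ^ 2 = 0 := by
      rcases mul_eq_zero.1 h4 with h | h
      · exact absurd h hγ.ne'
      · exact h
    have h6 : c * p - u = 0 := by
      apply pow_eq_zero_iff (two_ne_zero) |>.1
      nlinarith [sq_nonneg (c * p - u), sq_nonneg (c * s + q)]
    have h7 : c * s + q = 0 := by
      apply pow_eq_zero_iff (two_ne_zero) |>.1
      nlinarith [sq_nonneg (c * p - u), sq_nonneg (c * s + q)]
    constructor <;> linarith
  -- On the equality set J = c(p² + s²), so G = -2u/(tρ) + cJ/ρ² + 1/t² becomes (cp/ρ - 1/t)² +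
  -- (cs/ρ)²; it vanishes along the radial map and forces s = 0 and cpt = ρ.
  refine ⟨⟨fun _ => 0, fun _ => 0, fun _ => 2 * c * γ, fun _ => 2 * c⟩,
    ⟨fun _ => 0, fun t => -2 / t, fun ρ => c / ρ ^ 2, fun t => 1 / t ^ 2⟩,
    ⟨by fun_prop, by fun_prop, by fun_prop, by fun_prop⟩, ⟨by fun_prop, ?_, ?_, ?_⟩, ?_, ?_, ?_, ?_, ?_⟩
  · exact continuousOn_const.div continuousOn_id fun t ht => (zero_lt_one.trans_le ht.1).ne'
  · exact continuousOn_const.div (by fun_prop) fun t ht =>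
      pow_ne_zero _ (zero_lt_one.trans_le ht.1).ne'
  · exact continuousOn_const.div (by fun_prop) fun t ht =>
      pow_ne_zero _ (zero_lt_one.trans_le ht.1).ne'
  · intro t ht ρ hρ p q s u hJ
    have h1 := hsplit p q s u hJ
    have h2 : 0 ≤ γ * ((c * p - u) ^ 2 + (c * s + q) ^ 2) +
          ((c * p - u) ^ 2 + (c * q + s) ^ 2) / (p * u - q * s) := by positivity
    simp only [FreeLagrangian.eval, zero_mul, zero_div, zero_add]
    linarith
  · intro t ht
    have ht0 : 0 < t := zero_lt_one.trans_le ht.1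
    have hH := h.pos t ht
    simp only [FreeLagrangian.eval, lagrangian, hk t ht]
    field_simp
    ring
  · intro t ht
    have ht0 : 0 < t := zero_lt_one.trans_le ht.1
    have hH := h.pos t ht
    simp only [FreeLagrangian.eval, hk t ht]
    field_simp
    ring
  · intro t ht ρ hρ p q s u hJ he
    have ht0 : 0 < t := zero_lt_one.trans_le ht.1
    have hρ0 : 0 < ρ := zero_lt_one.trans_le hρ.1
    obtain ⟨rfl, rfl⟩ := hzero p q s u hJ (by rw [← he]; simp [FreeLagrangian.eval])
    have : FreeLagrangian.eval ⟨fun _ => 0, fun t => -2 / t, fun ρ => c / ρ ^ 2,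
        fun t => 1 / t ^ 2⟩ t ρ p (-(c * s)) s (c * p) = (c * p / ρ - 1 / t) ^ 2 + (c * s / ρ) ^ 2 := by
      simp only [FreeLagrangian.eval]
      field_simp
      ring
    rw [this]
    positivity
  · intro t ht ρ hρ p q s u hJ he he2
    have ht0 : 0 < t := zero_lt_one.trans_le ht.1
    have hρ0 : 0 < ρ := zero_lt_one.trans_le hρ.1
    have hH := h.pos t ht
    obtain ⟨rfl, rfl⟩ := hzero p q s u hJ (by rw [← he]; simp [FreeLagrangian.eval])
    have : FreeLagrangian.eval ⟨fun _ => 0, fun t => -2 / t, fun ρ => c / ρ ^ 2,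
        fun t => 1 / t ^ 2⟩ t ρ p (-(c * s)) s (c * p) = (c * p / ρ - 1 / t) ^ 2 + (c * s / ρ) ^ 2 := by
      simp only [FreeLagrangian.eval]
      field_simp
      ring
    rw [this] at he2
    have h6 : c * p / ρ - 1 / t = 0 := by
      apply pow_eq_zero_iff (two_ne_zero) |>.1
      nlinarith [sq_nonneg (c * p / ρ - 1 / t), sq_nonneg (c * s / ρ)]
    have h7 : c * s / ρ = 0 := by
      apply pow_eq_zero_iff (two_ne_zero) |>.1
      nlinarith [sq_nonneg (c * p / ρ - 1 / t), sq_nonneg (c * s / ρ)]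
    have h8 : s = 0 := by
      rcases div_eq_zero_iff.1 h7 with h | h
      · rcases mul_eq_zero.1 h with h | h
        · exact absurd h hc.ne'
        · exact h
      · exact absurd h hρ0.ne'
    have h9 : c * p * t = ρ := by
      field_simp at h6
      linarith
    refine ⟨?_, by simp [h8], h8, h9⟩
    rw [hk t ht, ← h9]
    field_simp

/-- `F` calibrates the radial map `H`, with equality only for the `1`-jet of `H`. -/
structure IsStrictCalibration (c γ r R : ℝ) (H H' : ℝ → ℝ) (F : FreeLagrangian) : Prop where
  cont : F.IsCont r R
  le : ∀ t ∈ Icc 1 r, ∀ ρ ∈ Icc 1 R, ∀ p q s u : ℝ, 0 < p * u - q * s →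
    F.eval t ρ p q s u ≤ lagrangian c γ p q s u
  eq : ∀ t ∈ Icc 1 r, F.eval t (H t) (H' t) 0 0 (H t / t) = lagrangian c γ (H' t) 0 0 (H t / t)
  rigid : ∀ t ∈ Icc 1 r, ∀ ρ ∈ Icc 1 R, ∀ p q s u : ℝ, 0 < p * u - q * s →
    F.eval t ρ p q s u = lagrangian c γ p q s u →
    ρ = H t ∧ p = H' t ∧ q = 0 ∧ s = 0 ∧ u = H t / t

theorem IsStrictCalibration.isCalibration {c γ r R : ℝ} {H H' : ℝ → ℝ} {F : FreeLagrangian}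
    (hF : IsStrictCalibration c γ r R H H' F) :
    IsCalibration c γ r R H H' F ⟨fun _ => 0, fun _ => 0, fun _ => 0, fun _ => 0⟩ where
  cont := hF.cont
  cont' := ⟨by fun_prop, by fun_prop, by fun_prop, by fun_prop⟩
  le := hF.le
  eq := hF.eq
  eq' t _ := by simp [FreeLagrangian.eval]
  nonneg t _ ρ _ p q s u _ _ := by simp [FreeLagrangian.eval]
  rigid t ht ρ hρ p q s u hJ he _ := by
    obtain ⟨h1, h2, h3, h4, h5⟩ := hF.rigid t ht ρ hρ p q s u hJ he
    refine ⟨by rw [h1, h2], h3, h4, ?_⟩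
    have : t ≠ 0 := (zero_lt_one.trans_le ht.1).ne'
    rw [h5, h1]
    field_simp

/-- Transfer of a calibration of the inverse radial map. -/
theorem IsStrictCalibration.of_inverse {c γ r R : ℝ} {H H' K K' : ℝ → ℝ} {F : FreeLagrangian}
    (hc : 0 < c) (hγ : 0 < γ) (hF : IsStrictCalibration c⁻¹ γ⁻¹ R r K K' F)
    (hH : MapsTo H (Icc 1 r) (Icc 1 R)) (hH' : ∀ t ∈ Icc 1 r, 0 < H' t)
    (hKH : ∀ t ∈ Icc 1 r, K (H t) = t) (hHK : ∀ ρ ∈ Icc 1 R, H (K ρ) = ρ)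
    (hK' : ∀ t ∈ Icc 1 r, K' (H t) = (H' t)⁻¹) :
    IsStrictCalibration c γ r R H H' ⟨fun ρ => γ * c ^ 2 * F.B ρ, fun t => γ * c ^ 2 * F.A t,
      fun ρ => γ * c ^ 2 * F.D ρ, fun t => γ * c ^ 2 * F.C t⟩ := by
  -- The density of the inverse problem at the inverse matrix, multiplied by the Jacobian, is the
  -- original density up to the constant γc².
  have hL : ∀ p q s u : ℝ, 0 < p * u - q * s → lagrangian c γ p q s u =
      γ * c ^ 2 * (p * u - q * s) * lagrangian c⁻¹ γ⁻¹ (u / (p * u - q * s)) (-q / (p * u - q * s))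
        (-s / (p * u - q * s)) (p / (p * u - q * s)) ∧
      u / (p * u - q * s) * (p / (p * u - q * s)) - -q / (p * u - q * s) * (-s / (p * u - q * s))
        = (p * u - q * s)⁻¹ := by
    intro p q s u hJ
    have hdet : u / (p * u - q * s) * (p / (p * u - q * s)) -
        -q / (p * u - q * s) * (-s / (p * u - q * s)) = (p * u - q * s)⁻¹ := by
      obtain ⟨J, hJ'⟩ : ∃ J, J = p * u - q * s := ⟨_, rfl⟩
      rw [← hJ'] at hJ ⊢
      field_simp
      rw [hJ']
      ring
    refine ⟨?_, hdet⟩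
    unfold lagrangian
    rw [hdet]
    obtain ⟨J, hJ'⟩ : ∃ J, J = p * u - q * s := ⟨_, rfl⟩
    rw [← hJ'] at hJ ⊢
    field_simp
    ring
  -- Inversion and multiplication by J exchange the two boundary terms A, B and the two volume terms
  -- C, D.
  have hE : ∀ t ρ p q s u : ℝ, 0 < t → 0 < ρ → 0 < p * u - q * s →
      FreeLagrangian.eval ⟨fun ρ => γ * c ^ 2 * F.B ρ, fun t => γ * c ^ 2 * F.A t,
      fun ρ => γ * c ^ 2 * F.D ρ, fun t => γ * c ^ 2 * F.C t⟩ t ρ p q s u =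
      γ * c ^ 2 * (p * u - q * s) * F.eval ρ t (u / (p * u - q * s)) (-q / (p * u - q * s))
        (-s / (p * u - q * s)) (p / (p * u - q * s)) := by
    intro t ρ p q s u ht hρ hJ
    simp only [FreeLagrangian.eval]
    rw [(hL p q s u hJ).2]
    obtain ⟨J, hJ'⟩ : ∃ J, J = p * u - q * s := ⟨_, rfl⟩
    rw [← hJ'] at hJ ⊢
    field_simp
    ring
  have hpos : ∀ t : ℝ, t ∈ Icc 1 r → 0 < t := fun t ht => zero_lt_one.trans_le ht.1
  have hpos' : ∀ ρ : ℝ, ρ ∈ Icc 1 R → 0 < ρ := fun ρ hρ => zero_lt_one.trans_le hρ.1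
  refine ⟨⟨hF.cont.B.const_mul _, hF.cont.A.const_mul _,
    hF.cont.D.const_mul _, hF.cont.C.const_mul _⟩, ?_, ?_, ?_⟩
  · intro t ht ρ hρ p q s u hJ
    rw [hE t ρ p q s u (hpos t ht) (hpos' ρ hρ) hJ, (hL p q s u hJ).1]
    have := hF.le ρ hρ t ht (u / (p * u - q * s)) (-q / (p * u - q * s))
        (-s / (p * u - q * s)) (p / (p * u - q * s)) (by rw [(hL p q s u hJ).2]; positivity)
    gcongr
  · intro t ht
    have ht0 := hpos t ht
    have hρ := hH ht
    have hH0 := hpos' _ hρ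
    have hd := hH' t ht
    have hJ : 0 < H' t * (H t / t) - 0 * 0 := by
      simp only [mul_zero, sub_zero]; positivity
    rw [hE t _ _ _ _ _ ht0 hH0 hJ, (hL _ _ _ _ hJ).1]
    have := hF.eq (H t) hρ
    rw [hKH t ht, hK' t ht] at this
    have e1 : H t / t / (H' t * (H t / t) - 0 * 0) = (H' t)⁻¹ := by field_simp; ring
    have e2 : H' t / (H' t * (H t / t) - 0 * 0) = t / H t := by field_simp; ring
    rw [e1, e2, neg_zero, zero_div, this]
  · intro t ht ρ hρ p q s u hJ he
    have ht0 := hpos t ht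
    have hρ0 := hpos' ρ hρ
    rw [hE t ρ p q s u ht0 hρ0 hJ, (hL p q s u hJ).1] at he
    have he' := mul_left_cancel₀ (by positivity) he
    obtain ⟨h1, h2, h3, h4, h5⟩ := hF.rigid ρ hρ t ht _ _ _ _
      (by rw [(hL p q s u hJ).2]; positivity) he'
    have hq : q = 0 := by
      rcases div_eq_zero_iff.1 h3 with h | h
      · linarith
      · exact absurd h hJ.ne'
    have hs : s = 0 := by
      rcases div_eq_zero_iff.1 h4 with h | h
      · linarith
      · exact absurd h hJ.ne'
    have hρt : ρ = H t := by rw [h1, hHK ρ hρ]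
    subst hq hs
    simp only [mul_zero, sub_zero] at h2 h5 hJ
    have hp0 : p ≠ 0 := fun h => by simp [h] at hJ
    have hu0 : u ≠ 0 := fun h => by simp [h] at hJ
    have hd := hH' t ht
    have h2' : p⁻¹ = (H' t)⁻¹ := by
      rw [← hK' t ht, ← hρt, ← h2]; field_simp
    refine ⟨hρt, inv_injective h2', rfl, rfl, ?_⟩
    rw [← h1] at h5
    rw [← hρt]
    field_simp at h5 ⊢
    linarith

end CombinedEnergy

/-! ### The calibration for slopes below one -/

namespace CombinedEnergy

/-- The lower bound of the Lagrangian in terms of the entry `u` and the Jacobian `J`. -/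
noncomputable def reducedLagrangian (c γ k u J : ℝ) : ℝ :=
  γ * (2 * c * k * J + (1 - k ^ 2) * u ^ 2) + (2 * c * k + (1 - k ^ 2) * u ^ 2 / J)

/-- For each parameter k in (0, 1) the difference is a sum of squares with nonnegative weights. The
parameter is free, and the best value will depend on u and J. Equality means cp = ku and q = s = 0,
as for a radial map of slope k. -/
theorem lagrangian_sub_reducedLagrangian (c γ k p q s u : ℝ) (hJ : 0 < p * u - q * s) :
    lagrangian c γ p q s u - reducedLagrangian c γ k u (p * u - q * s) =
      γ * ((c * p - k * u) ^ 2 + ((c * s + k * q) ^ 2 + (1 - k ^ 2) * q ^ 2)) +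
      ((c * p - k * u) ^ 2 + ((c * q + k * s) ^ 2 + (1 - k ^ 2) * s ^ 2)) / (p * u - q * s) := by
  unfold lagrangian reducedLagrangian
  obtain ⟨J, hJ'⟩ : ∃ J, J = p * u - q * s := ⟨_, rfl⟩
  rw [← hJ'] at hJ ⊢
  field_simp
  rw [hJ']
  ring

theorem reducedLagrangian_le {c γ k p q s u : ℝ} (hγ : 0 < γ) (hk : 0 < k) (hk1 : k < 1)
    (hJ : 0 < p * u - q * s) :
    reducedLagrangian c γ k u (p * u - q * s) ≤ lagrangian c γ p q s u ∧
    (lagrangian c γ p q s u = reducedLagrangian c γ k u (p * u - q * s) →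
      c * p = k * u ∧ q = 0 ∧ s = 0) := by
  have h := lagrangian_sub_reducedLagrangian c γ k p q s u hJ
  have h1 : 0 < 1 - k ^ 2 := by nlinarith
  have h2 : 0 ≤ γ * ((c * p - k * u) ^ 2 + ((c * s + k * q) ^ 2 + (1 - k ^ 2) * q ^ 2)) := by
    positivity
  have h3 : 0 ≤ ((c * p - k * u) ^ 2 + ((c * q + k * s) ^ 2 + (1 - k ^ 2) * s ^ 2)) /
    (p * u - q * s) := by positivity
  refine ⟨by linarith, fun he => ?_⟩
  rw [he, sub_self] at h
  have h4 : (c * p - k * u) ^ 2 + ((c * s + k * q) ^ 2 + (1 - k ^ 2) * q ^ 2) = 0 := by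
    have : γ * ((c * p - k * u) ^ 2 + ((c * s + k * q) ^ 2 + (1 - k ^ 2) * q ^ 2)) = 0 := by linarith
    exact (mul_eq_zero.1 this).resolve_left hγ.ne'
  have h5 : (c * p - k * u) ^ 2 + ((c * q + k * s) ^ 2 + (1 - k ^ 2) * s ^ 2) = 0 := by
    have : ((c * p - k * u) ^ 2 + ((c * q + k * s) ^ 2 + (1 - k ^ 2) * s ^ 2)) /
      (p * u - q * s) = 0 := by linarith
    exact (div_eq_zero_iff.1 this).resolve_right hJ.ne'
  have a1 : 0 ≤ (1 - k ^ 2) * q ^ 2 := by positivity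
  have a2 : 0 ≤ (1 - k ^ 2) * s ^ 2 := by positivity
  refine ⟨?_, ?_, ?_⟩
  · have : (c * p - k * u) ^ 2 = 0 := by
      nlinarith [sq_nonneg (c * p - k * u), sq_nonneg (c * s + k * q)]
    linarith [pow_eq_zero_iff (two_ne_zero) |>.1 this]
  · have : (1 - k ^ 2) * q ^ 2 = 0 := by
      nlinarith [sq_nonneg (c * p - k * u), sq_nonneg (c * s + k * q)]
    exact pow_eq_zero_iff (two_ne_zero) |>.1 ((mul_eq_zero.1 this).resolve_left h1.ne')
  · have : (1 - k ^ 2) * s ^ 2 = 0 := by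
      nlinarith [sq_nonneg (c * p - k * u), sq_nonneg (c * q + k * s)]
    exact pow_eq_zero_iff (two_ne_zero) |>.1 ((mul_eq_zero.1 this).resolve_left h1.ne')

namespace IsSlopeSystem

variable {c γ r R : ℝ} {H k : ℝ → ℝ}

/-- The auxiliary function `b = t B / (2 c)` of the calibration. -/
noncomputable def momentum (c γ : ℝ) (H k : ℝ → ℝ) (t : ℝ) : ℝ :=
  (1 - k t ^ 2) * (γ * H t ^ 2 / c + t ^ 2 / k t)

/-- The function `κ = k + 1 / k`. -/
noncomputable def kappa (k : ℝ → ℝ) (t : ℝ) : ℝ := k t + 1 / k t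

/-- The coefficient of the Jacobian in the calibration, as a function of `t`. -/
noncomputable def jacCoeff (c γ : ℝ) (H k : ℝ → ℝ) (t : ℝ) : ℝ :=
  2 * γ * c * k t - (1 - k t ^ 2) * c ^ 2 * t ^ 2 / (k t ^ 2 * H t ^ 2)

/-- The coefficient `D` of the calibration. -/
noncomputable def constCoeff (c γ : ℝ) (H k : ℝ → ℝ) (t : ℝ) : ℝ :=
  c * kappa k t - c * momentum c γ H k t / t ^ 2

/-- The coefficient `B` of the calibration. -/
noncomputable def angCoeff (c γ : ℝ) (H k : ℝ → ℝ) (t : ℝ) : ℝ :=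
  2 * c * momentum c γ H k t / t

/-- The derivative of `κ`. -/
noncomputable def kappaRate (c γ : ℝ) (H k : ℝ → ℝ) (t : ℝ) : ℝ :=
  - slopeRate c γ t (H t) (k t) * (1 - k t ^ 2) / k t ^ 2

theorem hasDeriv_kappa (h : IsSlopeSystem c γ r R H k) {t : ℝ} (ht : t ∈ Icc 1 r) :
    HasDerivWithinAt (kappa k) (kappaRate c γ H k t) (Icc 1 r) t := by
  have hk := h.slope_pos t ht
  have h1 := (h.hasDeriv_slope t ht).add
    ((hasDerivWithinAt_const t (Icc 1 r) (1 : ℝ)).div (h.hasDeriv_slope t ht) hk.ne')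
  refine h1.congr_deriv ?_
  unfold kappaRate
  field_simp
  ring

/-- The slope equation in the form b' = -t² κ', where b is the momentum. The derivatives of B and D
and the comparison `momentum_add_kappa_lt` follow from it. -/
theorem hasDeriv_momentum (h : IsSlopeSystem c γ r R H k) (hc : 0 < c) (hγ : 0 < γ) {t : ℝ}
    (ht : t ∈ Icc 1 r) :
    HasDerivWithinAt (momentum c γ H k) (- t ^ 2 * kappaRate c γ H k t) (Icc 1 r) t := by
  have hk := h.slope_pos t ht
  have hH := h.pos t ht
  have ht0 : 0 < t := zero_lt_one.trans_le ht.1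
  have h1 := (((h.hasDeriv_slope t ht).pow 2).const_sub 1).mul
    (((((h.hasDeriv t ht).pow 2).const_mul γ).div_const c).add
      (((hasDerivWithinAt_id t (Icc 1 r)).pow 2).div (h.hasDeriv_slope t ht) hk.ne'))
  refine h1.congr_deriv ?_
  simp only [Pi.pow_apply, Pi.add_apply, Pi.div_apply, id, kappaRate, slopeRate]
  generalize k t = k at *
  generalize H t = y at *
  have e1 : c * t ^ 2 + γ * y ^ 2 * k ^ 3 ≠ 0 := by positivity
  have e2 : 1 + γ * y ^ 2 / (c * t ^ 2) * k ^ 3 = (c * t ^ 2 + γ * y ^ 2 * k ^ 3) / (c * t ^ 2) := by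
    field_simp
  rw [e2]
  field_simp
  ring

/-- Equivalently (H² C)' = 2γ k κ H² / t, which is the form needed for `jac_part_lt`. -/
theorem hasDeriv_jacCoeff (h : IsSlopeSystem c γ r R H k) (hc : 0 < c) (hγ : 0 < γ) {t : ℝ}
    (ht : t ∈ Icc 1 r) :
    HasDerivWithinAt (jacCoeff c γ H k)
      (2 * k t / (c * t) * (γ * c * kappa k t - jacCoeff c γ H k t)) (Icc 1 r) t := by
  have hk := h.slope_pos t ht
  have hH := h.pos t ht
  have ht0 : 0 < t := zero_lt_one.trans_le ht.1
  have h1 := ((h.hasDeriv_slope t ht).const_mul (2 * γ * c)).sub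
    ((((((h.hasDeriv_slope t ht).pow 2).const_sub 1).mul_const (c ^ 2)).mul
      ((hasDerivWithinAt_id t (Icc 1 r)).pow 2)).div
      (((h.hasDeriv_slope t ht).pow 2).mul ((h.hasDeriv t ht).pow 2)) (by
        simp only [Pi.mul_apply, Pi.pow_apply]; positivity))
  refine h1.congr_deriv ?_
  simp only [Pi.pow_apply, Pi.mul_apply, id, slopeRate, kappa, jacCoeff]
  generalize k t = k at *
  generalize H t = y at *
  have e1 : c * t ^ 2 + γ * y ^ 2 * k ^ 3 ≠ 0 := by positivity
  have e2 : 1 + γ * y ^ 2 / (c * t ^ 2) * k ^ 3 = (c * t ^ 2 + γ * y ^ 2 * k ^ 3) / (c * t ^ 2) := by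
    field_simp
  rw [e2]
  field_simp
  ring

theorem hasDeriv_angCoeff (h : IsSlopeSystem c γ r R H k) (hc : 0 < c) (hγ : 0 < γ) {t : ℝ}
    (ht : t ∈ Icc 1 r) :
    HasDerivWithinAt (angCoeff c γ H k)
      (-2 * c * (t * kappaRate c γ H k t + momentum c γ H k t / t ^ 2)) (Icc 1 r) t := by
  have ht0 : 0 < t := zero_lt_one.trans_le ht.1
  have h1 := (((h.hasDeriv_momentum hc hγ ht).const_mul (2 * c)).div
    (hasDerivWithinAt_id t (Icc 1 r)) ht0.ne')
  refine h1.congr_deriv ?_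
  simp only [id]
  field_simp
  ring

/-- Together with `hasDeriv_angCoeff` this says D' = -B'/t, so that B/x + D is stationary at t = x.
-/
theorem hasDeriv_constCoeff (h : IsSlopeSystem c γ r R H k) (hc : 0 < c) (hγ : 0 < γ) {t : ℝ}
    (ht : t ∈ Icc 1 r) :
    HasDerivWithinAt (constCoeff c γ H k)
      (2 * c * (t * kappaRate c γ H k t + momentum c γ H k t / t ^ 2) / t) (Icc 1 r) t := by
  have ht0 : 0 < t := zero_lt_one.trans_le ht.1
  have h1 := ((h.hasDeriv_kappa ht).const_mul c).sub
    (((h.hasDeriv_momentum hc hγ ht).const_mul c).div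
      ((hasDerivWithinAt_id t (Icc 1 r)).pow 2) (by simpa using ht0.ne'))
  refine h1.congr_deriv ?_
  simp only [id, Pi.pow_apply]
  field_simp
  ring

theorem kappaRate_neg (h : IsSlopeSystem c γ r R H k) (hc : 0 < c) (hγ : 0 < γ)
    (hk1 : ∀ t ∈ Icc 1 r, k t < 1) {t : ℝ} (ht : t ∈ Icc 1 r) : kappaRate c γ H k t < 0 := by
  have hk := h.slope_pos t ht
  have hH := h.pos t ht
  have ht0 : 0 < t := zero_lt_one.trans_le ht.1
  have h1 : 0 < 1 - k t ^ 2 := by nlinarith [hk1 t ht]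
  have h2 : 0 < slopeRate c γ t (H t) (k t) := by unfold slopeRate; positivity
  unfold kappaRate
  rw [neg_mul, neg_div]
  apply neg_neg_of_pos
  positivity

/-- This is the negative of B'/(2c), and its sign decides that B/x + D has a maximum at t = x. The
bound 1/2 ≤ c enters the construction of the calibration through this lemma. -/
theorem angRate_pos (h : IsSlopeSystem c γ r R H k) (hc : 1 / 2 ≤ c) (hγ : 0 < γ)
    (hk1 : ∀ t ∈ Icc 1 r, k t < 1) {t : ℝ} (ht : t ∈ Icc 1 r) :
    0 < t * kappaRate c γ H k t + momentum c γ H k t / t ^ 2 := by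
  have hk := h.slope_pos t ht
  have hH := h.pos t ht
  have hk1 := hk1 t ht
  have hc0 : 0 < c := by linarith
  have ht0 : 0 < t := zero_lt_one.trans_le ht.1
  have h1 : 0 < 1 - k t ^ 2 := by nlinarith
  unfold kappaRate momentum slopeRate
  generalize k t = k at *
  generalize H t = y at *
  obtain ⟨w, hw⟩ : ∃ w, w = γ * y ^ 2 / (c * t ^ 2) := ⟨_, rfl⟩
  have hw0 : 0 < w := by rw [hw]; positivity
  have hy : γ * y ^ 2 = w * (c * t ^ 2) := by rw [hw]; field_simp
  rw [← hw, hy]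
  have e : t * (-(k / t * (1 - k ^ 2) * (1 + w * k ^ 2 / c) / (1 + w * k ^ 3)) * (1 - k ^ 2) / k ^ 2) +
      (1 - k ^ 2) * (w * (c * t ^ 2) / c + t ^ 2 / k) / t ^ 2 =
      (1 - k ^ 2) / (k * (1 + w * k ^ 3)) *
        ((1 + w * k) * (1 + w * k ^ 3) - (1 - k ^ 2) * (1 + w * k ^ 2 / c)) := by
    field_simp
    ring
  rw [e]
  -- Amounts to k(1 - k²) ≤ c; on (0, 1) the left side is at most 2/(3√3), which is below 1/2.
  have h2 : k ^ 2 * (1 - k ^ 2) / c ≤ k := by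
    rw [div_le_iff₀ hc0]
    nlinarith [mul_pos hk hk, sq_nonneg (k - 1 / 2), mul_nonneg hk.le (sq_nonneg (k - 1 / 2))]
  have h3 : 0 < (1 + w * k) * (1 + w * k ^ 3) - (1 - k ^ 2) * (1 + w * k ^ 2 / c) := by
    have : (1 + w * k) * (1 + w * k ^ 3) - (1 - k ^ 2) * (1 + w * k ^ 2 / c) =
      k ^ 2 + w * (k - k ^ 2 * (1 - k ^ 2) / c) + w * k ^ 3 + w ^ 2 * k ^ 4 := by
      field_simp
      ring
    rw [this]
    have : 0 ≤ w * (k - k ^ 2 * (1 - k ^ 2) / c) := mul_nonneg hw0.le (by linarith)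
    positivity
  positivity

theorem momentum_pos (h : IsSlopeSystem c γ r R H k) (hc : 0 < c) (hγ : 0 < γ)
    (hk1 : ∀ t ∈ Icc 1 r, k t < 1) {t : ℝ} (ht : t ∈ Icc 1 r) : 0 < momentum c γ H k t := by
  have hk := h.slope_pos t ht
  have hH := h.pos t ht
  have ht0 : 0 < t := zero_lt_one.trans_le ht.1
  have h1 : 0 < 1 - k t ^ 2 := by nlinarith [hk1 t ht]
  unfold momentum
  positivity

theorem kappa_strictAntiOn (h : IsSlopeSystem c γ r R H k) (hc : 0 < c) (hγ : 0 < γ)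
    (hk1 : ∀ t ∈ Icc 1 r, k t < 1) : StrictAntiOn (kappa k) (Icc 1 r) := by
  refine strictAntiOn_of_deriv_neg (convex_Icc _ _)
    (fun t ht => (h.hasDeriv_kappa ht).continuousWithinAt) fun t ht => ?_
  rw [interior_Icc] at ht
  have ht' := Ioo_subset_Icc_self ht
  rw [((h.hasDeriv_kappa ht').hasDerivAt (Icc_mem_nhds ht.1 ht.2)).deriv]
  exact h.kappaRate_neg hc hγ hk1 ht'

/-- The derivative of B/x + D in t has the sign of 1/t - 1/x, so the function rises up to x and
falls afterwards. The hypotheses `hx1` and `hx2` encode that `t'` is the point of [1, r] closest to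
x. -/
theorem ang_add_const_lt (h : IsSlopeSystem c γ r R H k) (hc : 1 / 2 ≤ c) (hγ : 0 < γ)
    (hk1 : ∀ t ∈ Icc 1 r, k t < 1) {x t t' : ℝ} (hx : 0 < x) (ht : t ∈ Icc 1 r)
    (ht' : t' ∈ Icc 1 r) (hx1 : t' < x → t' = r) (hx2 : x < t' → t' = 1) (hne : t ≠ t') :
    angCoeff c γ H k t / x + constCoeff c γ H k t <
      angCoeff c γ H k t' / x + constCoeff c γ H k t' := by
  have hc0 : 0 < c := by linarith
  have := lt_of_deriv_sign (g := fun t => -(angCoeff c γ H k t / x + constCoeff c γ H k t))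
    (g' := fun t => 2 * c * (t * kappaRate c γ H k t + momentum c γ H k t / t ^ 2) *
      (1 / x - 1 / t)) ht' (fun t ht => ?_) (fun t ht => ?_) (fun t ht => ?_) t ht hne
  · linarith
  · refine ((((h.hasDeriv_angCoeff hc0 hγ ht).div_const x).add
      (h.hasDeriv_constCoeff hc0 hγ ht)).neg).congr_deriv ?_
    have ht0 : 0 < t := zero_lt_one.trans_le ht.1
    field_simp
    ring
  · have htI : t ∈ Icc 1 r := ⟨ht.1.le, ht.2.le.trans ht'.2⟩
    have ht0 : 0 < t := zero_lt_one.trans ht.1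
    have h1 := h.angRate_pos hc hγ hk1 htI
    have h2 : t < x := by
      by_contra hcon
      have := hx2 (by linarith [ht.2])
      linarith [ht.1, ht.2]
    have h3 : 1 / x < 1 / t := one_div_lt_one_div_of_lt ht0 h2
    exact mul_neg_of_pos_of_neg (by positivity) (by linarith)
  · have htI : t ∈ Icc 1 r := ⟨ht'.1.trans ht.1.le, ht.2.le⟩
    have h1 := h.angRate_pos hc hγ hk1 htI
    have h2 : x < t := by
      by_contra hcon
      have := hx1 (by linarith [ht.1])
      linarith [ht.1, ht.2]
    have h3 : 1 / t < 1 / x := one_div_lt_one_div_of_lt hx h2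
    exact mul_pos (by positivity) (by linarith)

/-- The derivative in τ has the sign of 2 k(s) j + 1 - k(s)² - j κ(τ). When j = k(s) this is
k(s)(κ(s) - κ(τ)), and κ is strictly decreasing, so s is the minimum. If j lies outside the range of
k, then s is an endpoint and the sign on the remaining side is only reinforced. -/
theorem jac_part_lt (h : IsSlopeSystem c γ r R H k) (hc : 0 < c) (hγ : 0 < γ)
    (hk1 : ∀ t ∈ Icc 1 r, k t < 1) {j s τ : ℝ} (hj : 0 < j) (hs : s ∈ Icc 1 r)
    (hτ : τ ∈ Icc 1 r) (hj1 : k s < j → s = r) (hj2 : j < k s → s = 1) (hne : τ ≠ s) :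
    H s ^ 2 * (γ * (2 * k s * j + 1 - k s ^ 2) - jacCoeff c γ H k s * j / c) <
      H τ ^ 2 * (γ * (2 * k s * j + 1 - k s ^ 2) - jacCoeff c γ H k τ * j / c) := by
  have hanti := h.kappa_strictAntiOn hc hγ hk1
  have hks := h.slope_pos s hs
  have hks1 : 0 < 1 - k s ^ 2 := by nlinarith [hk1 s hs]
  have hκs : kappa k s = k s + 1 / k s := rfl
  refine lt_of_deriv_sign
    (g := fun τ => H τ ^ 2 * (γ * (2 * k s * j + 1 - k s ^ 2) - jacCoeff c γ H k τ * j / c))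
    (g' := fun t => 2 * k t * H t ^ 2 / (c * t) *
      (γ * (2 * k s * j + 1 - k s ^ 2 - j * kappa k t))) hs
    (fun t ht => ?_) (fun t ht => ?_) (fun t ht => ?_) τ hτ hne
  · refine (((h.hasDeriv t ht).pow 2).mul
      ((((h.hasDeriv_jacCoeff hc hγ ht).mul_const j).div_const c).const_sub _)).congr_deriv ?_
    have ht0 : 0 < t := zero_lt_one.trans_le ht.1
    simp only [Pi.pow_apply]
    field_simp
    ring
  · have htI : t ∈ Icc 1 r := ⟨ht.1.le, ht.2.le.trans hs.2⟩
    have ht0 : 0 < t := zero_lt_one.trans ht.1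
    have hH := h.pos t htI
    have hk := h.slope_pos t htI
    have h1 : kappa k s < kappa k t := hanti htI hs ht.2
    have h2 : k s ≤ j := by
      by_contra hcon
      have := hj2 (by linarith)
      linarith [ht.1, ht.2]
    have h3 : 2 * k s * j + 1 - k s ^ 2 - j * kappa k s ≤ 0 := by
      have : 2 * k s * j + 1 - k s ^ 2 - j * kappa k s = - ((1 - k s ^ 2) * (j - k s) / k s) := by
        rw [hκs]; field_simp; ring
      rw [this]
      have : 0 ≤ (1 - k s ^ 2) * (j - k s) / k s :=
        div_nonneg (mul_nonneg hks1.le (by linarith)) hks.le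
      linarith
    have h4 : γ * (2 * k s * j + 1 - k s ^ 2 - j * kappa k t) < 0 :=
      mul_neg_of_pos_of_neg hγ (by nlinarith)
    exact mul_neg_of_pos_of_neg (by positivity) h4
  · have htI : t ∈ Icc 1 r := ⟨hs.1.trans ht.1.le, ht.2.le⟩
    have ht0 : 0 < t := zero_lt_one.trans_le htI.1
    have hH := h.pos t htI
    have hk := h.slope_pos t htI
    have h1 : kappa k t < kappa k s := hanti hs htI ht.1
    have h2 : j ≤ k s := by
      by_contra hcon
      have := hj1 (by linarith)
      linarith [ht.1, ht.2]
    have h3 : 0 ≤ 2 * k s * j + 1 - k s ^ 2 - j * kappa k s := by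
      have : 2 * k s * j + 1 - k s ^ 2 - j * kappa k s = (1 - k s ^ 2) * (k s - j) / k s := by
        rw [hκs]; field_simp; ring
      rw [this]
      exact div_nonneg (mul_nonneg hks1.le (by linarith)) hks.le
    have h4 : 0 < γ * (2 * k s * j + 1 - k s ^ 2 - j * kappa k t) :=
      mul_pos hγ (by nlinarith)
    exact mul_pos (by positivity) h4

/-- As b' = -s² κ', the derivative in s is κ'(s)(t² - s²), which changes sign from negative to
positive at s = t. -/
theorem momentum_add_kappa_lt (h : IsSlopeSystem c γ r R H k) (hc : 0 < c) (hγ : 0 < γ)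
    (hk1 : ∀ t ∈ Icc 1 r, k t < 1) {s t : ℝ} (hs : s ∈ Icc 1 r) (ht : t ∈ Icc 1 r) (hne : s ≠ t) :
    momentum c γ H k t + t ^ 2 * kappa k t < momentum c γ H k s + t ^ 2 * kappa k s := by
  refine lt_of_deriv_sign (g := fun s => momentum c γ H k s + t ^ 2 * kappa k s)
    (g' := fun s => kappaRate c γ H k s * (t ^ 2 - s ^ 2)) ht
    (fun x hx => ?_) (fun x hx => ?_) (fun x hx => ?_) s hs hne
  · refine ((h.hasDeriv_momentum hc hγ hx).add
      ((h.hasDeriv_kappa hx).const_mul (t ^ 2))).congr_deriv ?_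
    ring
  · have hxI : x ∈ Icc 1 r := ⟨hx.1.le, hx.2.le.trans ht.2⟩
    have := h.kappaRate_neg hc hγ hk1 hxI
    exact mul_neg_of_neg_of_pos this (by nlinarith [hx.1, hx.2])
  · have hxI : x ∈ Icc 1 r := ⟨ht.1.trans hx.1.le, hx.2.le⟩
    have := h.kappaRate_neg hc hγ hk1 hxI
    exact mul_pos_of_neg_of_neg this (by nlinarith [hx.1, hx.2, ht.1])

end IsSlopeSystem

end CombinedEnergy

namespace CombinedEnergy

namespace IsSlopeSystem

variable {c γ r R : ℝ} {H k : ℝ → ℝ}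

/-- The remainder of the calibration inequality after the coefficients have been moved to the
optimal parameters. -/
theorem remainder_nonneg (h : IsSlopeSystem c γ r R H k) (hc : 0 < c) (hγ : 0 < γ)
    (hk1 : ∀ t ∈ Icc 1 r, k t < 1) {x j s t' : ℝ} (hx : 0 < x) (hj : 0 < j)
    (hs : s ∈ Icc 1 r) (ht' : t' ∈ Icc 1 r) (hx1 : t' < x → t' = r) (hx2 : x < t' → t' = 1)
    (hj1 : k s < j → s = r) (hj2 : j < k s → s = 1) :
    0 ≤ (momentum c γ H k s - momentum c γ H k t' + x ^ 2 * (kappa k s - kappa k t')) +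
      momentum c γ H k t' * (1 - x / t') ^ 2 +
      (1 - k s ^ 2) * ((j - k s) / k s) * (s ^ 2 / k s - x ^ 2 / j) ∧
    ((momentum c γ H k s - momentum c γ H k t' + x ^ 2 * (kappa k s - kappa k t')) +
      momentum c γ H k t' * (1 - x / t') ^ 2 +
      (1 - k s ^ 2) * ((j - k s) / k s) * (s ^ 2 / k s - x ^ 2 / j) = 0 →
      s = t' ∧ x = s ∧ j = k s) := by
  have hks := h.slope_pos s hs
  have hHs := h.pos s hs
  have hs0 : 0 < s := zero_lt_one.trans_le hs.1
  have hks1 : 0 < 1 - k s ^ 2 := by nlinarith [hk1 s hs]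
  -- If the two clamped parameters coincide, the remainder is a sum of two squares. Otherwise each
  -- summand is nonnegative after regrouping, and the first is strictly positive.
  by_cases hst : s = t'
  · subst hst
    have e : (momentum c γ H k s - momentum c γ H k s + x ^ 2 * (kappa k s - kappa k s)) +
        momentum c γ H k s * (1 - x / s) ^ 2 +
        (1 - k s ^ 2) * ((j - k s) / k s) * (s ^ 2 / k s - x ^ 2 / j) =
        (1 - k s ^ 2) * (γ * H s ^ 2 / c) * (1 - x / s) ^ 2 +
        (1 - k s ^ 2) / (k s ^ 2 * j) * (s * j - x * k s) ^ 2 := by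
      unfold momentum
      field_simp
      ring
    rw [e]
    refine ⟨by positivity, fun h0 => ?_⟩
    have a1 : 0 ≤ (1 - k s ^ 2) * (γ * H s ^ 2 / c) * (1 - x / s) ^ 2 := by positivity
    have a2 : 0 ≤ (1 - k s ^ 2) / (k s ^ 2 * j) * (s * j - x * k s) ^ 2 := by positivity
    have b1 : (1 - k s ^ 2) * (γ * H s ^ 2 / c) * (1 - x / s) ^ 2 = 0 := by linarith
    have b2 : (1 - k s ^ 2) / (k s ^ 2 * j) * (s * j - x * k s) ^ 2 = 0 := by linarith
    have c1 : 1 - x / s = 0 :=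
      pow_eq_zero_iff two_ne_zero |>.1 ((mul_eq_zero.1 b1).resolve_left (by positivity))
    have c2 : s * j - x * k s = 0 :=
      pow_eq_zero_iff two_ne_zero |>.1 ((mul_eq_zero.1 b2).resolve_left (by positivity))
    have c3 : x = s := by field_simp at c1; linarith
    refine ⟨rfl, c3, ?_⟩
    rw [c3] at c2
    have : s * (j - k s) = 0 := by linarith
    have := (mul_eq_zero.1 this).resolve_left hs0.ne'
    linarith
  · have h1 := h.momentum_add_kappa_lt hc hγ hk1 hs ht' hst
    have hanti := h.kappa_strictAntiOn hc hγ hk1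
    -- If x exceeds `t'`, then `t'` is the right endpoint and s lies to its left, so both factors
    -- are nonnegative; the other side is symmetric.
    have h2 : 0 ≤ (x ^ 2 - t' ^ 2) * (kappa k s - kappa k t') := by
      have ht0 : 0 < t' := zero_lt_one.trans_le ht'.1
      rcases lt_trichotomy t' x with hlt | heq | hlt
      · have : kappa k t' ≤ kappa k s := hanti.antitoneOn hs ht' (by rw [hx1 hlt]; exact hs.2)
        exact mul_nonneg (by nlinarith) (by linarith)
      · simp [heq]
      · have : kappa k s ≤ kappa k t' := hanti.antitoneOn ht' hs (by rw [hx2 hlt]; exact hs.1)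
        exact mul_nonneg_of_nonpos_of_nonpos (by nlinarith) (by linarith)
    -- When j exceeds k(s), s = r; as `t'` differs from s, x cannot lie beyond r. Hence both factors
    -- have the same sign, and symmetrically at the left endpoint.
    have h3 : 0 ≤ ((j - k s) / k s) * (s ^ 2 / k s - x ^ 2 / j) := by
      have e : ((j - k s) / k s) * (s ^ 2 / k s - x ^ 2 / j) =
          ((j - k s) * (s ^ 2 * j - x ^ 2 * k s)) / (k s ^ 2 * j) := by
        field_simp
      rw [e]
      apply div_nonneg _ (by positivity)
      rcases lt_trichotomy (k s) j with hlt | heq | hlt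
      · have hsr := hj1 hlt
        have hxs : x ≤ s := by
          by_contra hcon
          have h5 : t' < x := by linarith [ht'.2]
          exact hst (by rw [hsr, hx1 h5])
        exact mul_nonneg (by linarith) (by nlinarith [mul_le_mul hxs hxs hx.le hs0.le])
      · simp [heq]
      · have hsr := hj2 hlt
        have hxs : s ≤ x := by
          by_contra hcon
          have h5 : x < t' := by linarith [ht'.1]
          exact hst (by rw [hsr, hx2 h5])
        exact mul_nonneg_of_nonpos_of_nonpos (by linarith)
          (by nlinarith [mul_le_mul hxs hxs hs0.le hx.le])
    have h4 : 0 ≤ (1 - k s ^ 2) * ((j - k s) / k s) * (s ^ 2 / k s - x ^ 2 / j) := by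
      rw [mul_assoc]; exact mul_nonneg hks1.le h3
    have h5 : 0 ≤ momentum c γ H k t' * (1 - x / t') ^ 2 := by
      have := h.momentum_pos hc hγ hk1 ht'
      positivity
    have h6 : 0 < (momentum c γ H k s - momentum c γ H k t' +
        x ^ 2 * (kappa k s - kappa k t')) := by nlinarith
    exact ⟨by linarith, fun h0 => by linarith⟩

theorem exists_slope_clamp (h : IsSlopeSystem c γ r R H k) (hr : 1 < r) (j : ℝ) :
    ∃ s ∈ Icc 1 r, (k s < j → s = r) ∧ (j < k s → s = 1) := by
  by_cases h1 : j < k 1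
  · refine ⟨1, ⟨le_rfl, hr.le⟩, fun h2 => by linarith, fun _ => rfl⟩
  by_cases h2 : k r < j
  · refine ⟨r, ⟨hr.le, le_rfl⟩, fun _ => rfl, fun h3 => by linarith⟩
  obtain ⟨s, hs, rfl⟩ := intermediate_value_Icc hr.le h.continuousOn_slope
    (show j ∈ Icc (k 1) (k r) from ⟨not_lt.1 h1, not_lt.1 h2⟩)
  exact ⟨s, hs, fun h3 => absurd h3 (lt_irrefl _), fun h3 => absurd h3 (lt_irrefl _)⟩

/-- The heart of the calibration inequality. In the scale-free variables x and j the gap splits into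
three nonnegative parts: replacing τ by s, replacing t by the clamp of x, and a remainder in which
only optimal parameters occur. The image radius is written H(τ), with τ independent of t. -/
theorem reduced_bound (h : IsSlopeSystem c γ r R H k) (hr : 1 < r) (hc : 1 / 2 ≤ c) (hγ : 0 < γ)
    (hk1 : ∀ t ∈ Icc 1 r, k t < 1) {t τ u J : ℝ} (ht : t ∈ Icc 1 r) (hτ : τ ∈ Icc 1 r)
    (hu : 0 < u) (hJ : 0 < J) :
    ∃ s ∈ Icc 1 r,
      angCoeff c γ H k t * u / H τ + jacCoeff c γ H k τ * J + constCoeff c γ H k t ≤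
        reducedLagrangian c γ (k s) u J ∧
      (angCoeff c γ H k t * u / H τ + jacCoeff c γ H k τ * J + constCoeff c γ H k t =
        reducedLagrangian c γ (k s) u J → t = τ ∧ s = τ ∧ u = H t / t) := by
  have hc0 : 0 < c := by linarith
  have hH := h.pos τ hτ
  -- Along the radial map u = H/t and J = HH'/t, so x = t and j = k(t) there.
  set x := H τ / u with hx
  have hx0 : 0 < x := by positivity
  set j := c * J / u ^ 2 with hj
  have hj0 : 0 < j := by positivity
  obtain ⟨s, hs, hj1, hj2⟩ := h.exists_slope_clamp hr j
  obtain ⟨t', ht', hx1, hx2⟩ : ∃ t' ∈ Icc 1 r, (t' < x → t' = r) ∧ (x < t' → t' = 1) := by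
    refine ⟨max 1 (min x r), ⟨le_max_left _ _, max_le hr.le (min_le_right _ _)⟩, fun h1 => ?_,
      fun h1 => ?_⟩
    · rcases le_total x r with h2 | h2
      · rw [min_eq_left h2] at h1
        exact absurd h1 (not_lt.2 (le_max_right _ _))
      · rw [min_eq_right h2, max_eq_right hr.le]
    · rcases le_total x r with h2 | h2
      · rw [min_eq_left h2] at h1 ⊢
        rcases lt_max_iff.1 h1 with h3 | h3
        · exact max_eq_left h3.le
        · exact absurd h3 (lt_irrefl _)
      · rw [min_eq_right h2, max_eq_right hr.le] at h1
        linarith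
  have hks := h.slope_pos s hs
  have hHs := h.pos s hs
  have ht0' : 0 < t' := zero_lt_one.trans_le ht'.1
  have hrem := h.remainder_nonneg hc0 hγ hk1 hx0 hj0 hs ht' hx1 hx2 hj1 hj2
  -- The three lines on the right are the gaps of `jac_part_lt`, `ang_add_const_lt` and
  -- `remainder_nonneg`; the vanishing of all three gives s = τ = t = x and j = k(s).
  have e1 : reducedLagrangian c γ (k s) u J -
      (angCoeff c γ H k t * u / H τ + jacCoeff c γ H k τ * J + constCoeff c γ H k t) =
      (H τ ^ 2 * (γ * (2 * k s * j + 1 - k s ^ 2) - jacCoeff c γ H k τ * j / c) -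
        H s ^ 2 * (γ * (2 * k s * j + 1 - k s ^ 2) - jacCoeff c γ H k s * j / c)) / x ^ 2 +
      ((angCoeff c γ H k t' / x + constCoeff c γ H k t') -
        (angCoeff c γ H k t / x + constCoeff c γ H k t)) +
      c / x ^ 2 * ((momentum c γ H k s - momentum c γ H k t' + x ^ 2 * (kappa k s - kappa k t')) +
      momentum c γ H k t' * (1 - x / t') ^ 2 +
      (1 - k s ^ 2) * ((j - k s) / k s) * (s ^ 2 / k s - x ^ 2 / j)) := by
    have e2 : u = H τ / x := by rw [hx]; field_simp
    have e3 : J = j * u ^ 2 / c := by rw [hj]; field_simp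
    have e4 : jacCoeff c γ H k s = 2 * γ * c * k s -
      (1 - k s ^ 2) * c ^ 2 * s ^ 2 / (k s ^ 2 * H s ^ 2) := rfl
    have e5 : angCoeff c γ H k t' = 2 * c * momentum c γ H k t' / t' := rfl
    have e6 : constCoeff c γ H k t' = c * kappa k t' - c * momentum c γ H k t' / t' ^ 2 := rfl
    have e7 : momentum c γ H k s = (1 - k s ^ 2) * (γ * H s ^ 2 / c + s ^ 2 / k s) := rfl
    have e8 : kappa k s = k s + 1 / k s := rfl
    clear_value x j
    rw [e4, e5, e6, e7, e8, e3, e2]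
    unfold reducedLagrangian
    generalize k s = ks at *
    generalize H s = ys at *
    generalize H τ = y at *
    generalize momentum c γ H k t' = b at *
    generalize kappa k t' = κ at *
    generalize angCoeff c γ H k t = b1 at *
    generalize constCoeff c γ H k t = d1 at *
    generalize jacCoeff c γ H k τ = j1 at *
    field_simp
    ring
  have a1 : 0 ≤ c / x ^ 2 * ((momentum c γ H k s - momentum c γ H k t' +
      x ^ 2 * (kappa k s - kappa k t')) +
      momentum c γ H k t' * (1 - x / t') ^ 2 +
      (1 - k s ^ 2) * ((j - k s) / k s) * (s ^ 2 / k s - x ^ 2 / j)) :=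
    mul_nonneg (by positivity) hrem.1
  have a2 : 0 ≤ (H τ ^ 2 * (γ * (2 * k s * j + 1 - k s ^ 2) - jacCoeff c γ H k τ * j / c) -
        H s ^ 2 * (γ * (2 * k s * j + 1 - k s ^ 2) - jacCoeff c γ H k s * j / c)) / x ^ 2 ∧
      (τ ≠ s → 0 < (H τ ^ 2 * (γ * (2 * k s * j + 1 - k s ^ 2) - jacCoeff c γ H k τ * j / c) -
        H s ^ 2 * (γ * (2 * k s * j + 1 - k s ^ 2) - jacCoeff c γ H k s * j / c)) / x ^ 2) := by
    have : τ ≠ s → 0 < (H τ ^ 2 * (γ * (2 * k s * j + 1 - k s ^ 2) - jacCoeff c γ H k τ * j / c) -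
        H s ^ 2 * (γ * (2 * k s * j + 1 - k s ^ 2) - jacCoeff c γ H k s * j / c)) / x ^ 2 := by
      intro hne
      have := h.jac_part_lt hc0 hγ hk1 hj0 hs hτ hj1 hj2 hne
      exact div_pos (by linarith) (by positivity)
    refine ⟨?_, this⟩
    by_cases hne : τ = s
    · simp [hne]
    · exact (this hne).le
  have a3 : 0 ≤ ((angCoeff c γ H k t' / x + constCoeff c γ H k t') -
        (angCoeff c γ H k t / x + constCoeff c γ H k t)) ∧
      (t ≠ t' → 0 < ((angCoeff c γ H k t' / x + constCoeff c γ H k t') -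
        (angCoeff c γ H k t / x + constCoeff c γ H k t))) := by
    have : t ≠ t' → 0 < ((angCoeff c γ H k t' / x + constCoeff c γ H k t') -
        (angCoeff c γ H k t / x + constCoeff c γ H k t)) := by
      intro hne
      have := h.ang_add_const_lt hc hγ hk1 hx0 ht ht' hx1 hx2 hne
      linarith
    refine ⟨?_, this⟩
    by_cases hne : t = t'
    · simp [hne]
    · exact (this hne).le
  refine ⟨s, hs, by linarith [a2.1, a3.1], fun he => ?_⟩
  rw [he, sub_self] at e1
  have b1 : τ = s := by
    by_contra hne
    have := a2.2 hne
    linarith [a3.1]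
  have b2 : t = t' := by
    by_contra hne
    have := a3.2 hne
    linarith [a2.1]
  have b3 : c / x ^ 2 * ((momentum c γ H k s - momentum c γ H k t' +
      x ^ 2 * (kappa k s - kappa k t')) +
      momentum c γ H k t' * (1 - x / t') ^ 2 +
      (1 - k s ^ 2) * ((j - k s) / k s) * (s ^ 2 / k s - x ^ 2 / j)) = 0 := by
    linarith [a2.1, a3.1]
  obtain ⟨d1, d2, d3⟩ := hrem.2 ((mul_eq_zero.1 b3).resolve_left (by positivity))
  have htτ : t = τ := by rw [b2, b1, d1]
  refine ⟨htτ, b1.symm, ?_⟩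
  have h1 : H τ / u = t := by rw [← hx, d2, b2, d1]
  have ht0 : 0 < t := zero_lt_one.trans_le ht.1
  rw [div_eq_iff hu.ne', htτ] at h1
  rw [eq_div_iff ht0.ne', htτ]
  linarith

theorem exists_strictCalibration (h : IsSlopeSystem c γ r R H k) (hr : 1 < r) (hc : 1 / 2 ≤ c)
    (hγ : 0 < γ) (hk1 : ∀ t ∈ Icc 1 r, k t < 1) :
    ∃ F, IsStrictCalibration c γ r R H (fun t => k t * H t / (c * t)) F := by
  have hc0 : 0 < c := by linarith
  obtain ⟨K, hK, hKH, hHK⟩ := (h.isRadialProfile hc0).exists_inverse hr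
  have hbound : ∀ t ∈ Icc 1 r, ∀ τ ∈ Icc 1 r, ∀ p q s u : ℝ, 0 < p * u - q * s →
      angCoeff c γ H k t * u / H τ + jacCoeff c γ H k τ * (p * u - q * s) + constCoeff c γ H k t ≤
        lagrangian c γ p q s u ∧
      (angCoeff c γ H k t * u / H τ + jacCoeff c γ H k τ * (p * u - q * s) + constCoeff c γ H k t =
        lagrangian c γ p q s u → t = τ ∧ p = k t * H t / (c * t) ∧ q = 0 ∧ s = 0 ∧ u = H t / t) := by
    intro t ht τ hτ p q s u hJ
    have hang : 0 < angCoeff c γ H k t := by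
      have := h.momentum_pos hc0 hγ hk1 ht
      have : 0 < t := zero_lt_one.trans_le ht.1
      unfold angCoeff
      positivity
    have hH := h.pos τ hτ
    rcases lt_trichotomy u 0 with hu | hu | hu
    -- For u < 0 compare with -u: the reduced Lagrangian is even in u, while the term with B > 0
    -- becomes smaller, so the inequality is strict.
    · obtain ⟨σ, hσ, h1, -⟩ := h.reduced_bound hr hc hγ hk1 ht hτ (neg_pos.2 hu) hJ
      have e : reducedLagrangian c γ (k σ) (-u) (p * u - q * s) =
          reducedLagrangian c γ (k σ) u (p * u - q * s) := by
        unfold reducedLagrangian; rw [neg_sq]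
      have h2 := (reducedLagrangian_le (c := c) hγ (h.slope_pos σ hσ) (hk1 σ hσ) hJ).1
      have h3 : angCoeff c γ H k t * u / H τ < 0 :=
        div_neg_of_neg_of_pos (mul_neg_of_pos_of_neg hang hu) hH
      have h4 : angCoeff c γ H k t * -u / H τ = - (angCoeff c γ H k t * u / H τ) := by ring
      rw [e, h4] at h1
      exact ⟨by linarith, fun he => by linarith⟩
    -- For u = 0 the parameter s = r is best: k is largest there, and it dominates C and D by 2γc
    -- k(r) and 2c k(r).
    · subst hu
      have hr' : r ∈ Icc 1 r := ⟨hr.le, le_rfl⟩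
      have h2 := (reducedLagrangian_le (c := c) hγ (h.slope_pos r hr') (hk1 r hr') hJ).1
      have hanti := h.kappa_strictAntiOn hc0 hγ hk1
      have hkmono : ∀ x ∈ Icc 1 r, k x ≤ k r := by
        intro x hx
        by_contra hcon
        have h5 := hanti.antitoneOn hx hr' hx.2
        have h6 := h.slope_pos r hr'
        have h7 := h.slope_pos x hx
        have h8 := hk1 x hx
        have h9 := hk1 r hr'
        unfold kappa at h5
        have : k r + 1 / k r - (k x + 1 / k x) = (k x - k r) * (1 / (k r * k x) - 1) := by
          field_simp; ring
        have h10 : 1 < 1 / (k r * k x) := by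
          rw [lt_div_iff₀ (by positivity)]; nlinarith
        nlinarith
      have h3 : jacCoeff c γ H k τ < 2 * γ * c * k r := by
        have h5 : 0 < 1 - k τ ^ 2 := by nlinarith [hk1 τ hτ, h.slope_pos τ hτ]
        have h6 : 0 < (1 - k τ ^ 2) * c ^ 2 * τ ^ 2 / (k τ ^ 2 * H τ ^ 2) := by
          have := h.slope_pos τ hτ
          have : 0 < τ := zero_lt_one.trans_le hτ.1
          positivity
        have h7 := hkmono τ hτ
        have h8 : 2 * γ * c * k τ ≤ 2 * γ * c * k r := by gcongr
        unfold jacCoeff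
        linarith
      have h4 : constCoeff c γ H k t ≤ 2 * c * k r := by
        have e : constCoeff c γ H k t = 2 * c * k t - (1 - k t ^ 2) * γ * H t ^ 2 / t ^ 2 := by
          have := h.slope_pos t ht
          have : 0 < t := zero_lt_one.trans_le ht.1
          unfold constCoeff momentum kappa
          field_simp
          ring
        have h5 : 0 < 1 - k t ^ 2 := by nlinarith [hk1 t ht, h.slope_pos t ht]
        have h6 : 0 ≤ (1 - k t ^ 2) * γ * H t ^ 2 / t ^ 2 := by positivity
        have h7 := hkmono t ht
        have h8 : 2 * c * k t ≤ 2 * c * k r := by gcongr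
        linarith
      have h5 : reducedLagrangian c γ (k r) 0 (p * 0 - q * s) =
          2 * γ * c * k r * (p * 0 - q * s) + 2 * c * k r := by
        unfold reducedLagrangian; ring
      have h6 := mul_lt_mul_of_pos_right h3 hJ
      have h7 : angCoeff c γ H k t * 0 / H τ = 0 := by simp
      rw [h7]
      exact ⟨by linarith, fun he => by linarith⟩
    · obtain ⟨σ, hσ, h1, h2⟩ := h.reduced_bound hr hc hγ hk1 ht hτ hu hJ
      have h3 := reducedLagrangian_le (c := c) hγ (h.slope_pos σ hσ) (hk1 σ hσ) hJ
      refine ⟨h1.trans h3.1, fun he => ?_⟩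
      obtain ⟨htτ, hστ, hu'⟩ := h2 (le_antisymm h1 (he ▸ h3.1))
      obtain ⟨hp, hq, hs⟩ := h3.2 (le_antisymm (he ▸ h1) h3.1)
      refine ⟨htτ, ?_, hq, hs, hu'⟩
      have ht0 : 0 < t := zero_lt_one.trans_le ht.1
      rw [hστ, ← htτ, hu'] at hp
      field_simp at hp ⊢
      linarith
  refine ⟨⟨fun _ => 0, angCoeff c γ H k, fun ρ => jacCoeff c γ H k (K ρ), constCoeff c γ H k⟩,
    ⟨continuousOn_const, fun t ht => (h.hasDeriv_angCoeff hc0 hγ ht).continuousWithinAt,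
      ContinuousOn.comp (g := jacCoeff c γ H k)
        (fun t ht => (h.hasDeriv_jacCoeff hc0 hγ ht).continuousWithinAt) hK.continuousOn hK.mapsTo,
      fun t ht => (h.hasDeriv_constCoeff hc0 hγ ht).continuousWithinAt⟩, ?_, ?_, ?_⟩
  · intro t ht ρ hρ p q s u hJ
    have := (hbound t ht (K ρ) (hK.mapsTo hρ) p q s u hJ).1
    rw [hHK ρ hρ] at this
    simpa [FreeLagrangian.eval] using this
  · intro t ht
    have ht0 : 0 < t := zero_lt_one.trans_le ht.1
    have hk := h.slope_pos t ht
    have hH := h.pos t ht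
    simp only [FreeLagrangian.eval, hKH t ht, angCoeff, jacCoeff, constCoeff, kappa, momentum,
      lagrangian]
    field_simp
    ring
  · intro t ht ρ hρ p q s u hJ he
    have := (hbound t ht (K ρ) (hK.mapsTo hρ) p q s u hJ).2 (by
      rw [hHK ρ hρ]; simpa [FreeLagrangian.eval] using he)
    obtain ⟨h1, h2⟩ := this
    exact ⟨by rw [h1, hHK ρ hρ], h2⟩

end IsSlopeSystem

end CombinedEnergy

namespace CombinedEnergy

/-! ### Existence of radial solutions by shooting -/

theorem slopeRate_nonneg {c γ t y k : ℝ} (hc : 0 < c) (hγ : 0 < γ) (ht : 0 < t) (hk : 0 ≤ k)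
    (hk1 : k ≤ 1) : 0 ≤ slopeRate c γ t y k := by
  have : 0 ≤ 1 - k ^ 2 := by nlinarith
  unfold slopeRate
  positivity

/-- The vector field of the slope system, on `(t, H, k)`. -/
noncomputable def slopeField (c γ : ℝ) (x : ℝ × ℝ × ℝ) : ℝ × ℝ :=
  (x.2.2 * x.2.1 / (c * x.1), slopeRate c γ x.1 x.2.1 x.2.2)

theorem contDiffOn_slopeField {c γ : ℝ} (hc : 0 < c) (hγ : 0 < γ) (r M : ℝ) :
    ContDiffOn ℝ 1 (slopeField c γ) (Icc 1 r ×ˢ Icc 1 M ×ˢ Icc 0 1) := by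
  have h1 : ∀ x ∈ Icc (1 : ℝ) r ×ˢ Icc (1 : ℝ) M ×ˢ Icc (0 : ℝ) 1, 0 < x.1 := fun x hx =>
    zero_lt_one.trans_le hx.1.1
  have hw : ContDiffOn ℝ 1 (fun x : ℝ × ℝ × ℝ => γ * x.2.1 ^ 2 / (c * x.1 ^ 2))
      (Icc 1 r ×ˢ Icc 1 M ×ˢ Icc 0 1) :=
    ContDiffOn.div (by fun_prop) (by fun_prop) fun x hx => by have := h1 x hx; positivity
  refine ContDiffOn.prodMk ?_ ?_
  · exact ContDiffOn.div (by fun_prop) (by fun_prop) fun x hx => by have := h1 x hx; positivity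
  · unfold slopeRate
    refine ContDiffOn.div ?_ ?_ fun x hx => ?_
    · refine ContDiffOn.mul (ContDiffOn.mul ?_ (by fun_prop)) ?_
      · exact ContDiffOn.div (by fun_prop) (by fun_prop) fun x hx => by
          have := h1 x hx; positivity
      · exact contDiffOn_const.add ((hw.mul (by fun_prop)).div_const c)
    · exact contDiffOn_const.add (hw.mul (by fun_prop))
    · have := h1 x hx
      have := hx.2.2.1
      positivity

/-- The slope vector field with clamped arguments. -/
noncomputable def clampedField (c γ M t : ℝ) (x : ℝ × ℝ) : ℝ × ℝ :=
  slopeField c γ (t, max 1 (min x.1 M), max 0 (min x.2 1))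

/-- Clamping the arguments makes the field bounded and Lipschitz on the whole plane, so that
Picard–Lindelöf reaches t = r in one step with Lipschitz dependence on the initial slope κ. At κ = 0
the solution rests at (1, 0), which is the lower end of the shooting range. -/
theorem exists_shooting_flow {c γ r M : ℝ} (hc : 0 < c) (hγ : 0 < γ) (hr : 1 < r) (hM : 1 ≤ M) :
    ∃ α : ℝ → ℝ → ℝ × ℝ,
      (∀ κ ∈ Icc (0 : ℝ) 1, α κ 1 = (1, κ) ∧ ∀ t ∈ Icc 1 r,
        HasDerivWithinAt (α κ) (clampedField c γ M t (α κ t)) (Icc 1 r) t) ∧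
      ContinuousOn (fun κ => (α κ r).1) (Icc 0 1) ∧ α 0 r = (1, 0) := by
  set S : Set (ℝ × ℝ × ℝ) := Icc 1 r ×ˢ Icc 1 M ×ˢ Icc 0 1 with hS
  have hScomp : IsCompact S := isCompact_Icc.prod (isCompact_Icc.prod isCompact_Icc)
  have hSconv : Convex ℝ S := (convex_Icc _ _).prod ((convex_Icc _ _).prod (convex_Icc _ _))
  have hmem : ∀ t ∈ Icc 1 r, ∀ x : ℝ × ℝ, (t, max 1 (min x.1 M), max 0 (min x.2 1)) ∈ S := by
    intro t ht x
    exact ⟨ht, ⟨le_max_left _ _, max_le hM (min_le_right _ _)⟩,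
      ⟨le_max_left _ _, max_le zero_le_one (min_le_right _ _)⟩⟩
  have hcd := contDiffOn_slopeField hc hγ r M
  obtain ⟨K, hK⟩ := hcd.exists_lipschitzOnWith (by norm_num) hSconv hScomp
  obtain ⟨L, hL⟩ := hScomp.exists_bound_of_continuousOn hcd.continuousOn
  have hL0 : 0 ≤ L := (norm_nonneg _).trans (hL _ (hmem 1 ⟨le_rfl, hr.le⟩ (0, 0)))
  have hlip : ∀ t ∈ Icc 1 r, LipschitzWith K (clampedField c γ M t) := by
    intro t ht
    have hclamp : LipschitzWith 1 (fun x : ℝ × ℝ =>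
        ((t, max 1 (min x.1 M), max 0 (min x.2 1)) : ℝ × ℝ × ℝ)) := by
      have a1 : LipschitzWith 1 (fun x : ℝ × ℝ => max 1 (min x.1 M)) :=
        (LipschitzWith.prod_fst.min_const M).const_max 1
      have a2 : LipschitzWith 1 (fun x : ℝ × ℝ => max 0 (min x.2 1)) :=
        (LipschitzWith.prod_snd.min_const 1).const_max 0
      have a3 := ((LipschitzWith.const (α := ℝ × ℝ) t).prodMk (a1.prodMk a2))
      simpa using a3
    have := hK.comp (hclamp.lipschitzOnWith (s := univ)) (fun x _ => hmem t ht x)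
    rw [mul_one] at this
    exact lipschitzOnWith_univ.1 this
  -- The initial data lie in the ball of radius 1/2 about (1, 1/2); a solution moves by at most L(r
  -- - 1).
  let a : NNReal := 1 / 2 + L.toNNReal * (r - 1).toNNReal
  have hPL : IsPicardLindelof (clampedField c γ M) (tmin := 1) (tmax := r) ⟨1, le_rfl, hr.le⟩
      ((1, 1 / 2) : ℝ × ℝ) a (1 / 2) L.toNNReal K := by
    refine ⟨fun t ht => (hlip t ht).lipschitzOnWith, fun x _ => ?_, fun t ht x _ => ?_, ?_⟩
    · exact hcd.continuousOn.comp (by fun_prop) fun t ht => hmem t ht x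
    · rw [Real.coe_toNNReal L hL0]; exact hL _ (hmem t ht x)
    · have h1 : (0 : ℝ) ≤ r - 1 := by linarith
      simp [a, Real.coe_toNNReal L hL0, Real.coe_toNNReal _ h1, h1]
  obtain ⟨α, hα, L', hL'⟩ :=
    hPL.exists_forall_mem_closedBall_eq_hasDerivWithinAt_lipschitzOnWith
  have hball : ∀ κ ∈ Icc (0 : ℝ) 1, ((1, κ) : ℝ × ℝ) ∈ Metric.closedBall ((1, 1 / 2) : ℝ × ℝ)
      ((1 / 2 : NNReal) : ℝ) := by
    intro κ hκ
    rw [Metric.mem_closedBall, Prod.dist_eq]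
    simp only [dist_self, Real.dist_eq]
    refine max_le (by simp) ?_
    rw [abs_le]
    constructor <;> [skip; skip] <;> simp <;> linarith [hκ.1, hκ.2]
  refine ⟨fun κ => α (1, κ), fun κ hκ => hα _ (hball κ hκ), ?_, ?_⟩
  · have h1 : ContinuousOn (fun x => α x r) (Metric.closedBall ((1, 1 / 2) : ℝ × ℝ)
      ((1 / 2 : NNReal) : ℝ)) := (hL' r ⟨hr.le, le_rfl⟩).continuousOn
    exact continuous_fst.comp_continuousOn (h1.comp (by fun_prop) hball)
  · obtain ⟨h0, h1⟩ := hα _ (hball 0 ⟨le_rfl, zero_le_one⟩)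
    have hz : ∀ t ∈ Icc 1 r, clampedField c γ M t (1, 0) = 0 := by
      intro t ht
      simp [clampedField, slopeField, slopeRate]
    have hmono : ∀ t ∈ Ico 1 r, Icc 1 r ∈ 𝓝[Ici t] t := fun t ht =>
      mem_of_superset (Icc_mem_nhdsGE ht.2) (Icc_subset_Icc_left ht.1)
    have := ODE_solution_unique_of_mem_Icc_right (v := clampedField c γ M) (s := fun _ => univ)
      (K := K) (f := α (1, 0)) (g := fun _ => (1, 0)) (a := 1) (b := r)
      (fun t ht => (hlip t (Ico_subset_Icc_self ht)).lipschitzOnWith)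
      (fun t ht => (h1 t ht).continuousWithinAt)
      (fun t ht => (h1 t (Ico_subset_Icc_self ht)).mono_of_mem_nhdsWithin (hmono t ht))
      (fun _ _ => mem_univ _) continuousOn_const
      (fun t ht => by
        rw [hz t (Ico_subset_Icc_self ht)]; exact hasDerivWithinAt_const _ _ _)
      (fun _ _ => mem_univ _) h0
    exact this ⟨hr.le, le_rfl⟩

/-- These a priori bounds show that the clamps are inactive along the solutions, which therefore
solve the true system; and they compute the upper end of the shooting range, κ = 1. -/
theorem clamped_solution_bounds {c γ r κ : ℝ} (hc : 0 < c) (hγ : 0 < γ) (hr : 1 < r)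
    (hκ : κ ∈ Icc (0 : ℝ) 1) {f : ℝ → ℝ × ℝ} (h0 : f 1 = (1, κ))
    (hf : ∀ t ∈ Icc 1 r,
      HasDerivWithinAt f (clampedField c γ (r ^ (1 / c)) t (f t)) (Icc 1 r) t) :
    (∀ t ∈ Icc 1 r, 1 ≤ (f t).1 ∧ (f t).1 ≤ r ^ (1 / c) ∧ κ ≤ (f t).2 ∧ (f t).2 ≤ 1) ∧
      (κ = 1 → (f r).1 = r ^ (1 / c)) := by
  set M := r ^ (1 / c) with hMdef
  have hM : 1 ≤ M := Real.one_le_rpow hr.le (by positivity)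
  have hd1 : ∀ t ∈ Icc 1 r, HasDerivWithinAt (fun t => (f t).1)
      (clampedField c γ M t (f t)).1 (Icc 1 r) t := fun t ht => (hf t ht).fst
  have hd2 : ∀ t ∈ Icc 1 r, HasDerivWithinAt (fun t => (f t).2)
      (clampedField c γ M t (f t)).2 (Icc 1 r) t := fun t ht => (hf t ht).snd
  have hk0 : ∀ x : ℝ, 0 ≤ max 0 (min x 1) := fun x => le_max_left _ _
  have hk1 : ∀ x : ℝ, max 0 (min x 1) ≤ 1 := fun x => max_le zero_le_one (min_le_right _ _)
  have hy0 : ∀ x : ℝ, 1 ≤ max 1 (min x M) := fun x => le_max_left _ _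
  have hd1' : ∀ t ∈ Ioo 1 r, HasDerivAt (fun t => (f t).1) (clampedField c γ M t (f t)).1 t :=
    fun t ht => (hd1 t (Ioo_subset_Icc_self ht)).hasDerivAt (Icc_mem_nhds ht.1 ht.2)
  have hd2' : ∀ t ∈ Ioo 1 r, HasDerivAt (fun t => (f t).2) (clampedField c γ M t (f t)).2 t :=
    fun t ht => (hd2 t (Ioo_subset_Icc_self ht)).hasDerivAt (Icc_mem_nhds ht.1 ht.2)
  have hc1 : ContinuousOn (fun t => (f t).1) (Icc 1 r) := fun t ht => (hd1 t ht).continuousWithinAt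
  have hc2 : ContinuousOn (fun t => (f t).2) (Icc 1 r) := fun t ht => (hd2 t ht).continuousWithinAt
  have h1I : (1 : ℝ) ∈ Icc 1 r := ⟨le_rfl, hr.le⟩
  have hrI : r ∈ Icc 1 r := ⟨hr.le, le_rfl⟩
  have hm1 : MonotoneOn (fun t => (f t).1) (Icc 1 r) := by
    refine monotoneOn_of_deriv_nonneg (convex_Icc _ _) hc1 ?_ ?_ <;> rw [interior_Icc]
    · exact fun t ht => (hd1' t ht).differentiableAt.differentiableWithinAt
    · intro t ht
      rw [(hd1' t ht).deriv]
      have : 0 < t := zero_lt_one.trans ht.1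
      have := hk0 (f t).2
      have := zero_lt_one.trans_le (hy0 (f t).1)
      simp only [clampedField, slopeField]
      positivity
  have hm2 : MonotoneOn (fun t => (f t).2) (Icc 1 r) := by
    refine monotoneOn_of_deriv_nonneg (convex_Icc _ _) hc2 ?_ ?_ <;> rw [interior_Icc]
    · exact fun t ht => (hd2' t ht).differentiableAt.differentiableWithinAt
    · intro t ht
      rw [(hd2' t ht).deriv]
      exact slopeRate_nonneg hc hγ (zero_lt_one.trans ht.1) (hk0 _) (hk1 _)
  have b1 : ∀ t ∈ Icc 1 r, 1 ≤ (f t).1 := fun t ht => by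
    have := hm1 h1I ht ht.1; simpa [h0] using this
  have b3 : ∀ t ∈ Icc 1 r, κ ≤ (f t).2 := fun t ht => by
    have := hm2 h1I ht ht.1; simpa [h0] using this
  have b4 : ∀ t ∈ Icc 1 r, (f t).2 ≤ 1 := by
    intro t ht
    by_contra hcon
    -- Once the second component has reached 1, its clamped rate vanishes, so it cannot grow beyond.
    push Not at hcon
    obtain ⟨s, hs, hs1⟩ := intermediate_value_Icc ht.1 (hc2.mono (Icc_subset_Icc_right ht.2))
      (show (1 : ℝ) ∈ Icc (f 1).2 (f t).2 from ⟨by rw [h0]; exact hκ.2, hcon.le⟩)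
    have hconst : (f t).2 = (f s).2 := by
      refine constant_of_has_deriv_right_zero (f := fun t => (f t).2) (a := s) (b := t)
        (hc2.mono (Icc_subset_Icc hs.1 ht.2)) (fun x hx => ?_) t ⟨hs.2, le_rfl⟩
      have hxI : x ∈ Icc 1 r := ⟨hs.1.trans hx.1, hx.2.le.trans ht.2⟩
      have h2 : 1 ≤ (f x).2 := by
        have := hm2 ⟨hs.1, hs.2.trans ht.2⟩ hxI hx.1
        simp only at this hs1
        linarith
      have h3 := hd2 x hxI
      have h4 : (clampedField c γ M x (f x)).2 = 0 := by
        simp [clampedField, slopeField, min_eq_right h2, slopeRate]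
      rw [h4] at h3
      exact h3.mono_of_mem_nhdsWithin (mem_of_superset (Icc_mem_nhdsGE (hx.2.trans_le ht.2))
        (Icc_subset_Icc_left hxI.1))
    simp only at hs1
    linarith
  have hcl : ∀ t ∈ Icc 1 r, max 1 (min (f t).1 M) ≤ (f t).1 := fun t ht =>
    max_le (b1 t ht) (min_le_left _ _)
  -- Comparison with the solution t^(1/c) of slope one: the derivative of g has the sign of (clamped
  -- slope)·(clamped H) - H, which is nonpositive, and zero if the slope is identically 1.
  set g : ℝ → ℝ := fun t => (f t).1 * t ^ (-(1 / c)) with hg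
  have hgd : ∀ t ∈ Ioo 1 r, HasDerivAt g ((clampedField c γ M t (f t)).1 * t ^ (-(1 / c)) +
      (f t).1 * (-(1 / c) * t ^ (-(1 / c) - 1))) t := fun t ht =>
    (hd1' t ht).mul (Real.hasDerivAt_rpow_const (Or.inl (zero_lt_one.trans ht.1).ne'))
  have hge : ∀ t : ℝ, 0 < t → (clampedField c γ M t (f t)).1 * t ^ (-(1 / c)) +
      (f t).1 * (-(1 / c) * t ^ (-(1 / c) - 1)) =
      t ^ (-(1 / c)) / (c * t) * (max 0 (min (f t).2 1) * max 1 (min (f t).1 M) - (f t).1) := by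
    intro t ht
    rw [Real.rpow_sub_one ht.ne']
    simp only [clampedField, slopeField]
    field_simp
    ring
  have hgc : ContinuousOn g (Icc 1 r) := hc1.mul fun t ht =>
    (Real.continuousAt_rpow_const _ _ (Or.inl (zero_lt_one.trans_le ht.1).ne')).continuousWithinAt
  have hganti : AntitoneOn g (Icc 1 r) := by
    refine antitoneOn_of_deriv_nonpos (convex_Icc _ _) hgc ?_ ?_ <;> rw [interior_Icc]
    · exact fun t ht => (hgd t ht).differentiableAt.differentiableWithinAt
    · intro t ht
      have ht0 : 0 < t := zero_lt_one.trans ht.1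
      rw [(hgd t ht).deriv, hge t ht0]
      refine mul_nonpos_of_nonneg_of_nonpos (by positivity) ?_
      have e1 := hcl t (Ioo_subset_Icc_self ht)
      have e2 := hk0 (f t).2
      have e3 := hk1 (f t).2
      have e4 := hy0 (f t).1
      nlinarith
  have hg1 : g 1 = 1 := by simp [hg, h0]
  have b2' : ∀ t ∈ Icc 1 r, (f t).1 ≤ t ^ (1 / c) := by
    intro t ht
    have ht0 : 0 < t := zero_lt_one.trans_le ht.1
    have := hganti h1I ht ht.1
    rw [hg1] at this
    simp only [hg] at this
    rwa [Real.rpow_neg ht0.le, ← div_eq_mul_inv, div_le_one (by positivity)] at this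
  have b2 : ∀ t ∈ Icc 1 r, (f t).1 ≤ M := fun t ht => (b2' t ht).trans
    (Real.rpow_le_rpow (zero_le_one.trans ht.1) ht.2 (by positivity))
  refine ⟨fun t ht => ⟨b1 t ht, b2 t ht, b3 t ht, b4 t ht⟩, fun hκ1 => ?_⟩
  have hgmono : MonotoneOn g (Icc 1 r) := by
    refine monotoneOn_of_deriv_nonneg (convex_Icc _ _) hgc ?_ ?_ <;> rw [interior_Icc]
    · exact fun t ht => (hgd t ht).differentiableAt.differentiableWithinAt
    · intro t ht
      have ht0 : 0 < t := zero_lt_one.trans ht.1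
      have htI := Ioo_subset_Icc_self ht
      rw [(hgd t ht).deriv, hge t ht0]
      have e1 : (f t).2 = 1 := le_antisymm (b4 t htI) (hκ1 ▸ b3 t htI)
      rw [e1, min_self, max_eq_right zero_le_one, min_eq_left (b2 t htI), max_eq_right (b1 t htI)]
      simp
  have := le_antisymm (hganti h1I hrI hr.le) (hgmono h1I hrI hr.le)
  rw [hg1] at this
  simp only [hg] at this
  have hr0 : 0 < r := by linarith
  rw [Real.rpow_neg hr0.le, ← div_eq_mul_inv, div_eq_one_iff_eq (by positivity)] at this
  exact this

/-- The intermediate value theorem in the initial slope: the endpoint value of H is 1 for κ = 0 and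
r^(1/c) for κ = 1. -/
theorem exists_slopeSystem {c γ r R : ℝ} (hc : 0 < c) (hγ : 0 < γ) (hr : 1 < r) (hR : 1 < R)
    (hRr : R ≤ r ^ (1 / c)) :
    ∃ H k, IsSlopeSystem c γ r R H k ∧ ∀ t ∈ Icc 1 r, k t ≤ 1 := by
  obtain ⟨α, hα, hcont, hα0⟩ := exists_shooting_flow (c := c) (γ := γ) hc hγ hr (M := r ^ (1 / c))
    (Real.one_le_rpow hr.le (by positivity))
  have h1 := (clamped_solution_bounds hc hγ hr (κ := 1) ⟨zero_le_one, le_rfl⟩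
    (hα 1 ⟨zero_le_one, le_rfl⟩).1 (hα 1 ⟨zero_le_one, le_rfl⟩).2).2 rfl
  obtain ⟨κ, hκ, hκR⟩ := intermediate_value_Icc zero_le_one hcont
    (show R ∈ Icc (α 0 r).1 (α 1 r).1 from ⟨by rw [hα0]; exact hR.le, by rw [h1]; exact hRr⟩)
  have hκ0 : 0 < κ := by
    rcases hκ.1.eq_or_lt with h | h
    · rw [← h] at hκR
      simp only [hα0] at hκR
      linarith
    · exact h
  obtain ⟨h0, hd⟩ := hα κ hκ
  have hb := (clamped_solution_bounds hc hγ hr hκ h0 hd).1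
  have he : ∀ t ∈ Icc 1 r, clampedField c γ (r ^ (1 / c)) t (α κ t) =
      slopeField c γ (t, (α κ t).1, (α κ t).2) := by
    intro t ht
    obtain ⟨b1, b2, b3, b4⟩ := hb t ht
    unfold clampedField
    rw [min_eq_left b2, max_eq_right b1, min_eq_left b4, max_eq_right (hκ0.le.trans b3)]
  refine ⟨fun t => (α κ t).1, fun t => (α κ t).2, ⟨fun t ht => ?_, fun t ht => ?_, fun t ht => ?_,
    fun t ht => ?_, by simp [h0], hκR⟩, fun t ht => (hb t ht).2.2.2⟩
  · have := (hd t ht).fst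
    rw [he t ht] at this
    exact this
  · have := (hd t ht).snd
    rw [he t ht] at this
    exact this
  · exact zero_lt_one.trans_le (hb t ht).1
  · exact hκ0.trans_le (hb t ht).2.2.1

theorem isSlopeSystem_rpow {c r : ℝ} (γ : ℝ) (hc : 0 < c) :
    IsSlopeSystem c γ r (r ^ (1 / c)) (fun t => t ^ (1 / c)) (fun _ => 1) := by
  refine ⟨fun t ht => ?_, fun t ht => ?_, fun t ht => ?_, fun t ht => one_pos, by simp, rfl⟩
  · have ht0 : 0 < t := zero_lt_one.trans_le ht.1
    refine ((Real.hasDerivAt_rpow_const (p := 1 / c)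
      (Or.inl ht0.ne')).hasDerivWithinAt).congr_deriv ?_
    rw [Real.rpow_sub_one ht0.ne']
    field_simp
  · refine (hasDerivWithinAt_const _ _ _).congr_deriv ?_
    simp [slopeRate]
  · have ht0 : 0 < t := zero_lt_one.trans_le ht.1
    positivity

end CombinedEnergy

namespace CombinedEnergy

/-! ### Winding and orientation -/

/-- If the curve, divided by e^{inθ}, avoids a ray, then its winding number is n. Comparing the
principal argument of the quotient with the given branch ψ forces n = 1. It is used with n = -1 and
n = 0 to obtain contradictions. -/
theorem WindsOnce.eq_one_of_mem_slitPlane {f : ℂ → ℂ} {z₀ : ℂ} {ε : ℝ} (h : WindsOnce f z₀ ε)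
    (hf : Continuous fun θ : ℝ => f (circleMap z₀ ε θ)) (n : ℤ) (ν : ℂ)
    (hG : ∀ θ : ℝ, (f (circleMap z₀ ε θ) - f z₀) * ν * Complex.exp (-(n * θ * Complex.I)) ∈
      Complex.slitPlane) : n = 1 := by
  obtain ⟨ψ, hψ, hψ2, hψf⟩ := h
  set G : ℝ → ℂ := fun θ =>
    (f (circleMap z₀ ε θ) - f z₀) * ν * Complex.exp (-(n * θ * Complex.I)) with hGdef
  have hGc : Continuous G :=
    ((hf.sub continuous_const).mul continuous_const).mul (by fun_prop)
  have hG' : ∀ θ, G θ ∈ Complex.slitPlane := hG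
  have hν : ν ≠ 0 := by
    rintro rfl
    have := hG 0
    simp at this
  -- Both branches describe the same direction, so `d` takes values in 2πℤ; being continuous it is
  -- constant, and its increment over a period is 2π(n - 1).
  set d : ℝ → ℝ := fun θ => (G θ).arg - ψ θ + n * θ - ν.arg with hd
  have hargc : Continuous fun θ => (G θ).arg :=
    continuous_iff_continuousAt.2 fun θ => (Complex.continuousAt_arg (hG' θ)).comp hGc.continuousAt
  have hdc : Continuous d := by fun_prop
  have hd2 : ∀ θ, ∃ m : ℤ, d θ = m * (2 * Real.pi) := by
    intro θ
    have hGne : G θ ≠ 0 := Complex.slitPlane_ne_zero (hG θ)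
    have hfne : f (circleMap z₀ ε θ) - f z₀ ≠ 0 := by
      intro h0
      simp [hGdef, h0] at hGne
    have e1 : G θ = (‖G θ‖ : ℂ) * Complex.exp ((G θ).arg * Complex.I) :=
      (Complex.norm_mul_exp_arg_mul_I _).symm
    have e2 : ν = (‖ν‖ : ℂ) * Complex.exp (ν.arg * Complex.I) :=
      (Complex.norm_mul_exp_arg_mul_I _).symm
    have e3 : ‖G θ‖ = ‖f (circleMap z₀ ε θ) - f z₀‖ * ‖ν‖ := by
      simp only [hGdef, norm_mul]
      have : -((n : ℂ) * θ * Complex.I) = ((-(n * θ) : ℝ) : ℂ) * Complex.I := by push_cast; ring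
      rw [this, Complex.norm_exp_ofReal_mul_I, mul_one]
    have e4 : G θ = (‖f (circleMap z₀ ε θ) - f z₀‖ : ℂ) * ‖ν‖ *
        Complex.exp ((ψ θ + ν.arg - n * θ : ℝ) * Complex.I) := by
      have : ((ψ θ + ν.arg - n * θ : ℝ) : ℂ) * Complex.I =
        ψ θ * Complex.I + ν.arg * Complex.I + -(n * θ * Complex.I) := by push_cast; ring
      rw [this, Complex.exp_add, Complex.exp_add]
      simp only [hGdef]
      conv_lhs => rw [hψf θ, e2]
      ring
    have hne : (‖f (circleMap z₀ ε θ) - f z₀‖ : ℂ) * ‖ν‖ ≠ 0 := by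
      simp [hfne, hν]
    have e5 : Complex.exp ((ψ θ + ν.arg - n * θ : ℝ) * Complex.I) =
        Complex.exp ((G θ).arg * Complex.I) := by
      refine mul_left_cancel₀ hne (e4.symm.trans (e1.trans ?_))
      rw [e3, Complex.ofReal_mul]
    obtain ⟨m, hm⟩ := Complex.exp_eq_exp_iff_exists_int.1 e5
    refine ⟨-m, ?_⟩
    have hI := Complex.I_ne_zero
    have : ((ψ θ + ν.arg - n * θ : ℝ) : ℂ) = (((G θ).arg + m * (2 * Real.pi) : ℝ) : ℂ) := by
      apply mul_right_cancel₀ hI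
      rw [hm]
      push_cast
      ring
    have := Complex.ofReal_injective this
    simp only [hd]
    push_cast
    linarith
  have hper : G (2 * Real.pi) = G 0 := by
    simp only [hGdef]
    have h1 : circleMap z₀ ε (2 * Real.pi) = circleMap z₀ ε 0 := by
      have := periodic_circleMap z₀ ε 0
      simpa using this
    have h2 : Complex.exp (-(n * ((2 * Real.pi : ℝ) : ℂ) * Complex.I)) = 1 := by
      rw [Complex.exp_eq_one_iff]
      exact ⟨-n, by push_cast; ring⟩
    rw [h1, h2]
    simp
  have hdeq : d (2 * Real.pi) = d 0 := by
    by_contra hne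
    obtain ⟨m0, hm0⟩ := hd2 0
    obtain ⟨m1, hm1⟩ := hd2 (2 * Real.pi)
    have hpi := Real.pi_pos
    have key : ∃ v ∈ uIcc (d 0) (d (2 * Real.pi)), v = d 0 + Real.pi ∨ v = d 0 - Real.pi := by
      have hmne : m0 ≠ m1 := fun h => hne (by rw [hm0, hm1, h])
      rcases lt_or_gt_of_ne hmne with h | h
      · have : (m0 : ℝ) + 1 ≤ m1 := by exact_mod_cast h
        refine ⟨d 0 + Real.pi, ?_, Or.inl rfl⟩
        rw [mem_uIcc]; left
        constructor
        · linarith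
        · rw [hm0, hm1]; nlinarith
      · have : (m1 : ℝ) + 1 ≤ m0 := by exact_mod_cast h
        refine ⟨d 0 - Real.pi, ?_, Or.inr rfl⟩
        rw [mem_uIcc]; right
        constructor
        · rw [hm0, hm1]; nlinarith
        · linarith
    obtain ⟨v, hv, hv'⟩ := key
    obtain ⟨θ, -, hθ⟩ := intermediate_value_uIcc (hdc.continuousOn) hv
    obtain ⟨m, hm⟩ := hd2 θ
    rw [← hθ, hm, hm0] at hv'
    rcases hv' with h | h
    · have : Real.pi * (2 * (m - m0) - 1) = 0 := by linarith
      have h3 := (mul_eq_zero.1 this).resolve_left hpi.ne'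
      have : (2 * (m - m0) - 1 : ℤ) = 0 := by exact_mod_cast h3
      omega
    · have : Real.pi * (2 * (m - m0) + 1) = 0 := by linarith
      have h3 := (mul_eq_zero.1 this).resolve_left hpi.ne'
      have : (2 * (m - m0) + 1 : ℤ) = 0 := by exact_mod_cast h3
      omega
  simp only [hd, hper, hψ2] at hdeq
  have hpi := Real.pi_pos
  have : (2 * Real.pi) * ((n : ℝ) - 1) = 0 := by linarith
  have h3 := (mul_eq_zero.1 this).resolve_left (by positivity)
  have : (n : ℝ) = 1 := by linarith
  exact_mod_cast this

theorem windsOnce_of_mem_slitPlane {f : ℂ → ℂ} {z₀ : ℂ} {ε : ℝ}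
    (hf : Continuous fun θ : ℝ => f (circleMap z₀ ε θ)) (ν : ℂ)
    (hG : ∀ θ : ℝ, (f (circleMap z₀ ε θ) - f z₀) * ν * Complex.exp (-(θ * Complex.I)) ∈
      Complex.slitPlane) : WindsOnce f z₀ ε := by
  set G : ℝ → ℂ := fun θ =>
    (f (circleMap z₀ ε θ) - f z₀) * ν * Complex.exp (-(θ * Complex.I)) with hGdef
  have hGc : Continuous G :=
    ((hf.sub continuous_const).mul continuous_const).mul (by fun_prop)
  have hG' : ∀ θ, G θ ∈ Complex.slitPlane := hG
  have hν : ν ≠ 0 := by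
    rintro rfl
    have := hG 0
    simp at this
  have hargc : Continuous fun θ => (G θ).arg :=
    continuous_iff_continuousAt.2 fun θ => (Complex.continuousAt_arg (hG' θ)).comp hGc.continuousAt
  refine ⟨fun θ => (G θ).arg + θ - ν.arg, by fun_prop, ?_, fun θ => ?_⟩
  · have hper : G (2 * Real.pi) = G 0 := by
      simp only [hGdef]
      have h1 : circleMap z₀ ε (2 * Real.pi) = circleMap z₀ ε 0 := by
        have := periodic_circleMap z₀ ε 0
        simpa using this
      have h2 : Complex.exp (-(((2 * Real.pi : ℝ) : ℂ) * Complex.I)) = 1 := by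
        rw [Complex.exp_eq_one_iff]
        exact ⟨-1, by push_cast; ring⟩
      rw [h1, h2]
      simp
    simp only [hper]
    ring
  · have e1 : G θ = (‖G θ‖ : ℂ) * Complex.exp ((G θ).arg * Complex.I) :=
      (Complex.norm_mul_exp_arg_mul_I _).symm
    have e2 : ν = (‖ν‖ : ℂ) * Complex.exp (ν.arg * Complex.I) :=
      (Complex.norm_mul_exp_arg_mul_I _).symm
    have e3 : ‖G θ‖ = ‖f (circleMap z₀ ε θ) - f z₀‖ * ‖ν‖ := by
      simp only [hGdef, norm_mul]
      have : -((θ : ℂ) * Complex.I) = ((-θ : ℝ) : ℂ) * Complex.I := by push_cast; ring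
      rw [this, Complex.norm_exp_ofReal_mul_I, mul_one]
    have hν' : (‖ν‖ : ℂ) ≠ 0 := by simp [hν]
    have e4 : (((G θ).arg + θ - ν.arg : ℝ) : ℂ) * Complex.I =
        (G θ).arg * Complex.I + θ * Complex.I - ν.arg * Complex.I := by push_cast; ring
    rw [e4, Complex.exp_sub, Complex.exp_add]
    have e5 : (f (circleMap z₀ ε θ) - f z₀) * ν = G θ * Complex.exp (θ * Complex.I) := by
      simp only [hGdef]
      rw [mul_assoc _ (Complex.exp _) (Complex.exp _), ← Complex.exp_add]
      simp
    rw [e1, e3] at e5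
    have e6 : ν / Complex.exp (ν.arg * Complex.I) = ‖ν‖ := by
      rw [div_eq_iff (Complex.exp_ne_zero _)]; exact e2
    apply mul_right_cancel₀ hν
    rw [e5, Complex.ofReal_mul, ← e6]
    ring

/-- The Jacobian determinant of a real linear map of the plane. -/
theorem det_eq (L : ℂ →L[ℝ] ℂ) :
    L.det = (L 1).re * (L Complex.I).im - (L 1).im * (L Complex.I).re := by
  rw [ContinuousLinearMap.det, ← LinearMap.det_toMatrix Complex.basisOneI, Matrix.det_fin_two]
  simp [LinearMap.toMatrix_apply, Complex.basisOneI]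
  ring

/-- The splitting L v = μ v + ν v̄ into complex linear and antilinear parts. The determinant is |μ|²
- |ν|², so its sign tells which part dominates on small circles. -/
theorem apply_eq_mul_add_conj (L : ℂ →L[ℝ] ℂ) (v : ℂ) :
    L v = (L 1 - Complex.I * L Complex.I) / 2 * v +
      (L 1 + Complex.I * L Complex.I) / 2 * conj v := by
  have h : L v = v.re • L 1 + v.im • L Complex.I := by
    rw [← map_smul, ← map_smul, ← map_add]
    congr 1
    apply Complex.ext <;> simp
  rw [h]
  apply Complex.ext <;> simp <;> ring

theorem normSq_sub_normSq (L : ℂ →L[ℝ] ℂ) :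
    ‖(L 1 - Complex.I * L Complex.I) / 2‖ ^ 2 - ‖(L 1 + Complex.I * L Complex.I) / 2‖ ^ 2 =
      L.det := by
  rw [det_eq, ← Complex.normSq_eq_norm_sq, ← Complex.normSq_eq_norm_sq, Complex.normSq_apply,
    Complex.normSq_apply]
  simp
  ring

theorem continuous_circle_comp {f : ℂ → ℂ} {U : Set ℂ} (hf : ContinuousOn f U) {z₀ : ℂ} {ε : ℝ}
    (hε : Metric.closedBall z₀ |ε| ⊆ U) : Continuous fun θ : ℝ => f (circleMap z₀ ε θ) :=
  hf.comp_continuous (continuous_circleMap _ _) fun θ =>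
    hε (by rw [Metric.mem_closedBall, dist_eq_norm]; simp [circleMap])

theorem eventually_closedBall_subset {U : Set ℂ} (hU : IsOpen U) {z₀ : ℂ} (hz : z₀ ∈ U) :
    ∀ᶠ ε in 𝓝[>] (0 : ℝ), 0 < ε ∧ Metric.closedBall z₀ |ε| ⊆ U := by
  obtain ⟨δ, hδ, hδU⟩ := Metric.nhds_basis_closedBall.mem_iff.1 (hU.mem_nhds hz)
  filter_upwards [Ioc_mem_nhdsGT hδ] with ε hε
  refine ⟨hε.1, (Metric.closedBall_subset_closedBall ?_).trans hδU⟩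
  rw [abs_of_pos hε.1]; exact hε.2

theorem eventually_circle_fderiv {f : ℂ → ℂ} {L : ℂ →L[ℝ] ℂ} {z₀ : ℂ} (hL : HasFDerivAt f L z₀)
    {η : ℝ} (hη : 0 < η) :
    ∀ᶠ ε in 𝓝[>] (0 : ℝ), ∀ θ : ℝ, ∃ e : ℂ, ‖e‖ ≤ η ∧ f (circleMap z₀ ε θ) - f z₀ =
      ε * (L (Complex.exp (θ * Complex.I)) + e) := by
  have h1 := hL.isLittleO.bound hη
  rw [Metric.eventually_nhds_iff] at h1
  obtain ⟨δ, hδ, hb⟩ := h1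
  filter_upwards [Ioo_mem_nhdsGT hδ] with ε hε θ
  have hε0 : (ε : ℂ) ≠ 0 := by exact_mod_cast hε.1.ne'
  have e1 : circleMap z₀ ε θ - z₀ = ε * Complex.exp (θ * Complex.I) := by simp [circleMap]
  have e2 : ‖circleMap z₀ ε θ - z₀‖ = ε := by
    rw [e1, norm_mul, Complex.norm_exp_ofReal_mul_I, mul_one, Complex.norm_real,
      Real.norm_of_nonneg hε.1.le]
  have h2 := hb (y := circleMap z₀ ε θ) (by rw [dist_eq_norm, e2]; exact hε.2)
  refine ⟨(f (circleMap z₀ ε θ) - f z₀ - L (circleMap z₀ ε θ - z₀)) / ε, ?_, ?_⟩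
  · rw [norm_div, Complex.norm_real, Real.norm_of_nonneg hε.1.le, div_le_iff₀ hε.1]
    rwa [e2] at h2
  · rw [e1]
    have : L (ε * Complex.exp (θ * Complex.I)) = ε * L (Complex.exp (θ * Complex.I)) := by
      have := L.map_smul ε (Complex.exp (θ * Complex.I))
      simpa using this
    rw [this]
    field_simp
    ring

/-- With negative determinant the antilinear part dominates, and the image of a small circle would
wind -1 times. -/
theorem det_pos_of_windsOnce {f : ℂ → ℂ} {L : ℂ →L[ℝ] ℂ} {z₀ : ℂ} {U : Set ℂ} (hU : IsOpen U)
    (hz : z₀ ∈ U) (hf : ContinuousOn f U) (hL : HasFDerivAt f L z₀)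
    (hw : ∀ᶠ ε in 𝓝[>] (0 : ℝ), WindsOnce f z₀ ε) (hdet : L.det ≠ 0) : 0 < L.det := by
  by_contra hcon
  have hneg : L.det < 0 := lt_of_le_of_ne (not_lt.1 hcon) hdet
  set μ := (L 1 - Complex.I * L Complex.I) / 2 with hμ
  set ν := (L 1 + Complex.I * L Complex.I) / 2 with hν
  have hlt : ‖μ‖ < ‖ν‖ := by
    have := normSq_sub_normSq L
    rw [← hμ, ← hν] at this
    nlinarith [norm_nonneg μ, norm_nonneg ν]
  have hν0 : 0 < ‖ν‖ := (norm_nonneg _).trans_lt hlt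
  have hν0' : ν ≠ 0 := norm_pos_iff.1 hν0
  obtain ⟨ε, ⟨hε, hεU⟩, hwε, he⟩ := ((eventually_closedBall_subset hU hz).and
    (hw.and (eventually_circle_fderiv hL (η := (‖ν‖ - ‖μ‖) / 2) (by linarith)))).exists
  have := hwε.eq_one_of_mem_slitPlane (continuous_circle_comp hf hεU) (-1) ν⁻¹ fun θ => by
    obtain ⟨e, he1, he2⟩ := he θ
    left
    rw [he2, apply_eq_mul_add_conj, ← hμ, ← hν, ← Complex.exp_conj]
    have e1 : conj ((θ : ℂ) * Complex.I) = -(θ * Complex.I) := by simp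
    have e2 : -(((-1 : ℤ) : ℂ) * θ * Complex.I) = θ * Complex.I := by push_cast; ring
    rw [e1, e2, Complex.exp_neg]
    set E := Complex.exp (θ * Complex.I) with hE
    have hE0 : E ≠ 0 := Complex.exp_ne_zero _
    have hE1 : ‖E‖ = 1 := Complex.norm_exp_ofReal_mul_I θ
    have e3 : ε * (μ * E + ν * E⁻¹ + e) * ν⁻¹ * E = ε * (1 + (μ * E ^ 2 + e * E) / ν) := by
      field_simp
      ring
    rw [e3, Complex.re_ofReal_mul]
    refine mul_pos hε ?_
    have h4 : ‖(μ * E ^ 2 + e * E) / ν‖ < 1 := by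
      rw [norm_div, div_lt_one hν0]
      calc _ ≤ ‖μ * E ^ 2‖ + ‖e * E‖ := norm_add_le _ _
        _ = ‖μ‖ + ‖e‖ := by simp [hE1]
        _ < ‖ν‖ := by linarith
    have h5 := (Complex.abs_re_le_norm ((μ * E ^ 2 + e * E) / ν)).trans_lt h4
    rw [Complex.add_re, Complex.one_re]
    linarith [(abs_lt.1 h5).1]
  norm_num at this

theorem windsOnce_of_det_pos {f : ℂ → ℂ} {L : ℂ →L[ℝ] ℂ} {z₀ : ℂ} {U : Set ℂ} (hU : IsOpen U)
    (hz : z₀ ∈ U) (hf : ContinuousOn f U) (hL : HasFDerivAt f L z₀) (hdet : 0 < L.det) :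
    ∀ᶠ ε in 𝓝[>] (0 : ℝ), WindsOnce f z₀ ε := by
  set μ := (L 1 - Complex.I * L Complex.I) / 2 with hμ
  set ν := (L 1 + Complex.I * L Complex.I) / 2 with hν
  have hlt : ‖ν‖ < ‖μ‖ := by
    have := normSq_sub_normSq L
    rw [← hμ, ← hν] at this
    nlinarith [norm_nonneg μ, norm_nonneg ν]
  have hν0 : 0 < ‖μ‖ := (norm_nonneg _).trans_lt hlt
  have hν0' : μ ≠ 0 := norm_pos_iff.1 hν0
  filter_upwards [eventually_closedBall_subset hU hz,
    eventually_circle_fderiv hL (η := (‖μ‖ - ‖ν‖) / 2) (by linarith)] with ε hεU he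
  refine windsOnce_of_mem_slitPlane (continuous_circle_comp hf hεU.2) μ⁻¹ fun θ => ?_
  obtain ⟨e, he1, he2⟩ := he θ
  left
  rw [he2, apply_eq_mul_add_conj, ← hμ, ← hν, ← Complex.exp_conj]
  have e1 : conj ((θ : ℂ) * Complex.I) = -(θ * Complex.I) := by simp
  rw [e1, Complex.exp_neg]
  set E := Complex.exp (θ * Complex.I) with hE
  have hE0 : E ≠ 0 := Complex.exp_ne_zero _
  have hE1 : ‖E‖ = 1 := Complex.norm_exp_ofReal_mul_I θ
  have e3 : ε * (μ * E + ν * E⁻¹ + e) * μ⁻¹ * E⁻¹ = ε * (1 + (ν * E⁻¹ ^ 2 + e * E⁻¹) / μ) := by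
    field_simp
    ring
  rw [e3, Complex.re_ofReal_mul]
  refine mul_pos hεU.1 ?_
  have h4 : ‖(ν * E⁻¹ ^ 2 + e * E⁻¹) / μ‖ < 1 := by
    rw [norm_div, div_lt_one hν0]
    calc _ ≤ ‖ν * E⁻¹ ^ 2‖ + ‖e * E⁻¹‖ := norm_add_le _ _
      _ = ‖ν‖ + ‖e‖ := by simp [hE1]
      _ < ‖μ‖ := by linarith
  have h5 := (Complex.abs_re_le_norm ((ν * E⁻¹ ^ 2 + e * E⁻¹) / μ)).trans_lt h4
  rw [Complex.add_re, Complex.one_re]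
  linarith [(abs_lt.1 h5).1]

end CombinedEnergy

namespace CombinedEnergy

/-! ### Homeomorphisms of annuli as planar maps -/

/-- `f` and `g` are mutually inverse homeomorphisms between the open planar sets `U` and `V`. -/
structure IsPlanarHomeo (U V : Set ℂ) (f g : ℂ → ℂ) : Prop where
  isOpen_source : IsOpen U
  isOpen_target : IsOpen V
  mapsTo : MapsTo f U V
  mapsTo_symm : MapsTo g V U
  leftInv : ∀ z ∈ U, g (f z) = z
  rightInv : ∀ w ∈ V, f (g w) = w
  continuousOn : ContinuousOn f U
  continuousOn_symm : ContinuousOn g V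

namespace IsPlanarHomeo

variable {U V : Set ℂ} {f g : ℂ → ℂ}

theorem symm (h : IsPlanarHomeo U V f g) : IsPlanarHomeo V U g f :=
  ⟨h.isOpen_target, h.isOpen_source, h.mapsTo_symm, h.mapsTo, h.rightInv, h.leftInv,
    h.continuousOn_symm, h.continuousOn⟩

theorem injOn (h : IsPlanarHomeo U V f g) : InjOn f U := fun x hx y hy hxy => by
  rw [← h.leftInv x hx, ← h.leftInv y hy, hxy]

theorem image_eq (h : IsPlanarHomeo U V f g) {s : Set ℂ} (hs : s ⊆ U) : f '' s = V ∩ g ⁻¹' s := by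
  ext w
  constructor
  · rintro ⟨z, hz, rfl⟩
    exact ⟨h.mapsTo (hs hz), by rw [mem_preimage, h.leftInv z (hs hz)]; exact hz⟩
  · rintro ⟨hw, hw'⟩
    exact ⟨g w, hw', h.rightInv w hw⟩

theorem isOpen_image (h : IsPlanarHomeo U V f g) {s : Set ℂ} (hs : s ⊆ U) (hso : IsOpen s) :
    IsOpen (f '' s) := by
  rw [h.image_eq hs]
  exact h.continuousOn_symm.isOpen_inter_preimage h.isOpen_target hso

end IsPlanarHomeo

theorem isOpen_openAnnulus (ρ : ℝ) : IsOpen (openAnnulus ρ) :=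
  (isOpen_lt continuous_const continuous_norm).inter (isOpen_lt continuous_norm continuous_const)

theorem openAnnulus_subset_annulus (ρ : ℝ) : openAnnulus ρ ⊆ annulus ρ := fun _ hz =>
  ⟨hz.1.le, hz.2.le⟩

theorem isCompact_annulus (ρ : ℝ) : IsCompact (annulus ρ) := by
  refine (isCompact_closedBall (0 : ℂ) ρ).of_isClosed_subset ?_ fun z hz => by
    rw [mem_closedBall_zero_iff]; exact hz.2
  exact (isClosed_le continuous_const continuous_norm).inter
    (isClosed_le continuous_norm continuous_const)

section ToPlane

variable {r R : ℝ} (h : annulus r ≃ₜ annulus R)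

theorem toPlane_apply {z : ℂ} (hz : z ∈ annulus r) : toPlane h z = h ⟨z, hz⟩ := by
  simp [toPlane, hz]

theorem toPlane_mem {z : ℂ} (hz : z ∈ annulus r) : toPlane h z ∈ annulus R := by
  rw [toPlane_apply h hz]; exact (h ⟨z, hz⟩).2

theorem toPlane_symm_toPlane {z : ℂ} (hz : z ∈ annulus r) :
    toPlane h.symm (toPlane h z) = z := by
  have h1 := toPlane_mem h hz
  rw [toPlane_apply h.symm h1]
  have : (⟨toPlane h z, h1⟩ : annulus R) = h ⟨z, hz⟩ := Subtype.ext (toPlane_apply h hz)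
  rw [this, h.symm_apply_apply]

theorem continuousOn_toPlane : ContinuousOn (toPlane h) (annulus r) := by
  rw [continuousOn_iff_continuous_domRestrict]
  have : (annulus r).domRestrict (toPlane h) = fun z => (h z : ℂ) := by
    ext z
    exact toPlane_apply h z.2
  rw [this]
  exact continuous_subtype_val.comp h.continuous

theorem toPlane_eq_indicator : toPlane h = (annulus r).indicator (toPlane h) := by
  ext z
  by_cases hz : z ∈ annulus r
  · rw [indicator_of_mem hz]
  · rw [indicator_of_notMem hz]; simp [toPlane, hz]

theorem integrable_toPlane : Integrable (toPlane h) := by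
  rw [toPlane_eq_indicator, integrable_indicator_iff (isCompact_annulus r).isClosed.measurableSet]
  exact (continuousOn_toPlane h).integrableOn_compact (isCompact_annulus r)

theorem measurable_toPlane : Measurable (toPlane h) := by
  have hm : MeasurableSet (annulus r) := (isCompact_annulus r).isClosed.measurableSet
  refine measurable_of_restrict_of_restrict_compl hm ?_ ?_
  · exact (continuousOn_iff_continuous_domRestrict.1 (continuousOn_toPlane h)).measurable
  · have : (annulus r)ᶜ.domRestrict (toPlane h) = fun _ => 0 := by
      ext z
      have : (z : ℂ) ∉ annulus r := z.2
      simp [toPlane, domRestrict, this]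
    rw [this]
    exact measurable_const

end ToPlane

namespace IsDeformation

variable {r R : ℝ} {h : annulus r ≃ₜ annulus R}

theorem norm_inner (hd : IsDeformation h) {z : ℂ} (hz : z ∈ annulus r) (h1 : ‖z‖ = 1) :
    ‖toPlane h z‖ = 1 := by
  rw [toPlane_apply h hz]; exact hd.inner_circle ⟨z, hz⟩ h1

theorem norm_outer (hd : IsDeformation h) {z : ℂ} (hz : z ∈ annulus r) (h1 : ‖z‖ = r) :
    ‖toPlane h z‖ = R := by
  rw [toPlane_apply h hz]; exact hd.outer_circle ⟨z, hz⟩ h1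

/-- The definition prescribes only where boundary circles go. An interior point sent to the boundary
of the target is excluded by orientation: near such a point the image curve stays on one side, so it
cannot wind once around. -/
theorem mapsTo_openAnnulus (hd : IsDeformation h) :
    MapsTo (toPlane h) (openAnnulus r) (openAnnulus R) := by
  intro z₀ hz₀
  have hU := isOpen_openAnnulus r
  have hsub := openAnnulus_subset_annulus r
  have hcont := (continuousOn_toPlane h).mono hsub
  have hmem := toPlane_mem h (hsub hz₀)
  set w₀ := toPlane h z₀ with hw₀
  have hcat : ContinuousAt (toPlane h) z₀ := hcont.continuousAt (hU.mem_nhds hz₀)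
  obtain ⟨δ, hδ, hδb⟩ := Metric.continuousAt_iff.1 hcat 1 one_pos
  obtain ⟨ε, ⟨hε, hεU⟩, hwε, hεδ⟩ := ((eventually_closedBall_subset hU hz₀).and
    ((hd.orientation z₀ hz₀).and (Ioo_mem_nhdsGT hδ))).exists
  have hcirc : ∀ θ : ℝ, toPlane h (circleMap z₀ ε θ) ∈ annulus R ∧
      toPlane h (circleMap z₀ ε θ) ≠ w₀ ∧ ‖toPlane h (circleMap z₀ ε θ) - w₀‖ < 1 := by
    intro θ
    have e1 : ‖circleMap z₀ ε θ - z₀‖ = ε := by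
      simp [circleMap, abs_of_pos hε]
    have h1 : circleMap z₀ ε θ ∈ annulus r := hsub (hεU (by
      rw [Metric.mem_closedBall, dist_eq_norm, e1, abs_of_pos hε]))
    refine ⟨toPlane_mem h h1, fun h2 => ?_, ?_⟩
    · have h3 : circleMap z₀ ε θ = z₀ := by
        rw [← toPlane_symm_toPlane h h1, h2, hw₀, toPlane_symm_toPlane h (hsub hz₀)]
      rw [h3, sub_self, norm_zero] at e1
      exact hε.ne e1
    · rw [← dist_eq_norm]
      exact hδb (by rw [dist_eq_norm, e1]; exact hεδ.2)
  have hcc := continuous_circle_comp hcont hεU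
  refine ⟨lt_of_le_of_ne hmem.1 fun h1 => ?_, lt_of_le_of_ne hmem.2 fun h1 => ?_⟩
  -- If the value lies on the inner circle, the image differences avoid the ray pointing to the
  -- origin, since a point on it at distance less than 1 would have modulus below 1. The winding
  -- number would be 0.
  · have hw1 : Complex.normSq w₀ = 1 := by rw [Complex.normSq_eq_norm_sq, ← h1]; norm_num
    have := hwε.eq_one_of_mem_slitPlane hcc 0 (conj w₀) fun θ => by
      obtain ⟨a1, a2, a3⟩ := hcirc θ
      set w := toPlane h (circleMap z₀ ε θ)
      have e0 : Complex.exp (-(((0 : ℤ) : ℂ) * θ * Complex.I)) = 1 := by simp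
      rw [e0, mul_one, ← hw₀, Complex.mem_slitPlane_iff]
      by_contra hcon
      push Not at hcon
      obtain ⟨b1, b2⟩ := hcon
      have b4 : w * conj w₀ = (w - w₀) * conj w₀ + 1 := by
        rw [sub_mul, Complex.mul_conj, hw1]; simp
      have b5 : ‖w * conj w₀‖ = ‖w‖ := by rw [norm_mul, RCLike.norm_conj, ← h1, mul_one]
      have b6 : ‖(w - w₀) * conj w₀‖ < 1 := by
        rw [norm_mul, RCLike.norm_conj, ← h1, mul_one]; exact a3
      have b7 : (w - w₀) * conj w₀ = (((w - w₀) * conj w₀).re : ℂ) := by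
        apply Complex.ext <;> simp [b2]
      set x := ((w - w₀) * conj w₀).re
      rw [b7, Complex.norm_real, Real.norm_eq_abs, abs_lt] at b6
      have b8 : ‖w‖ = 1 + x := by
        rw [← b5, b4, b7, ← Complex.ofReal_one, ← Complex.ofReal_add, Complex.norm_real,
          Real.norm_of_nonneg (by linarith)]
        ring
      have b9 : x = 0 := by linarith [a1.1]
      rw [b9, Complex.ofReal_zero, mul_eq_zero] at b7
      rcases b7 with h7 | h7
      · exact a2 (sub_eq_zero.1 h7)
      · have : w₀ = 0 := by simpa using h7
        rw [this] at hw1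
        simp at hw1
    norm_num at this
  -- If the value lies on the outer circle, the image lies in the disc of radius R, which touches
  -- its tangent line in one point only; the differences fill an open half plane's side, and the
  -- winding number would be 0.
  · have hw1 : Complex.normSq w₀ = R ^ 2 := by rw [Complex.normSq_eq_norm_sq, h1]
    have hR1 : 1 ≤ R := hmem.1.trans hmem.2
    have := hwε.eq_one_of_mem_slitPlane hcc 0 (-conj w₀) fun θ => by
      obtain ⟨a1, a2, a3⟩ := hcirc θ
      set w := toPlane h (circleMap z₀ ε θ)
      have e0 : Complex.exp (-(((0 : ℤ) : ℂ) * θ * Complex.I)) = 1 := by simp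
      rw [e0, mul_one, ← hw₀]
      left
      have b4 : (w - w₀) * -conj w₀ = (R ^ 2 : ℝ) - w * conj w₀ := by
        rw [mul_neg, sub_mul, Complex.mul_conj, hw1]; simp
      rw [b4, Complex.sub_re, Complex.ofReal_re]
      have b5 : ‖w * conj w₀‖ ≤ R ^ 2 := by
        rw [norm_mul, RCLike.norm_conj, h1, sq]
        exact mul_le_mul_of_nonneg_right a1.2 (by linarith)
      have b6 : (w * conj w₀).re ≤ R ^ 2 := (Complex.re_le_norm _).trans b5
      rcases b6.lt_or_eq with h7 | h7
      · linarith
      · exfalso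
        have b8 : (w * conj w₀).im = 0 := by
          have h8 := Complex.normSq_eq_norm_sq (w * conj w₀)
          rw [Complex.normSq_apply, h7] at h8
          have h9 : ‖w * conj w₀‖ ^ 2 ≤ (R ^ 2) ^ 2 := by gcongr
          nlinarith
        have b9 : w * conj w₀ = w₀ * conj w₀ := by
          rw [Complex.mul_conj, hw1]
          apply Complex.ext
          · rw [Complex.ofReal_re]; exact h7
          · simp only [b8, Complex.ofReal_im]
        have hne : conj w₀ ≠ 0 := by
          intro h9
          have : w₀ = 0 := by simpa using h9
          rw [this] at hw1
          simp at hw1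
          nlinarith
        exact a2 (mul_right_cancel₀ hne b9)
    norm_num at this

theorem isPlanarHomeo (hd : IsDeformation h) :
    IsPlanarHomeo (openAnnulus r) (openAnnulus R) (toPlane h) (toPlane h.symm) where
  isOpen_source := isOpen_openAnnulus r
  isOpen_target := isOpen_openAnnulus R
  mapsTo := hd.mapsTo_openAnnulus
  mapsTo_symm w hw := by
    have hw' := openAnnulus_subset_annulus R hw
    have h1 := toPlane_mem h.symm hw'
    have h2 : toPlane h (toPlane h.symm w) = w := toPlane_symm_toPlane h.symm hw'
    refine ⟨lt_of_le_of_ne h1.1 fun h3 => ?_, lt_of_le_of_ne h1.2 fun h3 => ?_⟩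
    · have := hd.norm_inner h1 h3.symm
      rw [h2] at this
      exact hw.1.ne' this
    · have := hd.norm_outer h1 h3
      rw [h2] at this
      exact hw.2.ne this
  leftInv z hz := toPlane_symm_toPlane h (openAnnulus_subset_annulus r hz)
  rightInv w hw := toPlane_symm_toPlane h.symm (openAnnulus_subset_annulus R hw)
  continuousOn := (continuousOn_toPlane h).mono (openAnnulus_subset_annulus r)
  continuousOn_symm := (continuousOn_toPlane h.symm).mono (openAnnulus_subset_annulus R)

theorem norm_symm_inner (hd : IsDeformation h) (hR : 1 < R) {w : ℂ} (hw : w ∈ annulus R)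
    (h1 : ‖w‖ = 1) : ‖toPlane h.symm w‖ = 1 := by
  have h2 := toPlane_mem h.symm hw
  have h3 : toPlane h (toPlane h.symm w) = w := toPlane_symm_toPlane h.symm hw
  rcases h2.1.lt_or_eq with h4 | h4
  · rcases h2.2.lt_or_eq with h5 | h5
    · have := (hd.mapsTo_openAnnulus ⟨h4, h5⟩).1
      rw [h3, h1] at this
      exact absurd this (lt_irrefl _)
    · have := hd.norm_outer h2 h5
      rw [h3, h1] at this
      linarith
  · exact h4.symm

theorem norm_symm_outer (hd : IsDeformation h) (hR : 1 < R) {w : ℂ} (hw : w ∈ annulus R)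
    (h1 : ‖w‖ = R) : ‖toPlane h.symm w‖ = r := by
  have h2 := toPlane_mem h.symm hw
  have h3 : toPlane h (toPlane h.symm w) = w := toPlane_symm_toPlane h.symm hw
  rcases h2.2.lt_or_eq with h4 | h4
  · rcases h2.1.lt_or_eq with h5 | h5
    · have := (hd.mapsTo_openAnnulus ⟨h5, h4⟩).2
      rw [h3, h1] at this
      exact absurd this (lt_irrefl _)
    · have := hd.norm_inner h2 h5.symm
      rw [h3, h1] at this
      linarith
  · exact h4

end IsDeformation

end CombinedEnergy

namespace CombinedEnergy

/-! ### Mollification -/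

section Mollify

variable {E : Type*} [NormedAddCommGroup E] [NormedSpace ℝ E]

/-- The convolution of `f` with a normalized bump function. -/
noncomputable def mollify (φ : ContDiffBump (0 : ℂ)) (f : ℂ → E) : ℂ → E :=
  convolution (φ.normed volume) f (ContinuousLinearMap.lsmul ℝ ℝ) volume

theorem mollify_apply (φ : ContDiffBump (0 : ℂ)) (f : ℂ → E) (x : ℂ) :
    mollify φ f x = ∫ y, φ.normed volume (x - y) • f y :=
  convolution_lsmul_swap

theorem integrable_mollify_integrand (φ : ContDiffBump (0 : ℂ)) {f : ℂ → E}
    (hf : LocallyIntegrable f volume) (x : ℂ) :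
    Integrable (fun y => φ.normed volume (x - y) • f y) := by
  have h := φ.hasCompactSupport_normed (μ := volume).convolutionExists_left
    (ContinuousLinearMap.lsmul ℝ ℝ) φ.continuous_normed hf x
  exact h.integrable_swap

theorem continuous_mollify (φ : ContDiffBump (0 : ℂ)) {f : ℂ → E}
    (hf : LocallyIntegrable f volume) : Continuous (mollify φ f) :=
  φ.hasCompactSupport_normed.continuous_convolution_left _ φ.continuous_normed hf

theorem mollify_sub (φ : ContDiffBump (0 : ℂ)) {f g : ℂ → E}
    (hf : LocallyIntegrable f volume) (hg : LocallyIntegrable g volume) (x : ℂ) :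
    mollify φ (fun y => f y - g y) x = mollify φ f x - mollify φ g x := by
  simp only [mollify_apply, smul_sub]
  exact integral_sub (integrable_mollify_integrand φ hf x) (integrable_mollify_integrand φ hg x)

theorem integrable_mollify (φ : ContDiffBump (0 : ℂ)) {f : ℂ → E} (hf : Integrable f) :
    Integrable (mollify φ f) :=
  φ.integrable_normed.integrable_convolution _ hf

theorem integral_norm_mollify_le (φ : ContDiffBump (0 : ℂ)) {f : ℂ → E} (hf : Integrable f) :
    ∫ x, ‖mollify φ f x‖ ≤ ∫ x, ‖f x‖ := by
  have h1 : ∫ x, mollify φ (fun y => ‖f y‖) x = ∫ x, ‖f x‖ := by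
    unfold mollify
    rw [integral_convolution _ φ.integrable_normed hf.norm, φ.integral_normed]
    simp
  rw [← h1]
  refine integral_mono (integrable_mollify φ hf).norm (integrable_mollify φ hf.norm) fun x => ?_
  simp only [mollify_apply]
  refine (norm_integral_le_integral_norm _).trans_eq (integral_congr_ae (.of_forall fun y => ?_))
  simp only [norm_smul, Real.norm_of_nonneg (φ.nonneg_normed _), smul_eq_mul]

variable [CompleteSpace E]

theorem norm_mollify_sub_le (φ : ContDiffBump (0 : ℂ)) {f : ℂ → E}
    (hf : AEStronglyMeasurable f volume) {x : ℂ} {ε : ℝ}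
    (h : ∀ y ∈ Metric.ball x φ.rOut, ‖f y - f x‖ ≤ ε) : ‖mollify φ f x - f x‖ ≤ ε := by
  rw [← dist_eq_norm]
  exact φ.dist_normed_convolution_le hf fun y hy => by rw [dist_eq_norm]; exact h y hy

/-- Mollification is an L¹ contraction, so it suffices to treat a compactly supported continuous
approximation, where uniform continuity applies. Each of the three errors takes η/3. -/
theorem exists_integral_norm_mollify_sub_le {f : ℂ → E} (hf : Integrable f) {η : ℝ} (hη : 0 < η) :
    ∃ δ > 0, ∀ φ : ContDiffBump (0 : ℂ), φ.rOut < δ → ∫ x, ‖mollify φ f x - f x‖ ≤ η := by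
  obtain ⟨g, hgs, hgf, hgc, hgi⟩ :=
    hf.exists_hasCompactSupport_integral_sub_le (ε := η / 3) (by positivity)
  set K := Metric.cthickening 1 (tsupport g) with hK
  have hKc : IsCompact K := hgs.isCompact.cthickening
  set M : ℝ := volume.real K with hM
  have hM0 : 0 ≤ M := measureReal_nonneg
  obtain ⟨δ, hδ, hδg⟩ := Metric.uniformContinuous_iff.1
    (hgs.uniformContinuous_of_continuous hgc) (η / 3 / (M + 1)) (by positivity)
  refine ⟨min δ 1, lt_min hδ one_pos, fun φ hφ => ?_⟩
  have hφ1 : φ.rOut < δ := hφ.trans_le (min_le_left _ _)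
  have hφ2 : φ.rOut < 1 := hφ.trans_le (min_le_right _ _)
  have hgi' : LocallyIntegrable g volume := hgi.locallyIntegrable
  have hfi' : LocallyIntegrable f volume := hf.locallyIntegrable
  have hmid : ∀ x, ‖mollify φ g x - g x‖ ≤ K.indicator (fun _ => η / 3 / (M + 1)) x := by
    intro x
    by_cases hx : x ∈ K
    · rw [indicator_of_mem hx]
      refine norm_mollify_sub_le φ hgi.aestronglyMeasurable fun y hy => ?_
      rw [← dist_eq_norm]
      exact (hδg ((Metric.mem_ball.1 hy).trans hφ1)).le
    · rw [indicator_of_notMem hx]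
      refine norm_mollify_sub_le φ hgi.aestronglyMeasurable fun y hy => ?_
      have hz : ∀ y, dist y x < 1 → g y = 0 := by
        intro y hy
        by_contra hne
        have h1 : y ∈ tsupport g := subset_tsupport _ hne
        exact hx (Metric.mem_cthickening_of_dist_le x y 1 _ h1 (by rw [dist_comm]; exact hy.le))
      rw [hz y ((Metric.mem_ball.1 hy).trans hφ2), hz x (by simp), sub_zero, norm_zero]
  have hind : Integrable (K.indicator fun _ => η / 3 / (M + 1)) (volume : Measure ℂ) :=
    (integrable_indicator_iff hKc.isClosed.measurableSet).2
      (integrableOn_const hKc.measure_lt_top.ne)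
  have e1 : ∫ x, ‖mollify φ (fun y => f y - g y) x‖ ≤ η / 3 :=
    (integral_norm_mollify_le φ (hf.sub hgi)).trans hgf
  have e2 : ∫ x, ‖mollify φ g x - g x‖ ≤ η / 3 := by
    refine (integral_mono ((integrable_mollify φ hgi).sub hgi).norm hind hmid).trans ?_
    rw [integral_indicator hKc.isClosed.measurableSet, setIntegral_const, smul_eq_mul, ← hM]
    rw [mul_div_assoc', div_le_iff₀ (by positivity)]
    nlinarith
  have e3 : ∀ x, ‖mollify φ f x - f x‖ ≤ ‖mollify φ (fun y => f y - g y) x‖ +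
      ‖mollify φ g x - g x‖ + ‖f x - g x‖ := by
    intro x
    rw [mollify_sub φ hfi' hgi']
    calc _ = ‖(mollify φ f x - mollify φ g x) + (mollify φ g x - g x) - (f x - g x)‖ := by
          congr 1; abel
      _ ≤ _ := (norm_sub_le _ _).trans (add_le_add_left (norm_add_le _ _) _)
  have i1 := (integrable_mollify φ (hf.sub hgi)).norm
  have i2 := ((integrable_mollify φ hgi).sub hgi).norm
  have i3 := (hf.sub hgi).norm
  calc ∫ x, ‖mollify φ f x - f x‖ ≤ ∫ x, (‖mollify φ (fun y => f y - g y) x‖ +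
      ‖mollify φ g x - g x‖ + ‖f x - g x‖) :=
        integral_mono ((integrable_mollify φ hf).sub hf).norm ((i1.add i2).add i3) e3
    _ = (∫ x, ‖mollify φ (fun y => f y - g y) x‖) + (∫ x, ‖mollify φ g x - g x‖) +
        ∫ x, ‖f x - g x‖ := (integral_add (i1.add i2) i3).trans
          (congrArg (· + ∫ x, ‖f x - g x‖) (integral_add i1 i2))
    _ ≤ η := by linarith

end Mollify

/-! ### Weak derivatives as limits of classical derivatives -/

/-- The translated kernel y ↦ φ(x - y) is an admissible test function as soon as the ball about x
lies in `U`; the weak derivative identity then moves the derivative from the kernel to `f`. -/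
theorem HasWeakDeriv.hasFDerivAt_mollify {U : Set ℂ} (hU : IsOpen U) {f : ℂ → ℂ}
    {D : ℂ → ℂ →L[ℝ] ℂ} (h : HasWeakDeriv U f D) (hf : LocallyIntegrable f volume)
    (hD : IntegrableOn D U) (φ : ContDiffBump (0 : ℂ)) {x : ℂ}
    (hx : Metric.closedBall x φ.rOut ⊆ U) :
    HasFDerivAt (mollify φ f) (mollify φ (U.indicator D) x) x := by
  have hφc : ContDiff ℝ ∞ (φ.normed volume) := φ.contDiff_normed (n := ⊤)
  have h1 := φ.hasCompactSupport_normed (μ := volume).hasFDerivAt_convolution_left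
    (ContinuousLinearMap.lsmul ℝ ℝ) (hφc.of_le (by exact_mod_cast le_top)) hf x
  refine h1.congr_fderiv (Eq.symm ?_)
  set ψ : ℂ → ℝ := fun y => φ.normed volume (x - y) with hψ
  have hψc : ContDiff ℝ ∞ ψ := hφc.comp (contDiff_const.sub contDiff_id)
  have hsupp : tsupport ψ ⊆ Metric.closedBall x φ.rOut := by
    refine closure_minimal (fun y hy => ?_) Metric.isClosed_closedBall
    have : x - y ∈ Function.support (φ.normed volume) := hy
    rw [φ.support_normed_eq, mem_ball_zero_iff] at this
    rw [Metric.mem_closedBall, dist_comm, dist_eq_norm]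
    exact this.le
  have hψs : HasCompactSupport ψ :=
    HasCompactSupport.of_support_subset_isCompact (isCompact_closedBall x φ.rOut)
      ((subset_tsupport _).trans hsupp)
  have hDi : LocallyIntegrable (U.indicator D) volume :=
    Integrable.locallyIntegrable ((integrable_indicator_iff (f := D) hU.measurableSet).2 hD)
  have hcompl : ∀ y ∉ U, ψ =ᶠ[𝓝 y] 0 := fun y hy =>
    notMem_tsupport_iff_eventuallyEq.1 fun h => hy (hx (hsupp h))
  have hder : ∀ y, fderiv ℝ ψ y = -(fderiv ℝ (φ.normed volume) (x - y)) := by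
    intro y
    have h2 : HasFDerivAt (φ.normed volume) (fderiv ℝ (φ.normed volume) (x - y)) (x - y) :=
      ((hφc.differentiable (by simp)) _).hasFDerivAt
    have h3 := h2.comp y ((hasFDerivAt_const x y).sub (hasFDerivAt_id y))
    rw [show fderiv ℝ ψ y = _ from HasFDerivAt.fderiv h3]
    ext v
    simp
  ext1 v
  have e1 : (mollify φ (U.indicator D) x) v = ∫ y in U, ψ y • D y v := by
    rw [mollify_apply, ContinuousLinearMap.integral_apply (integrable_mollify_integrand φ hDi x),
      ← integral_indicator hU.measurableSet]
    refine integral_congr_ae (.of_forall fun y => ?_)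
    by_cases hy : y ∈ U
    · simp [hψ, hy]
    · simp [hy]
  have e2 := h.integral_eq ψ hψc hψs (hsupp.trans hx) v
  have hex := (HasCompactSupport.convolutionExists_left
    ((ContinuousLinearMap.lsmul ℝ ℝ : ℝ →L[ℝ] ℂ →L[ℝ] ℂ).precompL ℂ)
    (φ.hasCompactSupport_normed (μ := volume).fderiv ℝ)
    (hφc.continuous_fderiv (by simp)) hf x).integrable_swap
  rw [convolution_eq_swap, ContinuousLinearMap.integral_apply hex, e1,
    ← neg_eq_iff_eq_neg.2 e2, ← integral_indicator hU.measurableSet, ← integral_neg]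
  refine integral_congr_ae (.of_forall fun y => ?_)
  simp only [ContinuousLinearMap.precompL_apply, ContinuousLinearMap.lsmul_apply]
  by_cases hy : y ∈ U
  · rw [indicator_of_mem hy, hder]
    simp
  · rw [indicator_of_notMem hy, ← neg_neg (fderiv ℝ (φ.normed volume) (x - y)), ← hder,
      (hcompl y hy).fderiv_eq]
    simp

/-- `D` is the derivative of `f` on `U` in the sense of approximation: on compact subsets of `U`,
`f` is a uniform limit of `C¹` functions whose derivatives converge to `D` in `L¹`. -/
structure HasLimitDeriv (U : Set ℂ) (f : ℂ → ℂ) (D : ℂ → ℂ →L[ℝ] ℂ) : Prop where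
  integrableOn : IntegrableOn D U
  exists_approx : ∀ K ⊆ U, IsCompact K → ∀ η > 0, ∃ (F : ℂ → ℂ) (DF : ℂ → ℂ →L[ℝ] ℂ),
    (∀ z ∈ K, HasFDerivAt F (DF z) z) ∧ ContinuousOn DF K ∧ (∀ z ∈ K, ‖F z - f z‖ ≤ η) ∧
      ∫ z in K, ‖DF z - D z‖ ≤ η

theorem exists_contDiffBump_lt {δ : ℝ} (hδ : 0 < δ) : ∃ φ : ContDiffBump (0 : ℂ), φ.rOut < δ :=
  ⟨⟨δ / 4, δ / 2, by positivity, by linarith⟩, by simp only; linarith⟩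

theorem HasWeakDeriv.hasLimitDeriv {U : Set ℂ} (hU : IsOpen U) {f : ℂ → ℂ}
    {D : ℂ → ℂ →L[ℝ] ℂ} (h : HasWeakDeriv U f D) (hf : LocallyIntegrable f volume)
    (hfc : ContinuousOn f U) (hD : IntegrableOn D U) : HasLimitDeriv U f D := by
  refine ⟨hD, fun K hKU hK η hη => ?_⟩
  have hDi : Integrable (U.indicator D) volume :=
    (integrable_indicator_iff (f := D) hU.measurableSet).2 hD
  obtain ⟨δ₁, hδ₁, hδ₁'⟩ := exists_integral_norm_mollify_sub_le hDi hη
  obtain ⟨δ₂, hδ₂, hδ₂'⟩ := hK.exists_cthickening_subset_open hU hKU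
  have huc := (hK.cthickening (r := δ₂)).uniformContinuousOn_of_continuous (hfc.mono hδ₂')
  obtain ⟨δ₃, hδ₃, hδ₃'⟩ := Metric.uniformContinuousOn_iff.1 huc η hη
  obtain ⟨φ, hφ⟩ := exists_contDiffBump_lt (lt_min hδ₁ (lt_min hδ₂ hδ₃))
  rw [lt_min_iff, lt_min_iff] at hφ
  obtain ⟨hφ1, hφ2, hφ3⟩ := hφ
  have hball : ∀ z ∈ K, Metric.closedBall z φ.rOut ⊆ Metric.cthickening δ₂ K := fun z hz y hy =>
    Metric.mem_cthickening_of_dist_le y z δ₂ K hz ((Metric.mem_closedBall.1 hy).trans hφ2.le)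
  refine ⟨mollify φ f, mollify φ (U.indicator D), fun z hz =>
    h.hasFDerivAt_mollify hU hf hD φ ((hball z hz).trans hδ₂'),
    (continuous_mollify φ hDi.locallyIntegrable).continuousOn, fun z hz => ?_, ?_⟩
  · refine norm_mollify_sub_le φ hf.aestronglyMeasurable fun y hy => ?_
    rw [← dist_eq_norm]
    exact (hδ₃' y (hball z hz (Metric.ball_subset_closedBall hy)) z
      (Metric.self_subset_cthickening K hz)
      ((Metric.mem_ball.1 hy).trans hφ3)).le
  · have i1 := ((integrable_mollify φ hDi).sub hDi).norm
    calc ∫ z in K, ‖mollify φ (U.indicator D) z - D z‖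
        = ∫ z in K, ‖mollify φ (U.indicator D) z - U.indicator D z‖ :=
          setIntegral_congr_fun hK.isClosed.measurableSet fun z hz => by
            simp only [indicator_of_mem (hKU hz)]
      _ ≤ ∫ z, ‖mollify φ (U.indicator D) z - U.indicator D z‖ :=
          setIntegral_le_integral i1 (.of_forall fun _ => norm_nonneg _)
      _ ≤ η := hδ₁' φ hφ1

/-- The chain rule for a C¹ outer function and a weakly differentiable inner one, by passing to the
limit in the smooth approximations. It serves twice: for a function of |h| in the boundary terms and
for the quotient by the radial map in the uniqueness part. -/
theorem HasLimitDeriv.comp {U V : Set ℂ} {f : ℂ → ℂ} {D : ℂ → ℂ →L[ℝ] ℂ}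
    (hfd : HasLimitDeriv U f D) (hV : IsOpen V) (hf : ContinuousOn f U) (hfV : MapsTo f U V)
    {Ψ : ℂ × ℂ → ℂ} {DΨ : ℂ × ℂ → ℂ × ℂ →L[ℝ] ℂ}
    (hΨ : ∀ x ∈ U ×ˢ V, HasFDerivAt Ψ (DΨ x) x) (hDΨ : ContinuousOn DΨ (U ×ˢ V))
    (hi : IntegrableOn (fun z => (DΨ (z, f z)).comp ((ContinuousLinearMap.id ℝ ℂ).prod (D z))) U) :
    HasLimitDeriv U (fun z => Ψ (z, f z))
      (fun z => (DΨ (z, f z)).comp ((ContinuousLinearMap.id ℝ ℂ).prod (D z))) := by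
  refine ⟨hi, fun K hKU hK η hη => ?_⟩
  have hKm := hK.isClosed.measurableSet
  have hfK := hK.image_of_continuousOn (hf.mono hKU)
  obtain ⟨δ, hδ, hδV⟩ := hfK.exists_cthickening_subset_open hV
    (image_subset_iff.2 fun z hz => hfV (hKU hz))
  set Q := K ×ˢ Metric.cthickening δ (f '' K) with hQ
  have hQc : IsCompact Q := hK.prod hfK.cthickening
  have hQU : Q ⊆ U ×ˢ V := prod_mono hKU hδV
  have hΨc : ContinuousOn Ψ Q := fun x hx => (hΨ x (hQU hx)).continuousAt.continuousWithinAt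
  obtain ⟨M, hM⟩ := hQc.exists_bound_of_continuousOn (hDΨ.mono hQU)
  set S : ℝ := ∫ z in K, (1 + ‖D z‖) with hS
  have hDK : IntegrableOn D K := hfd.integrableOn.mono_set hKU
  have hSi : IntegrableOn (fun z => 1 + ‖D z‖) K :=
    (integrableOn_const hK.measure_lt_top.ne).add hDK.norm
  have hS0 : 0 ≤ S := integral_nonneg fun z => by positivity
  obtain ⟨δ₁, hδ₁, hδ₁'⟩ := Metric.uniformContinuousOn_iff.1
    (hQc.uniformContinuousOn_of_continuous hΨc) η hη
  obtain ⟨δ₂, hδ₂, hδ₂'⟩ := Metric.uniformContinuousOn_iff.1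
    (hQc.uniformContinuousOn_of_continuous (hDΨ.mono hQU)) (η / 2 / (S + 1)) (by positivity)
  have hM1 : 0 < |M| + 1 := by positivity
  set e := min (min (δ₁ / 2) (δ₂ / 2)) (min δ (η / 2 / (|M| + 1))) with he
  have he0 : 0 < e := by positivity
  obtain ⟨F, DF, hF, hDF, hFf, hDFD⟩ := hfd.exists_approx K hKU hK e he0
  have hFQ : ∀ z ∈ K, (z, F z) ∈ Q := fun z hz => ⟨hz,
    Metric.mem_cthickening_of_dist_le _ (f z) δ _ (mem_image_of_mem f hz) (by
      rw [dist_eq_norm]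
      exact (hFf z hz).trans ((min_le_right _ _).trans (min_le_left _ _)))⟩
  have hfQ : ∀ z ∈ K, (z, f z) ∈ Q := fun z hz => ⟨hz,
    Metric.self_subset_cthickening _ (mem_image_of_mem f hz)⟩
  have hdist : ∀ z ∈ K, dist (z, F z) (z, f z) ≤ e := fun z hz => by
    rw [Prod.dist_eq]
    simp only [dist_self]
    rw [dist_eq_norm]
    exact max_le he0.le (hFf z hz)
  have hFcont : ContinuousOn (fun z => (z, F z)) K :=
    continuousOn_id.prodMk fun z hz => (hF z hz).continuousAt.continuousWithinAt
  have hcd : ContinuousOn (fun z => (DΨ (z, F z)).comp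
      ((ContinuousLinearMap.id ℝ ℂ).prod (DF z))) K := by
    have h1 : ContinuousOn (fun z => DΨ (z, F z)) K := (hDΨ.mono hQU).comp hFcont hFQ
    have h2 : ContinuousOn (fun z => (ContinuousLinearMap.id ℝ ℂ).prod (DF z)) K :=
      ((continuousOn_const (c := ContinuousLinearMap.inl ℝ ℂ ℂ)).add
        ((continuousOn_const (c := ContinuousLinearMap.inr ℝ ℂ ℂ)).clm_comp hDF)).congr
        fun z _ => by ext <;> simp
    exact h1.clm_comp h2
  refine ⟨fun z => Ψ (z, F z), fun z => (DΨ (z, F z)).comp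
    ((ContinuousLinearMap.id ℝ ℂ).prod (DF z)), fun z hz => ?_, hcd, fun z hz => ?_, ?_⟩
  · exact (hΨ _ (hQU (hFQ z hz))).comp z ((hasFDerivAt_id z).prodMk (hF z hz))
  · rw [← dist_eq_norm]
    refine (hδ₁' _ (hFQ z hz) _ (hfQ z hz) ((hdist z hz).trans_lt ?_)).le
    have : e ≤ δ₁ / 2 := (min_le_left _ _).trans (min_le_left _ _)
    linarith
  · have hDFi : IntegrableOn (fun z => ‖DF z - D z‖) K :=
      ((hDF.integrableOn_compact hK).sub hDK).norm
    have hpt : ∀ z ∈ K, ‖(DΨ (z, F z)).comp ((ContinuousLinearMap.id ℝ ℂ).prod (DF z)) -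
        (DΨ (z, f z)).comp ((ContinuousLinearMap.id ℝ ℂ).prod (D z))‖ ≤
        (|M| + 1) * ‖DF z - D z‖ + η / 2 / (S + 1) * (1 + ‖D z‖) := by
      intro z hz
      refine ContinuousLinearMap.opNorm_le_bound _ (by positivity) fun v => ?_
      have a1 : ‖DΨ (z, F z)‖ ≤ |M| + 1 := by
        have := hM _ (hFQ z hz)
        have := le_abs_self M
        linarith
      have a2 : ‖DΨ (z, F z) - DΨ (z, f z)‖ ≤ η / 2 / (S + 1) := by
        rw [← dist_eq_norm]
        refine (hδ₂' _ (hFQ z hz) _ (hfQ z hz) ((hdist z hz).trans_lt ?_)).le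
        have : e ≤ δ₂ / 2 := (min_le_left _ _).trans (min_le_right _ _)
        linarith
      have a3 : ((DΨ (z, F z)).comp ((ContinuousLinearMap.id ℝ ℂ).prod (DF z)) -
        (DΨ (z, f z)).comp ((ContinuousLinearMap.id ℝ ℂ).prod (D z))) v =
        DΨ (z, F z) (0, (DF z - D z) v) + (DΨ (z, F z) - DΨ (z, f z)) (v, D z v) := by
        have : ((0 : ℂ), (DF z - D z) v) = (v, DF z v) - (v, D z v) := by simp
        rw [this, map_sub]
        simp
      rw [a3]
      have a4 : ‖((0 : ℂ), (DF z - D z) v)‖ ≤ ‖DF z - D z‖ * ‖v‖ := by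
        rw [Prod.norm_def]
        simp only [norm_zero]
        exact max_le (by positivity) (ContinuousLinearMap.le_opNorm _ _)
      have a5 : ‖(v, D z v)‖ ≤ (1 + ‖D z‖) * ‖v‖ := by
        rw [Prod.norm_def]
        have := ContinuousLinearMap.le_opNorm (D z) v
        have h1 := norm_nonneg v
        have h2 := norm_nonneg (D z)
        refine max_le ?_ ?_
        · simp only; nlinarith
        · simp only; nlinarith
      calc _ ≤ ‖DΨ (z, F z) (0, (DF z - D z) v)‖ + ‖(DΨ (z, F z) - DΨ (z, f z)) (v, D z v)‖ :=
            norm_add_le _ _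
        _ ≤ (|M| + 1) * (‖DF z - D z‖ * ‖v‖) + η / 2 / (S + 1) * ((1 + ‖D z‖) * ‖v‖) :=
            add_le_add
              ((ContinuousLinearMap.le_opNorm _ _).trans (by gcongr))
              ((ContinuousLinearMap.le_opNorm _ _).trans (by gcongr))
        _ = _ := by ring
    have hii := ((hcd.integrableOn_compact hK).sub (hi.mono_set hKU)).norm
    calc _ ≤ ∫ z in K, ((|M| + 1) * ‖DF z - D z‖ + η / 2 / (S + 1) * (1 + ‖D z‖)) :=
          setIntegral_mono_on hii ((hDFi.const_mul _).add (hSi.const_mul _)) hKm hpt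
      _ = (|M| + 1) * (∫ z in K, ‖DF z - D z‖) + η / 2 / (S + 1) * S := by
          rw [integral_add (hDFi.const_mul _) (hSi.const_mul _), integral_const_mul,
            integral_const_mul]
      _ ≤ η := by
          have h1 : ∫ z in K, ‖DF z - D z‖ ≤ η / 2 / (|M| + 1) :=
            hDFD.trans ((min_le_right _ _).trans (min_le_right _ _))
          have h2 : (|M| + 1) * (η / 2 / (|M| + 1)) = η / 2 := by field_simp
          have h3 : η / 2 / (S + 1) * S ≤ η / 2 := by
            rw [div_mul_eq_mul_div, div_le_iff₀ (by positivity)]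
            nlinarith
          have h4 := mul_le_mul_of_nonneg_left h1 hM1.le
          linarith

end CombinedEnergy

namespace CombinedEnergy

/-! ### Oscillation on circles -/

theorem polarCoord_symm_eq_circleMap (p : ℝ × ℝ) :
    Complex.polarCoord.symm p = circleMap 0 p.1 p.2 := by
  rw [Complex.polarCoord_symm_apply, circleMap_zero, Complex.exp_mul_I]
  push_cast
  rfl

theorem setIntegral_norm_mem {E : Type*} [NormedAddCommGroup E] [NormedSpace ℝ E] {S : Set ℝ}
    (hS : MeasurableSet S) (G : ℂ → E) :
    ∫ w in {w : ℂ | ‖w‖ ∈ S}, G w =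
      ∫ p in (Ioi 0 ∩ S) ×ˢ Ioo (-Real.pi) Real.pi, p.1 • G (circleMap 0 p.1 p.2) := by
  have hm : MeasurableSet {w : ℂ | ‖w‖ ∈ S} := measurable_norm hS
  rw [← integral_indicator hm, ← Complex.integral_comp_polarCoord_symm]
  have e1 : (Ioi 0 ∩ S) ×ˢ Ioo (-Real.pi) Real.pi = polarCoord.target ∩ (S ×ˢ univ) := by
    ext p
    simp only [polarCoord_target, mem_prod, mem_inter_iff, mem_univ, and_true]
    tauto
  rw [e1, ← setIntegral_indicator (hS.prod MeasurableSet.univ)]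
  refine setIntegral_congr_fun polarCoord.open_target.measurableSet fun p hp => ?_
  have hp0 : 0 < p.1 := hp.1
  have hn : ‖circleMap 0 p.1 p.2‖ = p.1 := by rw [norm_circleMap_zero, abs_of_pos hp0]
  simp only [polarCoord_symm_eq_circleMap]
  by_cases hpS : p.1 ∈ S
  · rw [indicator_of_mem (show circleMap 0 p.1 p.2 ∈ {w : ℂ | ‖w‖ ∈ S} by
      rw [mem_ofPred_eq, hn]; exact hpS), indicator_of_mem (show p ∈ S ×ˢ univ from ⟨hpS, trivial⟩)]
  · rw [indicator_of_notMem (show circleMap 0 p.1 p.2 ∉ {w : ℂ | ‖w‖ ∈ S} by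
      rw [mem_ofPred_eq, hn]; exact hpS), indicator_of_notMem (fun h => hpS h.1), smul_zero]

theorem volume_real_closedBall (z : ℂ) {s : ℝ} (hs : 0 ≤ s) :
    volume.real (Metric.closedBall z s) = Real.pi * s ^ 2 := by
  rw [measureReal_def, Complex.volume_closedBall, ENNReal.toReal_mul, ENNReal.toReal_pow,
    ENNReal.toReal_ofReal hs, mul_comm]
  rfl

theorem setIntegral_closedBall_add {E : Type*} [NormedAddCommGroup E] [NormedSpace ℝ E] (z : ℂ)
    (s : ℝ) (G : ℂ → E) :
    ∫ w in {w : ℂ | ‖w‖ ∈ Iic s}, G (z + w) = ∫ w in Metric.closedBall z s, G w := by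
  rw [← (measurePreserving_add_left volume z).setIntegral_preimage_emb
    (measurableEmbedding_addLeft z) G (Metric.closedBall z s)]
  congr 2
  ext w
  simp

theorem continuous_circleMap_uncurry (z : ℂ) : Continuous fun p : ℝ × ℝ => circleMap z p.1 p.2 := by
  unfold circleMap
  fun_prop

/-- In polar coordinates about z the integral of |DF| is an average of integrals along circles, so
some radius in [δ, 2δ] does no worse than the mean. This integral bounds the oscillation on the
circle. -/
theorem exists_circle_oscillation_le {F : ℂ → ℂ} {DF : ℂ → ℂ →L[ℝ] ℂ} {z : ℂ} {δ : ℝ} (hδ : 0 < δ)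
    (hF : ∀ y ∈ Metric.closedBall z (2 * δ), HasFDerivAt F (DF y) y)
    (hDF : ContinuousOn DF (Metric.closedBall z (2 * δ))) :
    ∃ s ∈ Icc δ (2 * δ), ∀ x ∈ Metric.sphere z s, ∀ y ∈ Metric.sphere z s,
      ‖F x - F y‖ ≤ (∫ w in Metric.closedBall z (2 * δ), ‖DF w‖) / δ := by
  set g : ℝ × ℝ → ℝ := fun p => p.1 * ‖DF (circleMap z p.1 p.2)‖ with hg
  have hmem : ∀ s ∈ Icc 0 (2 * δ), ∀ θ, circleMap z s θ ∈ Metric.closedBall z (2 * δ) :=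
    fun s hs θ => by
      rw [Metric.mem_closedBall, dist_eq_norm]
      simp [circleMap, abs_of_nonneg hs.1, hs.2]
  have hgc : ContinuousOn g (Icc 0 (2 * δ) ×ˢ Icc (-Real.pi) Real.pi) :=
    continuousOn_fst.mul (hDF.comp (continuous_circleMap_uncurry z).continuousOn
      fun p hp => hmem _ hp.1 _).norm
  have hgi : IntegrableOn g (Icc 0 (2 * δ) ×ˢ Icc (-Real.pi) Real.pi) :=
    hgc.integrableOn_compact (isCompact_Icc.prod isCompact_Icc)
  have hpi := Real.pi_pos
  have e1 : ∫ w in Metric.closedBall z (2 * δ), ‖DF w‖ =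
      ∫ p in (Ioi 0 ∩ Iic (2 * δ)) ×ˢ Ioo (-Real.pi) Real.pi, g p := by
    rw [← setIntegral_closedBall_add, setIntegral_norm_mem measurableSet_Iic]
    refine integral_congr_ae (.of_forall fun p => ?_)
    simp only [hg, smul_eq_mul, circleMap, zero_add]
  have hsub1 : (Ioi 0 ∩ Iic (2 * δ)) ×ˢ Ioo (-Real.pi) Real.pi ⊆
      Icc 0 (2 * δ) ×ˢ Icc (-Real.pi) Real.pi :=
    prod_mono (fun x hx => ⟨(mem_Ioi.1 hx.1).le, hx.2⟩) Ioo_subset_Icc_self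
  have hsub2 : Icc δ (2 * δ) ×ˢ Ioo (-Real.pi) Real.pi ⊆
      (Ioi 0 ∩ Iic (2 * δ)) ×ˢ Ioo (-Real.pi) Real.pi :=
    prod_mono (fun x hx => ⟨hδ.trans_le hx.1, hx.2⟩) Subset.rfl
  have e2 : ∫ p in Icc δ (2 * δ) ×ˢ Ioo (-Real.pi) Real.pi, g p ≤
      ∫ w in Metric.closedBall z (2 * δ), ‖DF w‖ := by
    rw [e1]
    refine setIntegral_mono_set (hgi.mono_set hsub1) ?_ hsub2.eventuallyLE
    filter_upwards [self_mem_ae_restrict ((measurableSet_Ioi.inter measurableSet_Iic).prod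
      measurableSet_Ioo)] with p hp
    exact mul_nonneg (mem_Ioi.1 hp.1.1).le (norm_nonneg _)
  have hgi2 : IntegrableOn g (Icc δ (2 * δ) ×ˢ Ioo (-Real.pi) Real.pi) :=
    hgi.mono_set (hsub2.trans hsub1)
  rw [Measure.volume_eq_prod] at e2 hgi2
  rw [setIntegral_prod _ hgi2] at e2
  rw [IntegrableOn, ← Measure.prod_restrict] at hgi2
  have hv : (volume : Measure ℝ) (Icc δ (2 * δ)) = ENNReal.ofReal δ := by
    rw [Real.volume_Icc]; congr 1; ring
  obtain ⟨s, hs, hsg⟩ := exists_le_setAverage (μ := volume) (s := Icc δ (2 * δ))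
    (f := fun s => ∫ θ in Ioo (-Real.pi) Real.pi, g (s, θ)) (by rw [hv]; simpa using hδ)
    (by rw [hv]; exact ENNReal.ofReal_ne_top) hgi2.integral_prod_left
  rw [setAverage_eq, measureReal_def, hv, ENNReal.toReal_ofReal hδ.le, smul_eq_mul,
    ← div_eq_inv_mul] at hsg
  have hs0 : 0 < s := hδ.trans_le hs.1
  have hsI : s ∈ Icc 0 (2 * δ) := ⟨hs0.le, hs.2⟩
  refine ⟨s, hs, ?_⟩
  have hgs : ContinuousOn (fun θ => g (s, θ)) univ :=
    continuousOn_const.mul (hDF.comp (continuous_circleMap z s).continuousOn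
      fun θ _ => hmem _ hsI _).norm
  rw [continuousOn_univ] at hgs
  have hder : ∀ θ, HasDerivAt (fun θ => F (circleMap z s θ))
      (DF (circleMap z s θ) (circleMap 0 s θ * Complex.I)) θ := fun θ =>
    (hF _ (hmem _ hsI θ)).comp_hasDerivAt θ (hasDerivAt_circleMap z s θ)
  have hderc : Continuous fun θ => DF (circleMap z s θ) (circleMap 0 s θ * Complex.I) := by
    have h1 : Continuous fun θ => DF (circleMap z s θ) := by
      rw [← continuousOn_univ]
      exact hDF.comp (continuous_circleMap z s).continuousOn fun θ _ => hmem _ hsI _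
    exact h1.clm_apply ((continuous_circleMap 0 s).mul continuous_const)
  have hbound : ∀ θ₁ ∈ Ioc (-Real.pi) Real.pi, ∀ θ₂ ∈ Ioc (-Real.pi) Real.pi,
      ‖F (circleMap z s θ₁) - F (circleMap z s θ₂)‖ ≤
        (∫ w in Metric.closedBall z (2 * δ), ‖DF w‖) / δ := by
    intro θ₁ h₁ θ₂ h₂
    rw [← intervalIntegral.integral_eq_sub_of_hasDerivAt (fun θ _ => hder θ)
      (hderc.intervalIntegrable _ _)]
    have hsubI : uIoc θ₂ θ₁ ⊆ Ioc (-Real.pi) Real.pi := fun θ hθ =>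
      ⟨(lt_min h₂.1 h₁.1).trans hθ.1, hθ.2.trans (max_le h₂.2 h₁.2)⟩
    have hgi3 : IntegrableOn (fun θ => g (s, θ)) (Ioc (-Real.pi) Real.pi) :=
      (hgs.integrableOn_Icc).mono_set Ioc_subset_Icc_self
    calc _ ≤ ∫ θ in uIoc θ₂ θ₁, ‖DF (circleMap z s θ) (circleMap 0 s θ * Complex.I)‖ :=
          intervalIntegral.norm_integral_le_integral_norm_uIoc
      _ ≤ ∫ θ in uIoc θ₂ θ₁, g (s, θ) := by
          refine integral_mono_ae (hderc.norm.integrableOn_uIoc) (hgi3.mono_set hsubI)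
            (.of_forall fun θ => ?_)
          refine (ContinuousLinearMap.le_opNorm _ _).trans_eq ?_
          rw [norm_mul, norm_circleMap_zero, Complex.norm_I, abs_of_pos hs0]
          simp only [hg]
          ring
      _ ≤ ∫ θ in Ioc (-Real.pi) Real.pi, g (s, θ) :=
          setIntegral_mono_set hgi3 (.of_forall fun θ => mul_nonneg hs0.le (norm_nonneg _))
            hsubI.eventuallyLE
      _ = ∫ θ in Ioo (-Real.pi) Real.pi, g (s, θ) := integral_Ioc_eq_integral_Ioo
      _ ≤ _ := hsg.trans (by gcongr)
  have harg : ∀ x ∈ Metric.sphere z s, x = circleMap z s (x - z).arg := by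
    intro x hx
    have : ‖x - z‖ = s := by rw [← dist_eq_norm]; exact hx
    rw [circleMap, ← this, Complex.norm_mul_exp_arg_mul_I]
    ring
  intro x hx y hy
  rw [harg x hx, harg y hy]
  exact hbound _ (Complex.arg_mem_Ioc _) _ (Complex.arg_mem_Ioc _)

theorem HasLimitDeriv.exists_circle_oscillation_le {U : Set ℂ} {f : ℂ → ℂ} {D : ℂ → ℂ →L[ℝ] ℂ}
    (h : HasLimitDeriv U f D) {z : ℂ} {δ : ℝ} (hδ : 0 < δ)
    (hz : Metric.closedBall z (2 * δ) ⊆ U) {η : ℝ} (hη : 0 < η) :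
    ∃ s ∈ Icc δ (2 * δ), ∀ x ∈ Metric.sphere z s, ∀ y ∈ Metric.sphere z s,
      ‖f x - f y‖ ≤ (∫ w in Metric.closedBall z (2 * δ), ‖D w‖) / δ + η := by
  set K := Metric.closedBall z (2 * δ) with hK
  set e := min (η / 3) (η / 3 * δ) with he
  have he0 : 0 < e := by positivity
  have he1 : e ≤ η / 3 := min_le_left _ _
  have he2 : e ≤ η / 3 * δ := min_le_right _ _
  have hKc : IsCompact K := isCompact_closedBall _ _
  obtain ⟨F, DF, hF, hDF, hFf, hDFD⟩ := h.exists_approx K hz hKc e he0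
  obtain ⟨s, hs, hosc⟩ := CombinedEnergy.exists_circle_oscillation_le hδ hF hDF
  refine ⟨s, hs, fun x hx y hy => ?_⟩
  have hsub : Metric.sphere z s ⊆ K := Metric.sphere_subset_closedBall.trans
    (Metric.closedBall_subset_closedBall hs.2)
  have hDi : IntegrableOn D K := h.integrableOn.mono_set hz
  have hDFi : IntegrableOn DF K := hDF.integrableOn_compact hKc
  have h1 : ∫ w in K, ‖DF w‖ ≤ (∫ w in K, ‖D w‖) + e := by
    refine le_trans ?_ (add_le_add_right hDFD _)
    refine (integral_mono hDFi.norm (hDi.norm.add (hDFi.sub hDi).norm) fun w => ?_).trans_eq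
      (integral_add hDi.norm (hDFi.sub hDi).norm)
    have := norm_add_le (D w) (DF w - D w)
    simpa using this
  have h2 : (∫ w in K, ‖DF w‖) / δ ≤ (∫ w in K, ‖D w‖) / δ + η / 3 := by
    rw [div_add' _ _ _ hδ.ne']
    gcongr
    linarith
  have h3 := hosc x hx y hy
  have h4 := hFf x (hsub hx)
  have h5 := hFf y (hsub hy)
  have h6 : f x - f y = (F x - F y) - (F x - f x) + (F y - f y) := by ring
  calc ‖f x - f y‖ ≤ ‖F x - F y‖ + ‖F x - f x‖ + ‖F y - f y‖ := by
        rw [h6]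
        exact (norm_add_le _ _).trans (add_le_add_left (norm_sub_le _ _) _)
    _ ≤ _ := by linarith

/-- A linear functional of an open map has no maximum at an interior point. -/
theorem IsPlanarHomeo.exists_sphere_le {U V : Set ℂ} {f g : ℂ → ℂ} (hfg : IsPlanarHomeo U V f g)
    {z : ℂ} {s : ℝ} (hz : Metric.closedBall z s ⊆ U) {x : ℂ} (hx : x ∈ Metric.closedBall z s)
    {ν : ℂ} (hν : ν ≠ 0) : ∃ m ∈ Metric.sphere z s, (conj ν * f x).re ≤ (conj ν * f m).re := by
  have hc : ContinuousOn (fun y => (conj ν * f y).re) (Metric.closedBall z s) :=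
    Complex.continuous_re.comp_continuousOn (continuousOn_const.mul (hfg.continuousOn.mono hz))
  obtain ⟨m, hm, hmax⟩ := (isCompact_closedBall z s).exists_isMaxOn ⟨x, hx⟩ hc
  refine ⟨m, ?_, hmax hx⟩
  by_contra hne
  have hmb : m ∈ Metric.ball z s := Metric.mem_ball.2 (lt_of_le_of_ne hm hne)
  have hball := Metric.ball_subset_closedBall (x := z) (ε := s)
  have hopen := hfg.isOpen_image (hball.trans hz) Metric.isOpen_ball
  have hcont : ContinuousAt (fun t : ℝ => f m + t * ν) 0 := by fun_prop
  have hev : ∀ᶠ t : ℝ in 𝓝 0, f m + t * ν ∈ f '' Metric.ball z s :=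
    hcont.eventually_mem (hopen.mem_nhds (by simpa using mem_image_of_mem f hmb))
  obtain ⟨t, ⟨y, hy, hyt⟩, ht⟩ :=
    ((hev.filter_mono nhdsWithin_le_nhds).and (self_mem_nhdsWithin (s := Ioi (0 : ℝ)))).exists
  have h1 : (conj ν * f y).re ≤ (conj ν * f m).re := hmax (hball hy)
  rw [hyt] at h1
  have h2 : (conj ν * (f m + t * ν)).re = (conj ν * f m).re + t * Complex.normSq ν := by
    have : conj ν * (f m + t * ν) = conj ν * f m + (t * Complex.normSq ν : ℝ) := by
      push_cast
      rw [← Complex.mul_conj]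
      ring
    rw [this, Complex.add_re, Complex.ofReal_re]
  have h3 : 0 < t * Complex.normSq ν := mul_pos ht (Complex.normSq_pos.2 hν)
  linarith

/-- Monotonicity of homeomorphisms: applying `exists_sphere_le` in the directions ±(f x - f y) moves
the difference from the disc to a circle of small oscillation. -/
theorem IsPlanarHomeo.norm_sub_le {U V : Set ℂ} {f g : ℂ → ℂ} {D : ℂ → ℂ →L[ℝ] ℂ}
    (hfg : IsPlanarHomeo U V f g) (h : HasLimitDeriv U f D) {z : ℂ} {δ : ℝ} (hδ : 0 < δ)
    (hz : Metric.closedBall z (2 * δ) ⊆ U) {x y : ℂ} (hx : x ∈ Metric.closedBall z δ)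
    (hy : y ∈ Metric.closedBall z δ) :
    ‖f x - f y‖ ≤ (∫ w in Metric.closedBall z (2 * δ), ‖D w‖) / δ := by
  refine le_of_forall_pos_le_add fun η hη => ?_
  rcases eq_or_ne (f x) (f y) with hxy | hxy
  · rw [hxy, sub_self, norm_zero]
    have : 0 ≤ ∫ w in Metric.closedBall z (2 * δ), ‖D w‖ :=
      integral_nonneg fun _ => norm_nonneg _
    positivity
  obtain ⟨s, hs, hosc⟩ := h.exists_circle_oscillation_le hδ hz hη
  have hzs : Metric.closedBall z s ⊆ U := (Metric.closedBall_subset_closedBall hs.2).trans hz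
  have hδs := Metric.closedBall_subset_closedBall (x := z) hs.1
  set ν := f x - f y with hν
  have hν0 : ν ≠ 0 := sub_ne_zero.2 hxy
  obtain ⟨m, hm, hxm⟩ := hfg.exists_sphere_le hzs (hδs hx) hν0
  obtain ⟨n, hn, hyn⟩ := hfg.exists_sphere_le hzs (hδs hy) (neg_ne_zero.2 hν0)
  have h1 : ‖ν‖ ^ 2 ≤ (conj ν * (f m - f n)).re := by
    have e1 : ‖ν‖ ^ 2 = (conj ν * f x).re - (conj ν * f y).re := by
      rw [← Complex.sub_re, ← mul_sub, ← hν, mul_comm, Complex.mul_conj, Complex.ofReal_re,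
        Complex.normSq_eq_norm_sq]
    rw [map_neg, neg_mul, neg_mul, Complex.neg_re, Complex.neg_re] at hyn
    rw [mul_sub, Complex.sub_re]
    linarith
  have h2 : (conj ν * (f m - f n)).re ≤ ‖ν‖ * ‖f m - f n‖ := by
    refine (Complex.re_le_norm _).trans_eq ?_
    rw [norm_mul, RCLike.norm_conj]
  have h3 : 0 < ‖ν‖ := norm_pos_iff.2 hν0
  have h4 : ‖ν‖ ≤ ‖f m - f n‖ := by
    refine le_of_mul_le_mul_left ?_ h3
    nlinarith
  exact h4.trans (hosc m hm n hn)

end CombinedEnergy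

namespace CombinedEnergy

/-! ### Differentiability almost everywhere -/

theorem norm_mollify_le {E : Type*} [NormedAddCommGroup E] [NormedSpace ℝ E]
    (φ : ContDiffBump (0 : ℂ)) {f : ℂ → E} (hf : LocallyIntegrable f volume) {y : ℂ} {S : Set ℂ}
    (hS : MeasurableSet S) (hy : Metric.closedBall y φ.rOut ⊆ S) (hfS : IntegrableOn f S) :
    ‖mollify φ f y‖ ≤ (∫ u in S, ‖f u‖) / (Real.pi * φ.rIn ^ 2) := by
  have hpi := Real.pi_pos
  have hr := φ.rIn_pos
  rw [mollify_apply]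
  calc _ ≤ ∫ u, ‖φ.normed volume (y - u) • f u‖ := norm_integral_le_integral_norm _
    _ ≤ ∫ u, S.indicator (fun u => ‖f u‖ / (Real.pi * φ.rIn ^ 2)) u := by
        refine integral_mono (integrable_mollify_integrand φ hf y).norm
          ((integrable_indicator_iff hS).2 (hfS.norm.div_const _)) fun u => ?_
        simp only [norm_smul, Real.norm_of_nonneg (φ.nonneg_normed _)]
        by_cases hu : u ∈ S
        · rw [indicator_of_mem hu, div_eq_inv_mul]
          gcongr
          refine (φ.normed_le_div_measure_closedBall_rIn volume _).trans_eq ?_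
          rw [volume_real_closedBall _ hr.le, one_div]
        · rw [indicator_of_notMem hu]
          have : φ.normed volume (y - u) = 0 := by
            rw [← Function.notMem_support, φ.support_normed_eq, mem_ball_zero_iff]
            intro h
            rw [← dist_eq_norm, dist_comm] at h
            exact hu (hy h.le)
          rw [this, zero_mul]
    _ = _ := by rw [integral_indicator hS, integral_div]

/-- At a Lebesgue point z of the weak derivative, with value T, mollify `f` at the scale σ|x - z|.
The mollified map has differential close to T on the ball through x, and by `norm_sub_le` it differs
from `f` by a small multiple of |x - z|. Only an integrable derivative is needed. -/
theorem IsPlanarHomeo.ae_hasFDerivAt {U V : Set ℂ} {f g : ℂ → ℂ} {D : ℂ → ℂ →L[ℝ] ℂ}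
    (hfg : IsPlanarHomeo U V f g) (h : HasWeakDeriv U f D) (hf : LocallyIntegrable f volume)
    (hD : IntegrableOn D U) : ∀ᵐ z, z ∈ U → HasFDerivAt f (D z) z := by
  have hU := hfg.isOpen_source
  set G := U.indicator D with hG
  have hGi : Integrable G volume := (integrable_indicator_iff (f := D) hU.measurableSet).2 hD
  have hlim := h.hasLimitDeriv hU hf hfg.continuousOn hD
  filter_upwards [IsUnifLocDoublingMeasure.ae_tendsto_average_norm_sub volume
    hGi.locallyIntegrable 1] with z hz hzU
  have hz' := hz (l := 𝓝[>] (0 : ℝ)) (fun _ => z) (fun δ => 2 * δ) (by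
    refine tendsto_nhdsWithin_iff.2 ⟨?_, ?_⟩
    · have : Tendsto (fun δ : ℝ => 2 * δ) (𝓝 0) (𝓝 (2 * 0)) := tendsto_id.const_mul 2
      rw [mul_zero] at this
      exact this.mono_left nhdsWithin_le_nhds
    · filter_upwards [self_mem_nhdsWithin] with δ hδ
      exact mul_pos two_pos (mem_Ioi.1 hδ)) (by
    filter_upwards [self_mem_nhdsWithin] with δ hδ
    exact Metric.mem_closedBall_self (by have : (0:ℝ) < δ := hδ; positivity))
  set T := D z with hT
  have hGz : G z = T := indicator_of_mem hzU D
  rw [hGz] at hz'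
  rw [hasFDerivAt_iff_isLittleO, Asymptotics.isLittleO_iff]
  intro c hc
  have hpi := Real.pi_pos
  -- σ makes the two mollification errors caused by T small; κ, chosen after σ, makes the deviation
  -- of the derivative from T small even after division by σ². The total is at most c/6 + c/2 + c/6.
  set σ : ℝ := min (1 / 2) (c / (16 * Real.pi * (‖T‖ + 1))) with hσ
  have hσ0 : 0 < σ := by positivity
  have hσ1 : σ ≤ 1 / 2 := min_le_left _ _
  have hσ2 : 8 * Real.pi * ‖T‖ * σ ≤ c / 2 := by
    have h1 : σ ≤ c / (16 * Real.pi * (‖T‖ + 1)) := min_le_right _ _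
    rw [le_div_iff₀ (by positivity)] at h1
    nlinarith [mul_pos hpi hσ0]
  set κ : ℝ := c * σ ^ 2 / 12 with hκ
  have hκ0 : 0 < κ := by positivity
  obtain ⟨B, hB, hBU⟩ : ∃ B > 0, Metric.closedBall z (2 * B) ⊆ U := by
    obtain ⟨B, hB, hBU⟩ := Metric.nhds_basis_closedBall.mem_iff.1 (hU.mem_nhds hzU)
    exact ⟨B / 2, by positivity, by rwa [mul_div_cancel₀ _ (two_ne_zero)]⟩
  have hev : ∀ᶠ δ in 𝓝[>] (0 : ℝ), ∫ y in Metric.closedBall z (2 * δ), ‖G y - T‖ ≤ κ * δ ^ 2 := by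
    filter_upwards [hz'.eventually_lt_const (u := κ / (4 * Real.pi)) (by positivity),
      self_mem_nhdsWithin] with δ hδ hδ0
    have hδ0 : 0 < δ := hδ0
    rw [setAverage_eq, volume_real_closedBall _ (by positivity), smul_eq_mul, ← div_eq_inv_mul,
      div_lt_iff₀ (by positivity)] at hδ
    refine hδ.le.trans_eq ?_
    field_simp
    ring
  obtain ⟨b, hb, hbev⟩ := mem_nhdsGT_iff_exists_Ioo_subset.1 hev
  have hb : 0 < b := hb
  filter_upwards [Metric.ball_mem_nhds z (lt_min hb hB)] with x hx
  rcases eq_or_ne x z with rfl | hxz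
  · simp
  set d := ‖x - z‖ with hd
  have hd0 : 0 < d := norm_pos_iff.2 (sub_ne_zero.2 hxz)
  have hdb : d < b ∧ d < B := by
    rw [Metric.mem_ball, dist_eq_norm, lt_min_iff] at hx
    exact hx
  have hint : ∫ y in Metric.closedBall z (2 * d), ‖G y - T‖ ≤ κ * d ^ 2 := hbev ⟨hd0, hdb.1⟩
  have hdU : Metric.closedBall z (2 * d) ⊆ U :=
    (Metric.closedBall_subset_closedBall (by linarith [hdb.2])).trans hBU
  set K := Metric.closedBall z (2 * d) with hK
  have hKc : IsCompact K := isCompact_closedBall _ _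
  have hKm : MeasurableSet K := hKc.isClosed.measurableSet
  have hGT : IntegrableOn (fun y => G y - T) K :=
    hGi.integrableOn.sub (integrableOn_const hKc.measure_lt_top.ne)
  have hGTl : LocallyIntegrable (fun y => G y - T) volume :=
    hGi.locallyIntegrable.sub (locallyIntegrable_const T)
  let φ : ContDiffBump (0 : ℂ) := ⟨σ * d / 2, σ * d, by positivity, by
    have : 0 < σ * d := by positivity
    linarith⟩
  have hφ : φ.rOut = σ * d := rfl
  have hφ' : φ.rIn = σ * d / 2 := rfl
  have hsub : ∀ y ∈ Metric.closedBall z d, Metric.closedBall y (2 * (σ * d)) ⊆ K := by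
    intro y hy u hu
    have h1 := dist_triangle u y z
    have h2 := Metric.mem_closedBall.1 hy
    have h3 := Metric.mem_closedBall.1 hu
    have h4 : σ * d ≤ 1 / 2 * d := by gcongr
    refine Metric.mem_closedBall.2 ?_
    linarith
  have hσd : 0 < σ * d := by positivity
  have hsub' : ∀ y ∈ Metric.closedBall z d, Metric.closedBall y φ.rOut ⊆ K := fun y hy =>
    (Metric.closedBall_subset_closedBall (by rw [hφ]; linarith)).trans (hsub y hy)
  have hder : ∀ y ∈ Metric.closedBall z d, HasFDerivAt (mollify φ f) (mollify φ G y) y :=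
    fun y hy => h.hasFDerivAt_mollify hU hf hD φ ((hsub' y hy).trans hdU)
  have hderT : ∀ y ∈ Metric.closedBall z d, ‖mollify φ G y - T‖ ≤ 2 * κ / σ ^ 2 := by
    intro y hy
    have h1 : mollify φ G y - T = mollify φ (fun y => G y - T) y := by
      rw [mollify_sub φ hGi.locallyIntegrable (locallyIntegrable_const T), mollify_apply φ fun _ => T,
        integral_smul_const, integral_sub_left_eq_self (φ.normed volume) volume y,
        φ.integral_normed, one_smul]
    rw [h1]
    refine (norm_mollify_le φ hGTl hKm (hsub' y hy) hGT).trans ?_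
    rw [hφ', div_le_div_iff₀ (by positivity) (by positivity)]
    have h2 : (2 : ℝ) ≤ Real.pi := Real.two_le_pi
    have h3 : 0 ≤ κ * (σ ^ 2 * d ^ 2) := by positivity
    calc _ ≤ κ * d ^ 2 * σ ^ 2 := by gcongr
      _ ≤ _ := by nlinarith
  have hmv := Convex.norm_image_sub_le_of_norm_hasFDerivWithin_le' (𝕜 := ℝ)
    (fun y hy => (hder y hy).hasFDerivWithinAt) hderT (convex_closedBall z d)
    (Metric.mem_closedBall_self hd0.le) (show x ∈ Metric.closedBall z d by
      rw [Metric.mem_closedBall, dist_eq_norm])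
  have happ : ∀ y ∈ Metric.closedBall z d, ‖mollify φ f y - f y‖ ≤
      (4 * Real.pi * ‖T‖ * σ + κ / σ) * d := by
    intro y hy
    have hyK := hsub y hy
    have hIy : ∫ u in Metric.closedBall y (2 * (σ * d)), ‖D u‖ ≤
        4 * Real.pi * ‖T‖ * (σ * d) ^ 2 + κ * d ^ 2 := by
      have i1 : IntegrableOn (fun u => ‖T‖) (Metric.closedBall y (2 * (σ * d))) :=
        integrableOn_const (isCompact_closedBall _ _).measure_lt_top.ne
      have i2 : IntegrableOn (fun u => ‖G u - T‖) (Metric.closedBall y (2 * (σ * d))) :=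
        (hGT.mono_set hyK).norm
      calc _ ≤ ∫ u in Metric.closedBall y (2 * (σ * d)), (‖T‖ + ‖G u - T‖) := by
            refine setIntegral_mono_on ((hD.mono_set (hyK.trans hdU)).norm) (i1.add i2)
              Metric.isClosed_closedBall.measurableSet fun u hu => ?_
            have : G u = D u := indicator_of_mem (hdU (hyK hu)) D
            rw [this]
            have := norm_add_le T (D u - T)
            simpa using this
        _ = (∫ u in Metric.closedBall y (2 * (σ * d)), ‖T‖) +
            ∫ u in Metric.closedBall y (2 * (σ * d)), ‖G u - T‖ := integral_add i1 i2
        _ ≤ _ := by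
            refine add_le_add ?_ ((setIntegral_mono_set hGT.norm
              (.of_forall fun _ => norm_nonneg _) hyK.eventuallyLE).trans hint)
            rw [setIntegral_const, volume_real_closedBall _ (by positivity), smul_eq_mul]
            exact le_of_eq (by ring)
    refine norm_mollify_sub_le φ hf.aestronglyMeasurable fun u hu => ?_
    refine (hfg.norm_sub_le hlim hσd (hyK.trans hdU)
      (Metric.ball_subset_closedBall (by rw [← hφ]; exact hu))
      (Metric.mem_closedBall_self hσd.le)).trans ?_
    rw [div_le_iff₀ hσd]
    refine hIy.trans_eq ?_
    field_simp
  have h1 := happ x (by rw [Metric.mem_closedBall, dist_eq_norm])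
  have h2 := happ z (Metric.mem_closedBall_self hd0.le)
  have h3 : f x - f z - T (x - z) = (mollify φ f x - mollify φ f z - T (x - z)) -
      (mollify φ f x - f x) + (mollify φ f z - f z) := by ring
  have h4 : ‖f x - f z - T (x - z)‖ ≤ 2 * κ / σ ^ 2 * d + 2 * ((4 * Real.pi * ‖T‖ * σ + κ / σ) * d) := by
    rw [h3]
    refine (norm_add_le _ _).trans ?_
    have := _root_.norm_sub_le (mollify φ f x - mollify φ f z - T (x - z)) (mollify φ f x - f x)
    linarith
  refine h4.trans ?_
  have h5 : κ / σ ≤ κ / σ ^ 2 := by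
    apply div_le_div_of_nonneg_left hκ0.le (by positivity)
    nlinarith
  have h6 : κ / σ ^ 2 = c / 12 := by
    rw [hκ]; field_simp
  have h7 : 2 * κ / σ ^ 2 = c / 6 := by
    rw [hκ]; field_simp; norm_num
  rw [h7]
  rw [h6] at h5
  nlinarith

/-! ### Lusin's condition -/

theorem sq_setIntegral_norm_le {E : Type*} [NormedAddCommGroup E] {D : ℂ → E} {K : Set ℂ}
    (hK : volume K ≠ ⊤) (hD : IntegrableOn D K) (hD2 : IntegrableOn (fun z => ‖D z‖ ^ 2) K) :
    (∫ z in K, ‖D z‖) ^ 2 ≤ volume.real K * ∫ z in K, ‖D z‖ ^ 2 := by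
  set M := ∫ z in K, ‖D z‖ with hM
  set Q := ∫ z in K, ‖D z‖ ^ 2 with hQ
  have key : ∀ l : ℝ, 2 * l * M ≤ Q + l ^ 2 * volume.real K := by
    intro l
    have i1 : IntegrableOn (fun _ : ℂ => l ^ 2) K := integrableOn_const hK
    have h1 : ∫ z in K, 2 * l * ‖D z‖ ≤ ∫ z in K, (‖D z‖ ^ 2 + l ^ 2) :=
      integral_mono (hD.norm.const_mul _) (hD2.add i1) fun z => by
        simp only
        nlinarith [sq_nonneg (‖D z‖ - l)]
    rw [integral_const_mul, integral_add hD2 i1, setIntegral_const, smul_eq_mul, mul_comm _ (l ^ 2)]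
      at h1
    exact h1
  have hv : 0 ≤ volume.real K := measureReal_nonneg
  rcases hv.eq_or_lt with h0 | h0
  · have : volume K = 0 := (measureReal_eq_zero_iff hK).1 h0.symm
    have hM0 : M = 0 := setIntegral_measure_zero _ this
    rw [hM0, ← h0]
    simp
  -- The value of l that minimizes Q - 2lM + l² |K|; this is the Cauchy–Schwarz inequality.
  · have := key (M / volume.real K)
    have e1 : 2 * (M / volume.real K) * M = 2 * (M ^ 2 / volume.real K) := by ring
    have e2 : (M / volume.real K) ^ 2 * volume.real K = M ^ 2 / volume.real K := by field_simp
    rw [e1, e2] at this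
    have h2 : M ^ 2 / volume.real K ≤ Q := by linarith
    rwa [div_le_iff₀ h0, mul_comm] at h2

/-- If doubling the radius always multiplied q by more than 5, then q would decay like 5^(-n) along
radii halved n times, faster than the lower bound, which decays like 4^(-n). -/
theorem exists_small_doubling {q : ℝ → ℝ} {s₀ : ℝ} (hs₀ : 0 < s₀)
    (hq : ∀ s ∈ Ioc 0 s₀, Real.pi * s ^ 2 ≤ q s) :
    ∃ᶠ s in 𝓝[>] (0 : ℝ), q (2 * s) ≤ 5 * q s := by
  intro hcon
  obtain ⟨b, hb, hbev⟩ := mem_nhdsGT_iff_exists_Ioo_subset.1 hcon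
  have hb : 0 < b := hb
  set t := min (b / 2) (s₀ / 2) with ht
  have ht0 : 0 < t := by positivity
  have htb : t < b := (min_le_left _ _).trans_lt (by linarith)
  have hts : t < s₀ := (min_le_right _ _).trans_lt (by linarith)
  have hstep : ∀ s, 0 < s → s ≤ t → 5 * q s < q (2 * s) := fun s h0 h1 =>
    not_le.1 (hbev ⟨h0, h1.trans_lt htb⟩)
  have hind : ∀ n : ℕ, 5 ^ n * q (t / 2 ^ n) ≤ q t := by
    intro n
    induction n with
    | zero => simp
    | succ n ih =>
      have h0 : 0 < t / 2 ^ (n + 1) := by positivity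
      have h1 : t / 2 ^ (n + 1) ≤ t := div_le_self ht0.le (one_le_pow₀ one_le_two)
      have h2 := hstep _ h0 h1
      have h3 : 2 * (t / 2 ^ (n + 1)) = t / 2 ^ n := by rw [pow_succ]; field_simp
      rw [h3] at h2
      have h4 : (0 : ℝ) < 5 ^ n := by positivity
      rw [pow_succ]
      nlinarith
  have hpi := Real.pi_pos
  have hlow : ∀ n : ℕ, (5 / 4 : ℝ) ^ n ≤ q t / (Real.pi * t ^ 2) := by
    intro n
    have h0 : 0 < t / 2 ^ n := by positivity
    have h1 : t / 2 ^ n ≤ s₀ := (div_le_self ht0.le (one_le_pow₀ one_le_two)).trans hts.le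
    have h2 := hq _ ⟨h0, h1⟩
    rw [le_div_iff₀ (by positivity)]
    refine le_trans ?_ (hind n)
    have h3 : (5 / 4 : ℝ) ^ n * (Real.pi * t ^ 2) = 5 ^ n * (Real.pi * (t / 2 ^ n) ^ 2) := by
      rw [div_pow, div_pow, ← pow_mul, mul_comm n 2, pow_mul]
      norm_num
      ring
    rw [h3]
    gcongr
  obtain ⟨n, hn⟩ := pow_unbounded_of_one_lt (q t / (Real.pi * t ^ 2)) (show (1 : ℝ) < 5 / 4 by norm_num)
  exact absurd (hlow n) (not_le.2 hn)

/-- Lusin's condition. The measure ρ of images is compared with a multiple ν of the measure with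
density 1 + |D|². By `norm_sub_le` and Cauchy–Schwarz the image of a disc is controlled by the
integral over the doubled disc, and at radii of small doubling by the disc itself. A Vitali covering
argument then gives ρ ≤ ν on the null set. -/
theorem IsPlanarHomeo.volume_image_eq_zero {U V : Set ℂ} {f g : ℂ → ℂ} {D : ℂ → ℂ →L[ℝ] ℂ}
    (hfg : IsPlanarHomeo U V f g) (hV : volume V ≠ ⊤) (h : HasLimitDeriv U f D)
    (hD2 : IntegrableOn (fun z => ‖D z‖ ^ 2) U) {S : Set ℂ} (hSU : S ⊆ U) (hS : volume S = 0) :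
    volume (f '' S) = 0 := by
  have hU := hfg.isOpen_source
  have hVo := hfg.isOpen_target
  have hpi := Real.pi_pos
  have hgm : AEMeasurable g (volume.restrict V) :=
    hfg.continuousOn_symm.aemeasurable hVo.measurableSet
  have : IsFiniteMeasure (volume.restrict V) := ⟨by
    rw [Measure.restrict_apply_univ]; exact hV.lt_top⟩
  set ρ : Measure ℂ := Measure.map g (volume.restrict V) with hρ
  have hρball : ∀ {T : Set ℂ}, MeasurableSet T → T ⊆ U → ρ T = volume (f '' T) := by
    intro T hT hTU
    rw [hρ, Measure.map_apply_of_aemeasurable hgm hT, Measure.restrict_apply' hVo.measurableSet,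
      hfg.image_eq hTU, inter_comm]
  -- The summand 1 provides the lower bound πs² that `exists_small_doubling` asks for.
  set m : ℂ → ℝ := fun z => 1 + U.indicator (fun z => ‖D z‖ ^ 2) z with hm
  have hm0 : ∀ z, 0 ≤ m z := fun z => add_nonneg zero_le_one
    (indicator_nonneg (fun _ _ => by positivity) z)
  have hD2i : Integrable (U.indicator fun z => ‖D z‖ ^ 2) volume :=
    (integrable_indicator_iff hU.measurableSet).2 hD2
  have hmi : ∀ z s, IntegrableOn m (Metric.closedBall z s) := fun z s =>
    (integrableOn_const (isCompact_closedBall z s).measure_lt_top.ne).add hD2i.integrableOn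
  -- 20π² = π · 4π · 5: the area of a disc, Cauchy–Schwarz on a disc of radius 2s, and the doubling
  -- constant.
  set c : ℝ := 20 * Real.pi ^ 2 with hc
  set ν : Measure ℂ := ENNReal.ofReal c • volume.withDensity fun z => ENNReal.ofReal (m z) with hν
  have hνball : ∀ z s, ν (Metric.closedBall z s) =
      ENNReal.ofReal (c * ∫ y in Metric.closedBall z s, m y) := by
    intro z s
    rw [hν, Measure.smul_apply, withDensity_apply _ Metric.isClosed_closedBall.measurableSet,
      ← ofReal_integral_eq_lintegral_ofReal (hmi z s) (.of_forall hm0), smul_eq_mul,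
      ← ENNReal.ofReal_mul (by positivity)]
  have : IsLocallyFiniteMeasure ν := ⟨fun z => ⟨Metric.closedBall z 1,
    Metric.closedBall_mem_nhds z one_pos, by rw [hνball]; exact ENNReal.ofReal_lt_top⟩⟩
  have hνS : ν S = 0 := by
    rw [hν, Measure.smul_apply, withDensity_absolutelyContinuous _ _ hS, smul_zero]
  have hfreq : ∀ x ∈ S, ∃ᶠ a in (Besicovitch.vitaliFamily ρ).filterAt x, ρ a ≤ ν a := by
    intro x hx
    obtain ⟨B, hB, hBU⟩ := Metric.nhds_basis_closedBall.mem_iff.1 (hU.mem_nhds (hSU hx))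
    refine (Besicovitch.tendsto_filterAt ρ x).frequently ?_
    have hq := exists_small_doubling (q := fun s => ∫ y in Metric.closedBall x s, m y)
      (s₀ := B) hB fun s hs => by
        rw [← volume_real_closedBall x hs.1.le]
        have h1 : volume.real (Metric.closedBall x s) =
            ∫ _ in Metric.closedBall x s, (1 : ℝ) := by
          rw [setIntegral_const]; simp
        rw [h1]
        refine integral_mono (integrableOn_const (isCompact_closedBall x s).measure_lt_top.ne)
          (hmi x s) fun z => ?_
        simp only [hm]
        have := indicator_nonneg (s := U) (f := fun z => ‖D z‖ ^ 2) (fun _ _ => by positivity) z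
        linarith
    refine (hq.and_eventually (Ioo_mem_nhdsGT (show 0 < B / 2 by positivity))).mono ?_
    rintro s ⟨hs, hs0, hsB⟩
    have h2U : Metric.closedBall x (2 * s) ⊆ U :=
      (Metric.closedBall_subset_closedBall (by linarith)).trans hBU
    have h1U : Metric.closedBall x s ⊆ U :=
      (Metric.closedBall_subset_closedBall (by linarith)).trans hBU
    have hv2 : volume (Metric.closedBall x (2 * s)) ≠ ⊤ :=
      (isCompact_closedBall _ _).measure_lt_top.ne
    set M := (∫ w in Metric.closedBall x (2 * s), ‖D w‖) / s with hM
    have hM0 : 0 ≤ M := div_nonneg (integral_nonneg fun _ => norm_nonneg _) hs0.le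
    have himg : f '' Metric.closedBall x s ⊆ Metric.closedBall (f x) M := by
      rintro _ ⟨y, hy, rfl⟩
      rw [Metric.mem_closedBall, dist_eq_norm]
      exact hfg.norm_sub_le h hs0 h2U hy (Metric.mem_closedBall_self hs0.le)
    rw [hρball Metric.isClosed_closedBall.measurableSet h1U, hνball]
    refine (measure_mono himg).trans ?_
    have hvM : volume (Metric.closedBall (f x) M) = ENNReal.ofReal (Real.pi * M ^ 2) := by
      rw [← volume_real_closedBall (f x) hM0, measureReal_def,
        ENNReal.ofReal_toReal (isCompact_closedBall _ _).measure_lt_top.ne]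
    rw [hvM]
    refine ENNReal.ofReal_le_ofReal ?_
    have hcs := sq_setIntegral_norm_le hv2 (h.integrableOn.mono_set h2U) (hD2.mono_set h2U)
    rw [volume_real_closedBall x (by positivity)] at hcs
    have hle : ∫ z in Metric.closedBall x (2 * s), ‖D z‖ ^ 2 ≤
        ∫ z in Metric.closedBall x (2 * s), m z := by
      refine setIntegral_mono_on (hD2.mono_set h2U) (hmi _ _)
        Metric.isClosed_closedBall.measurableSet fun z hz => ?_
      simp only [hm, indicator_of_mem (h2U hz)]
      linarith
    have hM2 : M ^ 2 ≤ 4 * Real.pi * ∫ z in Metric.closedBall x (2 * s), ‖D z‖ ^ 2 := by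
      rw [hM, div_pow, div_le_iff₀ (by positivity)]
      refine hcs.trans_eq (by ring)
    have hs' : ∫ y in Metric.closedBall x (2 * s), m y ≤ 5 * ∫ y in Metric.closedBall x s, m y := hs
    calc Real.pi * M ^ 2 ≤ Real.pi * (4 * Real.pi *
          (5 * ∫ y in Metric.closedBall x s, m y)) := by
          gcongr
          exact hM2.trans (by gcongr; exact hle.trans hs')
      _ = _ := by rw [hc]; ring
  have hfin := VitaliFamily.measure_le_of_frequently_le (Besicovitch.vitaliFamily ρ) ν
    (Measure.AbsolutelyContinuous.refl ρ) S hfreq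
  rw [hνS, nonpos_iff_eq_zero] at hfin
  have h1 := Measure.le_map_apply hgm S
  rw [← hρ, hfin, nonpos_iff_eq_zero, Measure.restrict_apply' hVo.measurableSet, inter_comm] at h1
  rw [hfg.image_eq hSU]
  exact h1

end CombinedEnergy

namespace CombinedEnergy

/-! ### Differentials in polar frames -/

/-- The radial derivative in the direction of `z`, read in the polar frame at `w`. -/
noncomputable def radialComp (L : ℂ →L[ℝ] ℂ) (z w : ℂ) : ℂ := L (z / ‖z‖) * (conj w / ‖w‖)

/-- The angular derivative in the direction of `i z`, read in the polar frame at `w`. -/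
noncomputable def angularComp (L : ℂ →L[ℝ] ℂ) (z w : ℂ) : ℂ :=
  L (Complex.I * z / ‖z‖) * (conj w / ‖w‖)

theorem frame_mul_conj {w : ℂ} (hw : w ≠ 0) : w / ‖w‖ * (conj w / ‖w‖) = 1 := by
  have h : (‖w‖ : ℂ) ≠ 0 := by simpa using hw
  rw [div_mul_div_comm, Complex.mul_conj, Complex.normSq_eq_norm_sq]
  push_cast
  field_simp

theorem apply_eq_radialComp_mul {L : ℂ →L[ℝ] ℂ} {z w : ℂ} (hw : w ≠ 0) :
    L (z / ‖z‖) = radialComp L z w * (w / ‖w‖) := by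
  rw [radialComp, mul_assoc, mul_comm (conj w / _), frame_mul_conj hw, mul_one]

theorem apply_eq_angularComp_mul {L : ℂ →L[ℝ] ℂ} {z w : ℂ} (hw : w ≠ 0) :
    L (Complex.I * z / ‖z‖) = angularComp L z w * (w / ‖w‖) := by
  rw [angularComp, mul_assoc, mul_comm (conj w / _), frame_mul_conj hw, mul_one]

theorem norm_frame {w : ℂ} (hw : w ≠ 0) : ‖w / ‖w‖‖ = 1 := by
  rw [norm_div, Complex.norm_real, norm_norm, div_self (norm_ne_zero_iff.2 hw)]

theorem norm_apply_sq_radial {L : ℂ →L[ℝ] ℂ} {z w : ℂ} (hw : w ≠ 0) :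
    ‖L (z / ‖z‖)‖ ^ 2 = (radialComp L z w).re ^ 2 + (radialComp L z w).im ^ 2 := by
  rw [apply_eq_radialComp_mul hw, norm_mul, norm_frame hw, mul_one, ← Complex.normSq_eq_norm_sq,
    Complex.normSq_apply]
  ring

theorem norm_apply_sq_angular {L : ℂ →L[ℝ] ℂ} {z w : ℂ} (hw : w ≠ 0) :
    ‖L (Complex.I * z / ‖z‖)‖ ^ 2 = (angularComp L z w).re ^ 2 + (angularComp L z w).im ^ 2 := by
  rw [apply_eq_angularComp_mul hw, norm_mul, norm_frame hw, mul_one, ← Complex.normSq_eq_norm_sq,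
    Complex.normSq_apply]
  ring

theorem apply_mul (L : ℂ →L[ℝ] ℂ) (x v : ℂ) :
    L (x * v) = x.re * L v + x.im * L (Complex.I * v) := by
  have h : x * v = x.re • v + x.im • (Complex.I * v) := by
    conv_lhs => rw [← Complex.re_add_im x]
    simp only [Complex.real_smul]
    ring
  rw [h, map_add, map_smul, map_smul, Complex.real_smul, Complex.real_smul]

theorem det_eq_comp {L : ℂ →L[ℝ] ℂ} {z w : ℂ} (hz : z ≠ 0) (hw : w ≠ 0) :
    L.det = (radialComp L z w).re * (angularComp L z w).im -
      (angularComp L z w).re * (radialComp L z w).im := by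
  set n := z / ‖z‖ with hn
  have hnn : n.re ^ 2 + n.im ^ 2 = 1 := by
    have := norm_frame hz
    rw [← hn] at this
    have h2 := Complex.normSq_eq_norm_sq n
    rw [this, Complex.normSq_apply] at h2
    nlinarith
  set N := conj w / ‖w‖ with hN
  have hNN : N.re ^ 2 + N.im ^ 2 = 1 := by
    have h1 : ‖N‖ = 1 := by
      rw [hN, norm_div, Complex.norm_real, norm_norm, RCLike.norm_conj,
        div_self (norm_ne_zero_iff.2 hw)]
    have h2 := Complex.normSq_eq_norm_sq N
    rw [h1, Complex.normSq_apply] at h2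
    nlinarith
  have h1 : L n = n.re * L 1 + n.im * L Complex.I := by
    have := apply_mul L n 1
    simpa using this
  have h2 : L (Complex.I * n) = -n.im * L 1 + n.re * L Complex.I := by
    have := apply_mul L (Complex.I * n) 1
    simpa using this
  have h3 : Complex.I * z / ‖z‖ = Complex.I * n := by rw [hn, mul_div_assoc]
  rw [radialComp, angularComp, ← hN, h3, ← hn, h1, h2, det_eq]
  simp only [Complex.mul_re, Complex.mul_im, Complex.add_re, Complex.add_im, Complex.ofReal_re,
    Complex.ofReal_im, Complex.neg_re, Complex.neg_im]
  linear_combination -((L 1).re * (L Complex.I).im - (L 1).im * (L Complex.I).re) *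
    ((N.re ^ 2 + N.im ^ 2) * hnn + hNN)

/-- Cramer's rule in the polar frames, multiplied by the determinant to avoid division. -/
theorem comp_inverse {L M : ℂ →L[ℝ] ℂ} {z w : ℂ} (hz : z ≠ 0) (hw : w ≠ 0)
    (hML : M.comp L = ContinuousLinearMap.id ℝ ℂ) :
    (L.det : ℂ) * radialComp M w z = (angularComp L z w).im - (radialComp L z w).im * Complex.I ∧
    (L.det : ℂ) * angularComp M w z =
      -(angularComp L z w).re + (radialComp L z w).re * Complex.I := by
  have hM : ∀ v, M (L v) = v := fun v => by
    rw [← ContinuousLinearMap.comp_apply, hML, ContinuousLinearMap.id_apply]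
  set P := radialComp L z w with hP
  set Q := angularComp L z w with hQ
  have e3 : Complex.I * z / ‖z‖ = Complex.I * (z / ‖z‖) := by rw [mul_div_assoc]
  have e4 : Complex.I * w / ‖w‖ = Complex.I * (w / ‖w‖) := by rw [mul_div_assoc]
  have e1 : z / ‖z‖ = P.re * M (w / ‖w‖) + P.im * M (Complex.I * (w / ‖w‖)) := by
    rw [← apply_mul, ← apply_eq_radialComp_mul hw, hM]
  have e2 : Complex.I * (z / ‖z‖) = Q.re * M (w / ‖w‖) + Q.im * M (Complex.I * (w / ‖w‖)) := by
    rw [← apply_mul, ← apply_eq_angularComp_mul hw, hM, e3]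
  have hd : (L.det : ℂ) = P.re * Q.im - Q.re * P.im := by
    rw [det_eq_comp hz hw]; push_cast; ring
  have hf := frame_mul_conj hz
  rw [radialComp, angularComp, e4, hd]
  constructor
  · linear_combination -(conj z / ‖z‖) * (Q.im * e1 - P.im * e2) + (Q.im - P.im * Complex.I) * hf
  · linear_combination -(conj z / ‖z‖) * (P.re * e2 - Q.re * e1) +
      (-Q.re + P.re * Complex.I) * hf

theorem opNorm_sq_le {L : ℂ →L[ℝ] ℂ} {z : ℂ} (hz : z ≠ 0) :
    ‖L‖ ^ 2 ≤ ‖L (z / ‖z‖)‖ ^ 2 + ‖L (Complex.I * z / ‖z‖)‖ ^ 2 := by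
  set S := ‖L (z / ‖z‖)‖ ^ 2 + ‖L (Complex.I * z / ‖z‖)‖ ^ 2 with hS
  have hS0 : 0 ≤ S := by positivity
  rw [← Real.le_sqrt (norm_nonneg _) hS0]
  refine ContinuousLinearMap.opNorm_le_bound _ (Real.sqrt_nonneg _) fun v => ?_
  set x := v * (conj z / ‖z‖) with hx
  have hv : v = x * (z / ‖z‖) := by
    rw [hx, mul_assoc, mul_comm (conj z / _), frame_mul_conj hz, mul_one]
  have hxn : ‖v‖ = ‖x‖ := by rw [hv, norm_mul, norm_frame hz, mul_one]
  have h1 : L v = x.re * L (z / ‖z‖) + x.im * L (Complex.I * z / ‖z‖) := by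
    rw [mul_div_assoc, ← apply_mul, ← hv]
  have h2 : ‖L v‖ ≤ |x.re| * ‖L (z / ‖z‖)‖ + |x.im| * ‖L (Complex.I * z / ‖z‖)‖ := by
    rw [h1]
    refine (norm_add_le _ _).trans_eq ?_
    rw [norm_mul, norm_mul, Complex.norm_real, Complex.norm_real, Real.norm_eq_abs,
      Real.norm_eq_abs]
  refine h2.trans (Real.le_sqrt_of_sq_le ?_ |>.trans_eq (Real.sqrt_mul hS0 (‖v‖ ^ 2)) |>.trans_eq ?_)
  · have h3 : ‖v‖ ^ 2 = |x.re| ^ 2 + |x.im| ^ 2 := by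
      rw [hxn, ← Complex.normSq_eq_norm_sq, Complex.normSq_apply, sq_abs, sq_abs]
      ring
    rw [h3, hS]
    nlinarith [sq_nonneg (|x.re| * ‖L (Complex.I * z / ‖z‖)‖ - |x.im| * ‖L (z / ‖z‖)‖)]
  · rw [Real.sqrt_sq (norm_nonneg _)]

/-! ### Uniqueness of weak derivatives -/

theorem _root_.MeasureTheory.LocallyIntegrableOn.integrableOn_smul {E : Type*}
    [NormedAddCommGroup E] [NormedSpace ℝ E] {U : Set ℂ} {D : ℂ → E}
    (hD : LocallyIntegrableOn D U) {φ : ℂ → ℝ} (hφ : Continuous φ) (hφs : HasCompactSupport φ)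
    (hφU : tsupport φ ⊆ U) : IntegrableOn (fun z => φ z • D z) U := by
  have h1 : IntegrableOn (fun z => φ z • D z) (tsupport φ) :=
    (hD.integrableOn_compact_subset hφU hφs).continuousOn_smul hφ.continuousOn hφs
  have hsupp : Function.support (fun z => φ z • D z) ⊆ tsupport φ := fun z hz =>
    subset_tsupport _ fun h => hz (by simp [h])
  exact ((integrableOn_iff_integrable_of_support_subset hsupp).1 h1).integrableOn

theorem HasWeakDeriv.ae_eq {U : Set ℂ} (hU : IsOpen U) {f : ℂ → ℂ} {D₁ D₂ : ℂ → ℂ →L[ℝ] ℂ}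
    (h₁ : HasWeakDeriv U f D₁) (h₂ : HasWeakDeriv U f D₂) :
    ∀ᵐ z ∂volume.restrict U, D₁ z = D₂ z := by
  have hloc : LocallyIntegrableOn (fun z => D₁ z - D₂ z) U :=
    h₁.locallyIntegrable_deriv.sub h₂.locallyIntegrable_deriv
  have h0 : ∀ᵐ z, z ∈ U → D₁ z - D₂ z = 0 := by
    refine hU.ae_eq_zero_of_integral_contDiff_smul_eq_zero hloc fun φ hφ hφs hφU => ?_
    have i1 := h₁.locallyIntegrable_deriv.integrableOn_smul hφ.continuous hφs hφU
    have i2 := h₂.locallyIntegrable_deriv.integrableOn_smul hφ.continuous hφs hφU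
    rw [← setIntegral_eq_integral_of_forall_compl_eq_zero (s := U) fun z hz => by
      rw [image_eq_zero_of_notMem_tsupport fun h => hz (hφU h)]
      exact zero_smul ℝ (D₁ z - D₂ z)]
    simp only [smul_sub]
    rw [integral_sub i1 i2, sub_eq_zero]
    ext1 v
    rw [ContinuousLinearMap.integral_apply i1, ContinuousLinearMap.integral_apply i2]
    have e1 := h₁.integral_eq φ hφ hφs hφU v
    have e2 := h₂.integral_eq φ hφ hφs hφU v
    simp only [smul_apply]
    rw [← neg_inj, ← e1, ← e2]
  rw [ae_restrict_iff' hU.measurableSet]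
  filter_upwards [h0] with z hz hzU
  exact sub_eq_zero.1 (hz hzU)

theorem hasWeakDeriv_weakDeriv {U : Set ℂ} {f : ℂ → ℂ} (h : ∃ D, HasWeakDeriv U f D) :
    HasWeakDeriv U f (weakDeriv U f) := by
  rw [weakDeriv, dif_pos h]
  exact h.choose_spec

/-! ### Change of variables -/

/-- Mutually inverse planar homeomorphisms with square integrable weak derivatives. -/
structure IsSobolevHomeo (U V : Set ℂ) (f g : ℂ → ℂ) (Df Dg : ℂ → ℂ →L[ℝ] ℂ) : Prop
    extends IsPlanarHomeo U V f g where
  volume_source : volume U ≠ ⊤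
  volume_target : volume V ≠ ⊤
  locallyIntegrable : LocallyIntegrable f volume
  locallyIntegrable_symm : LocallyIntegrable g volume
  weakDeriv : HasWeakDeriv U f Df
  weakDeriv_symm : HasWeakDeriv V g Dg
  integrableOn_sq : IntegrableOn (fun z => ‖Df z‖ ^ 2) U
  integrableOn_sq_symm : IntegrableOn (fun z => ‖Dg z‖ ^ 2) V

namespace IsSobolevHomeo

variable {U V : Set ℂ} {f g : ℂ → ℂ} {Df Dg : ℂ → ℂ →L[ℝ] ℂ}

theorem symm (h : IsSobolevHomeo U V f g Df Dg) : IsSobolevHomeo V U g f Dg Df :=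
  ⟨h.toIsPlanarHomeo.symm, h.volume_target, h.volume_source, h.locallyIntegrable_symm,
    h.locallyIntegrable, h.weakDeriv_symm, h.weakDeriv, h.integrableOn_sq_symm, h.integrableOn_sq⟩

theorem integrableOn (h : IsSobolevHomeo U V f g Df Dg) : IntegrableOn Df U := by
  refine Integrable.mono' ((integrableOn_const h.volume_source (C := (1 : ℝ))).add
    h.integrableOn_sq) h.weakDeriv.locallyIntegrable_deriv.aestronglyMeasurable
    (.of_forall fun z => ?_)
  simp only [Pi.add_apply]
  nlinarith [sq_nonneg (‖Df z‖ - 1)]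

theorem hasLimitDeriv (h : IsSobolevHomeo U V f g Df Dg) : HasLimitDeriv U f Df :=
  h.weakDeriv.hasLimitDeriv h.isOpen_source h.locallyIntegrable h.continuousOn h.integrableOn

theorem volume_image_eq_zero (h : IsSobolevHomeo U V f g Df Dg) {S : Set ℂ} (hSU : S ⊆ U)
    (hS : volume S = 0) : volume (f '' S) = 0 :=
  h.toIsPlanarHomeo.volume_image_eq_zero h.volume_target h.hasLimitDeriv h.integrableOn_sq hSU hS

/-- Remove from `U` the points where `f` is not differentiable and the images under `g` of those
where `g` is not. Both sets are null, the second by Lusin's condition for `g`; by Lusin's condition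
for `f` the image still has full measure in `V`. On what remains the classical chain rule and area
formula apply. -/
theorem exists_good_set (h : IsSobolevHomeo U V f g Df Dg) :
    ∃ E ⊆ U, MeasurableSet E ∧ volume (U \ E) = 0 ∧ volume (V \ f '' E) = 0 ∧
      ∀ z ∈ E, HasFDerivAt f (Df z) z ∧ (Dg (f z)).comp (Df z) = ContinuousLinearMap.id ℝ ℂ := by
  have hA := h.toIsPlanarHomeo.ae_hasFDerivAt h.weakDeriv h.locallyIntegrable h.integrableOn
  have hB := h.toIsPlanarHomeo.symm.ae_hasFDerivAt h.weakDeriv_symm h.locallyIntegrable_symm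
    h.symm.integrableOn
  set A := {z ∈ U | ¬ HasFDerivAt f (Df z) z} with hAdef
  set B := {w ∈ V | ¬ HasFDerivAt g (Dg w) w} with hBdef
  have hA0 : volume A = 0 := by
    refine measure_mono_null ?_ hA
    rintro z ⟨hzU, hz⟩ hcon
    exact hz (hcon hzU)
  have hB0 : volume B = 0 := by
    refine measure_mono_null ?_ hB
    rintro z ⟨hzU, hz⟩ hcon
    exact hz (hcon hzU)
  have hgB : volume (g '' B) = 0 := h.symm.volume_image_eq_zero (fun w hw => hw.1) hB0
  set Z := toMeasurable volume (A ∪ g '' B) with hZ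
  have hZ0 : volume Z = 0 := by rw [hZ, measure_toMeasurable, measure_union_null hA0 hgB]
  have hEU : U \ Z ⊆ U := sdiff_subset
  have hnull : volume (U ∩ Z) = 0 := measure_mono_null inter_subset_right hZ0
  refine ⟨U \ Z, hEU, h.isOpen_source.measurableSet.diff (measurableSet_toMeasurable _ _), ?_, ?_,
    fun z hz => ?_⟩
  · rw [sdiff_sdiff_right_self]
    exact hnull
  · refine measure_mono_null ?_ (h.volume_image_eq_zero inter_subset_left hnull)
    rintro w ⟨hwV, hw⟩
    refine ⟨g w, ⟨h.mapsTo_symm hwV, ?_⟩, h.rightInv w hwV⟩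
    by_contra hcon
    exact hw ⟨g w, ⟨h.mapsTo_symm hwV, hcon⟩, h.rightInv w hwV⟩
  · have hzZ : z ∉ A ∪ g '' B := fun hcon => hz.2 (subset_toMeasurable _ _ hcon)
    have h1 : HasFDerivAt f (Df z) z := by
      by_contra hcon
      exact hzZ (Or.inl ⟨hz.1, hcon⟩)
    have h2 : HasFDerivAt g (Dg (f z)) (f z) := by
      by_contra hcon
      exact hzZ (Or.inr ⟨f z, ⟨h.mapsTo hz.1, hcon⟩, h.leftInv z hz.1⟩)
    refine ⟨h1, (h2.comp z h1).unique ?_⟩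
    refine (hasFDerivAt_id z).congr_of_eventuallyEq ?_
    filter_upwards [h.isOpen_source.mem_nhds hz.1] with y hy
    exact h.leftInv y hy

theorem ae_hasFDerivAt (h : IsSobolevHomeo U V f g Df Dg) : ∀ᵐ z ∂volume.restrict U,
    z ∈ U ∧ HasFDerivAt f (Df z) z ∧ (Dg (f z)).comp (Df z) = ContinuousLinearMap.id ℝ ℂ := by
  obtain ⟨E, hEU, hEm, hE, -, hEd⟩ := h.exists_good_set
  rw [ae_restrict_iff' h.isOpen_source.measurableSet]
  have : ∀ᵐ z, z ∉ U \ E := measure_eq_zero_iff_ae_notMem.1 hE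
  filter_upwards [this] with z hz hzU
  have hzE : z ∈ E := by
    by_contra hcon
    exact hz ⟨hzU, hcon⟩
  exact ⟨hzU, hEd z hzE⟩

theorem lintegral_comp (h : IsSobolevHomeo U V f g Df Dg) (G : ℂ → ℝ≥0∞) :
    ∫⁻ w in V, G w = ∫⁻ z in U, ENNReal.ofReal |(Df z).det| * G (f z) := by
  obtain ⟨E, hEU, hEm, hE, hE', hEd⟩ := h.exists_good_set
  have e1 : E =ᵐ[volume] U := (LE.le.eventuallyLE hEU).antisymm (ae_le_set.2 hE)
  have e2 : f '' E =ᵐ[volume] V := (LE.le.eventuallyLE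
    ((image_mono hEU).trans h.mapsTo.image_subset)).antisymm (ae_le_set.2 hE')
  rw [← setLIntegral_congr e1, ← setLIntegral_congr e2]
  exact lintegral_image_eq_lintegral_abs_det_fderiv_mul volume hEm
    (fun z hz => (hEd z hz).1.hasFDerivWithinAt) (h.injOn.mono hEU) G

theorem integral_comp (h : IsSobolevHomeo U V f g Df Dg) (G : ℂ → ℝ) :
    ∫ w in V, G w = ∫ z in U, |(Df z).det| * G (f z) := by
  obtain ⟨E, hEU, hEm, hE, hE', hEd⟩ := h.exists_good_set
  have e1 : E =ᵐ[volume] U := (LE.le.eventuallyLE hEU).antisymm (ae_le_set.2 hE)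
  have e2 : f '' E =ᵐ[volume] V := (LE.le.eventuallyLE
    ((image_mono hEU).trans h.mapsTo.image_subset)).antisymm (ae_le_set.2 hE')
  rw [← setIntegral_congr_set e1, ← setIntegral_congr_set e2]
  exact integral_image_eq_integral_abs_det_fderiv_smul volume hEm
    (fun z hz => (hEd z hz).1.hasFDerivWithinAt) (h.injOn.mono hEU) G

theorem integrableOn_comp (h : IsSobolevHomeo U V f g Df Dg) (G : ℂ → ℝ) :
    IntegrableOn G V ↔ IntegrableOn (fun z => |(Df z).det| * G (f z)) U := by
  obtain ⟨E, hEU, hEm, hE, hE', hEd⟩ := h.exists_good_set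
  have e1 : E =ᵐ[volume] U := (LE.le.eventuallyLE hEU).antisymm (ae_le_set.2 hE)
  have e2 : f '' E =ᵐ[volume] V := (LE.le.eventuallyLE
    ((image_mono hEU).trans h.mapsTo.image_subset)).antisymm (ae_le_set.2 hE')
  rw [← integrableOn_congr_set_ae e1, ← integrableOn_congr_set_ae e2]
  exact integrableOn_image_iff_integrableOn_abs_det_fderiv_smul volume hEm
    (fun z hz => (hEd z hz).1.hasFDerivWithinAt) (h.injOn.mono hEU) G

/-- The determinant cannot vanish, since the derivative of the inverse is a left inverse; its sign
is given by the winding number. -/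
theorem ae_det_pos (h : IsSobolevHomeo U V f g Df Dg) (ho : PreservesOrientation U f) :
    ∀ᵐ z ∂volume.restrict U, 0 < (Df z).det := by
  filter_upwards [h.ae_hasFDerivAt] with z ⟨hzU, hz, hz'⟩
  refine det_pos_of_windsOnce h.isOpen_source hzU h.continuousOn hz (ho z hzU) fun h0 => ?_
  have h1 : LinearMap.det ((Dg (f z) : ℂ →ₗ[ℝ] ℂ) ∘ₗ (Df z : ℂ →ₗ[ℝ] ℂ)) = 1 :=
    (congrArg (fun L : ℂ →L[ℝ] ℂ => LinearMap.det (L : ℂ →ₗ[ℝ] ℂ)) hz').trans LinearMap.det_id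
  rw [LinearMap.det_comp, show LinearMap.det (Df z : ℂ →ₗ[ℝ] ℂ) = 0 from h0, mul_zero] at h1
  exact zero_ne_one h1

end IsSobolevHomeo

end CombinedEnergy

namespace CombinedEnergy

/-! ### The energy of a deformation -/

/-- The integrand of the normalized total energy for the differential `L` at `z` with `z ↦ w`. -/
noncomputable def lagrangianAt (c γ : ℝ) (L : ℂ →L[ℝ] ℂ) (z w : ℂ) : ℝ :=
  lagrangian c γ (radialComp L z w).re (angularComp L z w).re (radialComp L z w).im
    (angularComp L z w).im

/-- The value of a free Lagrangian for the differential `L` at `z` with `z ↦ w`. -/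
noncomputable def FreeLagrangian.evalAt (F : FreeLagrangian) (L : ℂ →L[ℝ] ℂ) (z w : ℂ) : ℝ :=
  F.eval ‖z‖ ‖w‖ (radialComp L z w).re (angularComp L z w).re (radialComp L z w).im
    (angularComp L z w).im

theorem ne_zero_of_mem_openAnnulus {ρ : ℝ} {z : ℂ} (hz : z ∈ openAnnulus ρ) : z ≠ 0 := by
  rintro rfl
  have := hz.1
  rw [norm_zero] at this
  linarith

theorem volume_openAnnulus_ne_top (ρ : ℝ) : volume (openAnnulus ρ) ≠ ⊤ :=
  ((measure_mono (openAnnulus_subset_annulus ρ)).trans_lt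
    (isCompact_annulus ρ).measure_lt_top).ne

theorem aestronglyMeasurable_clm_apply {U : Set ℂ} {D : ℂ → ℂ →L[ℝ] ℂ} {v : ℂ → ℂ}
    (hD : AEStronglyMeasurable D (volume.restrict U)) (hv : Measurable v) :
    AEStronglyMeasurable (fun z => D z (v z)) (volume.restrict U) :=
  isBoundedBilinearMap_apply.continuous.comp_aestronglyMeasurable
    (hD.prodMk hv.aestronglyMeasurable)

theorem measurable_radial : Measurable fun z : ℂ => z / ‖z‖ := by fun_prop

theorem measurable_angular : Measurable fun z : ℂ => Complex.I * z / ‖z‖ := by fun_prop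

variable {r R : ℝ} {h : annulus r ≃ₜ annulus R}

theorem integrableOn_sq_of_combinedEnergy_lt_top {a b : ℝ} (ha : 0 < a) (hb : 0 < b)
    (hw : ∃ D, HasWeakDeriv (openAnnulus r) (toPlane h) D) (hfin : combinedEnergy a b h < ⊤) :
    IntegrableOn (fun z => ‖weakDeriv (openAnnulus r) (toPlane h) z‖ ^ 2) (openAnnulus r) := by
  have hm := (hasWeakDeriv_weakDeriv hw).locallyIntegrable_deriv.aestronglyMeasurable
  refine ⟨(hm.norm.pow 2), ?_⟩
  rw [hasFiniteIntegral_iff_ofReal (.of_forall fun z => by positivity)]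
  calc _ ≤ ∫⁻ z in openAnnulus r, ENNReal.ofReal (1 / a ^ 2 + 1 / b ^ 2) *
        ENNReal.ofReal (a ^ 2 * ‖normalDeriv h z‖ ^ 2 + b ^ 2 * ‖tangentialDeriv h z‖ ^ 2) := by
        refine setLIntegral_mono' (isOpen_openAnnulus r).measurableSet fun z hz => ?_
        rw [← ENNReal.ofReal_mul (by positivity)]
        refine ENNReal.ofReal_le_ofReal
          ((opNorm_sq_le (ne_zero_of_mem_openAnnulus hz)).trans ?_)
        rw [← normalDeriv, ← tangentialDeriv]
        have e1 : (1 / a ^ 2 + 1 / b ^ 2) * (a ^ 2 * ‖normalDeriv h z‖ ^ 2 +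
            b ^ 2 * ‖tangentialDeriv h z‖ ^ 2) = ‖normalDeriv h z‖ ^ 2 + ‖tangentialDeriv h z‖ ^ 2 +
            (b ^ 2 / a ^ 2 * ‖tangentialDeriv h z‖ ^ 2 + a ^ 2 / b ^ 2 * ‖normalDeriv h z‖ ^ 2) := by
          field_simp
          ring
        rw [e1]
        exact le_add_of_nonneg_right (by positivity)
    _ = ENNReal.ofReal (1 / a ^ 2 + 1 / b ^ 2) * combinedEnergy a b h :=
        lintegral_const_mul' _ _ ENNReal.ofReal_ne_top
    _ < ⊤ := ENNReal.mul_lt_top ENNReal.ofReal_lt_top hfin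

theorem IsDeformation.isSobolevHomeo {a b α β : ℝ} (ha : 0 < a) (hb : 0 < b) (hα : 0 < α)
    (hβ : 0 < β) (hd : IsDeformation h) (hfin : totalEnergy a b α β h < ⊤) :
    IsSobolevHomeo (openAnnulus r) (openAnnulus R) (toPlane h) (toPlane h.symm)
      (CombinedEnergy.weakDeriv (openAnnulus r) (toPlane h))
      (CombinedEnergy.weakDeriv (openAnnulus R) (toPlane h.symm)) := by
  have hw : ∃ D, HasWeakDeriv (openAnnulus r) (toPlane h) D :=
    hd.sobolev.2.imp fun _ h => h.1
  have hw' : ∃ D, HasWeakDeriv (openAnnulus R) (toPlane h.symm) D :=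
    hd.sobolev_symm.2.imp fun _ h => h.1
  rw [totalEnergy, ENNReal.add_lt_top] at hfin
  have h1 : combinedEnergy a b h < ⊤ :=
    ENNReal.lt_top_of_mul_ne_top_right hfin.1.ne (by simpa using hα)
  have h2 : combinedEnergy b a h.symm < ⊤ :=
    ENNReal.lt_top_of_mul_ne_top_right hfin.2.ne (by simpa using hβ)
  exact
  { hd.isPlanarHomeo with
    volume_source := volume_openAnnulus_ne_top r
    volume_target := volume_openAnnulus_ne_top R
    locallyIntegrable := (integrable_toPlane h).locallyIntegrable
    locallyIntegrable_symm := (integrable_toPlane h.symm).locallyIntegrable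
    weakDeriv := hasWeakDeriv_weakDeriv hw
    weakDeriv_symm := hasWeakDeriv_weakDeriv hw'
    integrableOn_sq := integrableOn_sq_of_combinedEnergy_lt_top ha hb hw h1
    integrableOn_sq_symm := integrableOn_sq_of_combinedEnergy_lt_top hb ha hw' h2 }

/-- The algebra behind the reduction to one integrand: P', Q' are the components of the differential
of the inverse, and J is the factor from the change of variables. -/
theorem lagrangian_pos_energy {a b α β J : ℝ} (hb : 0 < b) (hβ : 0 < β) (hJ : 0 < J)
    {P Q P' Q' : ℂ} (hJ' : J = P.re * Q.im - Q.re * P.im)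
    (h1 : (J : ℂ) * P' = Q.im - P.im * Complex.I) (h2 : (J : ℂ) * Q' = -Q.re + P.re * Complex.I) :
    α * (a ^ 2 * (P.re ^ 2 + P.im ^ 2) + b ^ 2 * (Q.re ^ 2 + Q.im ^ 2)) +
      β * (J * (b ^ 2 * (P'.re ^ 2 + P'.im ^ 2) + a ^ 2 * (Q'.re ^ 2 + Q'.im ^ 2))) =
      β * b ^ 2 * lagrangian (a / b) (α / β) P.re Q.re P.im Q.im := by
  have e1 := congrArg Complex.re h1
  have e2 := congrArg Complex.im h1
  have e3 := congrArg Complex.re h2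
  have e4 := congrArg Complex.im h2
  simp at e1 e2 e3 e4
  rw [lagrangian, ← hJ']
  have f1 : P'.re = Q.im / J := by rw [← e1]; field_simp
  have f2 : P'.im = -P.im / J := by rw [← e2]; field_simp
  have f3 : Q'.re = -Q.re / J := by rw [← e3]; field_simp
  have f4 : Q'.im = P.re / J := by rw [← e4]; field_simp
  rw [f1, f2, f3, f4]
  field_simp
  ring

theorem IsDeformation.totalEnergy_eq {a b α β : ℝ} (ha : 0 < a) (hb : 0 < b) (hα : 0 < α)
    (hβ : 0 < β) (hd : IsDeformation h) (hfin : totalEnergy a b α β h < ⊤) :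
    totalEnergy a b α β h = ∫⁻ z in openAnnulus r, ENNReal.ofReal (β * b ^ 2 *
      lagrangianAt (a / b) (α / β) (weakDeriv (openAnnulus r) (toPlane h) z) z (toPlane h z)) := by
  have hs := hd.isSobolevHomeo ha hb hα hβ hfin
  have hmD := hs.weakDeriv.locallyIntegrable_deriv.aestronglyMeasurable
  rw [totalEnergy, combinedEnergy, combinedEnergy, hs.lintegral_comp,
    ← lintegral_const_mul' _ _ ENNReal.ofReal_ne_top,
    ← lintegral_const_mul' _ _ ENNReal.ofReal_ne_top, ← lintegral_add_left']
  · refine lintegral_congr_ae ?_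
    filter_upwards [hs.ae_hasFDerivAt, hs.ae_det_pos hd.orientation] with z ⟨hz, hz1, hz2⟩ hz3
    have hz0 := ne_zero_of_mem_openAnnulus hz
    have hw0 := ne_zero_of_mem_openAnnulus (hs.mapsTo hz)
    obtain ⟨h1, h2⟩ := comp_inverse hz0 hw0 hz2
    rw [lagrangianAt, ← lagrangian_pos_energy hb hβ hz3 (det_eq_comp hz0 hw0) h1 h2,
      abs_of_pos hz3, ← ENNReal.ofReal_mul hz3.le, ← ENNReal.ofReal_mul hα.le,
      ← ENNReal.ofReal_mul hβ.le, ← ENNReal.ofReal_add (by positivity) (by positivity)]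
    rw [normalDeriv, tangentialDeriv, normalDeriv, tangentialDeriv, norm_apply_sq_radial hw0,
      norm_apply_sq_angular hw0, norm_apply_sq_radial hz0, norm_apply_sq_angular hz0]
  · refine AEMeasurable.const_mul (AEMeasurable.ennreal_ofReal ?_) _
    have m1 := (aestronglyMeasurable_clm_apply hmD measurable_radial).norm.aemeasurable
    have m2 := (aestronglyMeasurable_clm_apply hmD measurable_angular).norm.aemeasurable
    exact ((m1.pow_const 2).const_mul _).add ((m2.pow_const 2).const_mul _)

end CombinedEnergy

namespace CombinedEnergy

/-! ### Integrals of free Lagrangians -/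

theorem circleMap_div_norm {τ : ℝ} (hτ : 0 < τ) (θ : ℝ) :
    circleMap 0 τ θ / ‖circleMap 0 τ θ‖ = circleMap 0 1 θ := by
  rw [norm_circleMap_zero, abs_of_pos hτ, circleMap_zero, circleMap_zero]
  have : (τ : ℂ) ≠ 0 := by exact_mod_cast hτ.ne'
  field_simp
  simp

theorem measurableSet_norm_Icc (s t : ℝ) : MeasurableSet {w : ℂ | ‖w‖ ∈ Icc s t} :=
  measurable_norm measurableSet_Icc

theorem isCompact_norm_Icc (s t : ℝ) : IsCompact {w : ℂ | ‖w‖ ∈ Icc s t} :=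
  (isCompact_closedBall (0 : ℂ) t).of_isClosed_subset (isClosed_Icc.preimage continuous_norm)
    fun w hw => by rw [mem_closedBall_zero_iff]; exact hw.2

/-- The factor 1/|z| cancels the Jacobian of polar coordinates, leaving the fundamental theorem of
calculus on each ray. -/
theorem integral_radial_deriv_of_hasFDerivAt {F : ℂ → ℂ} {DF : ℂ → ℂ →L[ℝ] ℂ} {s t : ℝ} (hs : 0 < s)
    (hst : s ≤ t) (hF : ∀ z ∈ {w : ℂ | ‖w‖ ∈ Icc s t}, HasFDerivAt F (DF z) z)
    (hDF : ContinuousOn DF {w : ℂ | ‖w‖ ∈ Icc s t}) :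
    ∫ z in {w : ℂ | ‖w‖ ∈ Icc s t}, (‖z‖⁻¹ : ℝ) • DF z (z / ‖z‖) =
      ∫ θ in Ioo (-Real.pi) Real.pi, (F (circleMap 0 t θ) - F (circleMap 0 s θ)) := by
  have hmem : ∀ τ ∈ Icc s t, ∀ θ, circleMap 0 τ θ ∈ {w : ℂ | ‖w‖ ∈ Icc s t} := fun τ hτ θ => by
    rw [mem_ofPred_eq, norm_circleMap_zero, abs_of_pos (hs.trans_le hτ.1)]
    exact hτ
  have hset : Ioi 0 ∩ Icc s t = Icc s t := inter_eq_right.2 fun τ hτ => hs.trans_le hτ.1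
  rw [setIntegral_norm_mem measurableSet_Icc, hset]
  set G : ℝ × ℝ → ℂ := fun p => DF (circleMap 0 p.1 p.2) (circleMap 0 1 p.2) with hG
  have hGc : ContinuousOn G (Icc s t ×ˢ univ) :=
    (hDF.comp (continuous_circleMap_uncurry 0).continuousOn fun p hp => hmem _ hp.1 _).clm_apply
      ((continuous_circleMap 0 1).comp continuous_snd).continuousOn
  have e1 : ∫ p in Icc s t ×ˢ Ioo (-Real.pi) Real.pi, p.1 • ((‖circleMap 0 p.1 p.2‖⁻¹ : ℝ) •
      DF (circleMap 0 p.1 p.2) (circleMap 0 p.1 p.2 / ‖circleMap 0 p.1 p.2‖)) =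
      ∫ p in Icc s t ×ˢ Ioo (-Real.pi) Real.pi, G p := by
    refine setIntegral_congr_fun (measurableSet_Icc.prod measurableSet_Ioo) fun p hp => ?_
    have hp0 : 0 < p.1 := hs.trans_le hp.1.1
    simp only [hG]
    rw [circleMap_div_norm hp0, norm_circleMap_zero, abs_of_pos hp0, smul_smul,
      mul_inv_cancel₀ hp0.ne', one_smul]
  have hGi : IntegrableOn G (Icc s t ×ˢ Ioo (-Real.pi) Real.pi) :=
    ((hGc.mono (prod_mono Subset.rfl (subset_univ _))).integrableOn_compact
      (isCompact_Icc.prod (isCompact_Icc (a := -Real.pi) (b := Real.pi)))).mono_set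
      (prod_mono Subset.rfl Ioo_subset_Icc_self)
  rw [e1, Measure.volume_eq_prod, ← setIntegral_prod_swap]
  rw [Measure.volume_eq_prod] at hGi
  rw [setIntegral_prod (fun p : ℝ × ℝ => G p.swap) hGi.swap]
  refine setIntegral_congr_fun measurableSet_Ioo fun θ _ => ?_
  simp only [Prod.swap_prod_mk]
  have hder : ∀ τ ∈ uIcc s t, HasDerivAt (fun τ => F (circleMap 0 τ θ)) (G (τ, θ)) τ := by
    intro τ hτ
    rw [uIcc_of_le hst] at hτ
    have h1 : HasDerivAt (fun τ : ℝ => circleMap 0 τ θ) (circleMap 0 1 θ) τ := by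
      simp only [circleMap, zero_add, Complex.ofReal_one, one_mul]
      simpa using (Complex.ofRealCLM.hasDerivAt (x := τ)).mul_const (Complex.exp (θ * Complex.I))
    exact (hF _ (hmem τ hτ θ)).comp_hasDerivAt τ h1
  have hcs : ContinuousOn (fun τ => G (τ, θ)) (Icc s t) :=
    hGc.comp (by fun_prop) fun τ hτ => ⟨hτ, trivial⟩
  rw [integral_Icc_eq_integral_Ioc, ← intervalIntegral.integral_of_le hst,
    intervalIntegral.integral_eq_sub_of_hasDerivAt hder
      (hcs.intervalIntegrable_of_Icc hst)]

theorem HasLimitDeriv.integral_radial_deriv {U : Set ℂ} {ψ : ℂ → ℂ} {W : ℂ → ℂ →L[ℝ] ℂ}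
    (h : HasLimitDeriv U ψ W) (hψ : ContinuousOn ψ U) {s t : ℝ} (hs : 0 < s) (hst : s ≤ t)
    (hU : {w : ℂ | ‖w‖ ∈ Icc s t} ⊆ U) :
    ∫ z in {w : ℂ | ‖w‖ ∈ Icc s t}, (‖z‖⁻¹ : ℝ) • W z (z / ‖z‖) =
      ∫ θ in Ioo (-Real.pi) Real.pi, (ψ (circleMap 0 t θ) - ψ (circleMap 0 s θ)) := by
  set K := {w : ℂ | ‖w‖ ∈ Icc s t} with hK
  have hKc : IsCompact K := isCompact_norm_Icc s t
  have hKm : MeasurableSet K := measurableSet_norm_Icc s t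
  have hpi := Real.pi_pos
  have hmem : ∀ τ ∈ Icc s t, ∀ θ, circleMap 0 τ θ ∈ K := fun τ hτ θ => by
    rw [hK, mem_ofPred_eq, norm_circleMap_zero, abs_of_pos (hs.trans_le hτ.1)]
    exact hτ
  have hcint : ∀ {F : ℂ → ℂ}, ContinuousOn F K → ∀ τ ∈ Icc s t,
      IntegrableOn (fun θ => F (circleMap 0 τ θ)) (Ioo (-Real.pi) Real.pi) := by
    intro F hF τ hτ
    have : Continuous fun θ => F (circleMap 0 τ θ) :=
      hF.comp_continuous (continuous_circleMap _ _) fun θ => hmem τ hτ θ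
    exact (this.integrableOn_Icc).mono_set Ioo_subset_Icc_self
  have hsI : s ∈ Icc s t := ⟨le_rfl, hst⟩
  have htI : t ∈ Icc s t := ⟨hst, le_rfl⟩
  have hWK : IntegrableOn W K := h.integrableOn.mono_set hU
  have hrad : ∀ {D : ℂ → ℂ →L[ℝ] ℂ}, IntegrableOn D K →
      IntegrableOn (fun z => (‖z‖⁻¹ : ℝ) • D z (z / ‖z‖)) K ∧
      ‖∫ z in K, (‖z‖⁻¹ : ℝ) • D z (z / ‖z‖)‖ ≤ s⁻¹ * ∫ z in K, ‖D z‖ := by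
    intro D hD
    have hb : ∀ᵐ z ∂volume.restrict K, ‖(‖z‖⁻¹ : ℝ) • D z (z / ‖z‖)‖ ≤ s⁻¹ * ‖D z‖ := by
      filter_upwards [self_mem_ae_restrict hKm] with z hz
      have hz0 : z ≠ 0 := norm_pos_iff.1 (hs.trans_le hz.1)
      rw [norm_smul, norm_inv, norm_norm]
      refine mul_le_mul (inv_anti₀ hs hz.1) ?_ (norm_nonneg _) (by positivity)
      refine ((D z).le_opNorm _).trans_eq ?_
      rw [norm_frame hz0, mul_one]
    have hi : IntegrableOn (fun z => s⁻¹ * ‖D z‖) K := hD.norm.const_mul _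
    have hint : IntegrableOn (fun z => (‖z‖⁻¹ : ℝ) • D z (z / ‖z‖)) K := by
      refine Integrable.mono' hi ?_ hb
      exact (measurable_norm.inv).aestronglyMeasurable.smul
        (aestronglyMeasurable_clm_apply hD.aestronglyMeasurable measurable_radial)
    refine ⟨hint, (norm_integral_le_integral_norm _).trans ?_⟩
    rw [← integral_const_mul]
    exact integral_mono_ae hint.norm hi hb
  rw [← sub_eq_zero, ← norm_le_zero_iff]
  refine le_of_forall_pos_le_add fun e he => ?_
  rw [zero_add]
  set η := e / (s⁻¹ + 4 * Real.pi) with hη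
  have hη0 : 0 < η := by positivity
  obtain ⟨F, DF, hF, hDF, hFψ, hDFW⟩ := h.exists_approx K hU hKc η hη0
  have hFc : ContinuousOn F K := fun z hz => (hF z hz).continuousAt.continuousWithinAt
  have key := integral_radial_deriv_of_hasFDerivAt hs hst hF hDF
  have hDFi : IntegrableOn DF K := hDF.integrableOn_compact hKc
  obtain ⟨hi1, -⟩ := hrad hDFi
  obtain ⟨hi2, -⟩ := hrad hWK
  have hb1 := (hrad (hDFi.sub hWK)).2
  have e1 : ∫ z in K, (‖z‖⁻¹ : ℝ) • (DF - W) z (z / ‖z‖) =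
      (∫ z in K, (‖z‖⁻¹ : ℝ) • DF z (z / ‖z‖)) - ∫ z in K, (‖z‖⁻¹ : ℝ) • W z (z / ‖z‖) := by
    rw [← integral_sub hi1 hi2]
    simp [smul_sub]
  have e2 : ∫ θ in Ioo (-Real.pi) Real.pi, ((F (circleMap 0 t θ) - F (circleMap 0 s θ)) -
      (ψ (circleMap 0 t θ) - ψ (circleMap 0 s θ))) =
      (∫ θ in Ioo (-Real.pi) Real.pi, (F (circleMap 0 t θ) - F (circleMap 0 s θ))) -
      ∫ θ in Ioo (-Real.pi) Real.pi, (ψ (circleMap 0 t θ) - ψ (circleMap 0 s θ)) :=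
    integral_sub ((hcint hFc t htI).sub (hcint hFc s hsI))
      ((hcint (hψ.mono hU) t htI).sub (hcint (hψ.mono hU) s hsI))
  have hb2 : ‖∫ θ in Ioo (-Real.pi) Real.pi, ((F (circleMap 0 t θ) - F (circleMap 0 s θ)) -
      (ψ (circleMap 0 t θ) - ψ (circleMap 0 s θ)))‖ ≤ 2 * η * (2 * Real.pi) := by
    have hv : volume.real (Ioo (-Real.pi) Real.pi) = 2 * Real.pi := by
      rw [measureReal_def, Real.volume_Ioo, ENNReal.toReal_ofReal (by linarith)]
      ring
    rw [← hv]
    refine norm_setIntegral_le_of_norm_le_const (by simp) fun θ _ => ?_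
    have h1 := hFψ _ (hmem t htI θ)
    have h2 := hFψ _ (hmem s hsI θ)
    have e3 : (F (circleMap 0 t θ) - F (circleMap 0 s θ)) -
      (ψ (circleMap 0 t θ) - ψ (circleMap 0 s θ)) = (F (circleMap 0 t θ) - ψ (circleMap 0 t θ)) -
      (F (circleMap 0 s θ) - ψ (circleMap 0 s θ)) := by ring
    rw [e3]
    refine (norm_sub_le _ _).trans ?_
    linarith
  rw [e1, key] at hb1
  rw [e2] at hb2
  have h3 : s⁻¹ * ∫ z in K, ‖(DF - W) z‖ ≤ s⁻¹ * η := by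
    gcongr
    exact hDFW
  calc _ = ‖((∫ θ in Ioo (-Real.pi) Real.pi, (F (circleMap 0 t θ) - F (circleMap 0 s θ))) -
      ∫ θ in Ioo (-Real.pi) Real.pi, (ψ (circleMap 0 t θ) - ψ (circleMap 0 s θ))) -
      ((∫ θ in Ioo (-Real.pi) Real.pi, (F (circleMap 0 t θ) - F (circleMap 0 s θ))) -
      ∫ z in K, (‖z‖⁻¹ : ℝ) • W z (z / ‖z‖))‖ := by congr 1; ring
    _ ≤ 2 * η * (2 * Real.pi) + s⁻¹ * η := (norm_sub_le _ _).trans (add_le_add hb2 (hb1.trans h3))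
    _ = e := by rw [hη]; field_simp; ring

/-- The radial integral over the whole annulus, for functions continuous up to the boundary. -/
theorem HasLimitDeriv.integral_openAnnulus {r : ℝ} (hr : 1 < r) {ψ : ℂ → ℂ} {W : ℂ → ℂ →L[ℝ] ℂ}
    (h : HasLimitDeriv (openAnnulus r) ψ W) (hψ : ContinuousOn ψ (annulus r))
    (hi : IntegrableOn (fun z => (‖z‖⁻¹ : ℝ) • W z (z / ‖z‖)) (openAnnulus r)) :
    ∫ z in openAnnulus r, (‖z‖⁻¹ : ℝ) • W z (z / ‖z‖) =
      ∫ θ in Ioo (-Real.pi) Real.pi, (ψ (circleMap 0 r θ) - ψ (circleMap 0 1 θ)) := by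
  obtain ⟨M, hM⟩ := (isCompact_annulus r).exists_bound_of_continuousOn hψ
  -- Exhaustion by closed annuli, on which the smooth approximations are available. The factor 1/2
  -- keeps the inner radius below the outer one already for n = 0.
  set s : ℕ → ℝ := fun n => 1 + (r - 1) / 2 / (n + 1) with hs
  set t : ℕ → ℝ := fun n => r - (r - 1) / 2 / (n + 1) with ht
  have hd : ∀ n : ℕ, 0 < (r - 1) / 2 / (n + 1) ∧ (r - 1) / 2 / (n + 1) ≤ (r - 1) / 2 := fun n => by
    have h1 : 0 < r - 1 := by linarith
    refine ⟨by positivity, div_le_self (by positivity) ?_⟩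
    have : (0 : ℝ) ≤ n := n.cast_nonneg
    linarith
  have hlim0 : Tendsto (fun n : ℕ => (r - 1) / 2 / ((n : ℝ) + 1)) atTop (𝓝 0) :=
    (tendsto_const_nhds.div_atTop (tendsto_atTop_add_const_right _ _ tendsto_natCast_atTop_atTop))
  have hslim : Tendsto s atTop (𝓝 1) := by simpa [hs] using hlim0.const_add 1
  have htlim : Tendsto t atTop (𝓝 r) := by simpa [ht] using hlim0.const_sub r
  have hanti : ∀ m n : ℕ, m ≤ n → (r - 1) / 2 / ((n : ℝ) + 1) ≤ (r - 1) / 2 / ((m : ℝ) + 1) := by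
    intro m n hmn
    have h1 : 0 < r - 1 := by linarith
    gcongr
  have hsub : ∀ n, {w : ℂ | ‖w‖ ∈ Icc (s n) (t n)} ⊆ openAnnulus r := fun n w hw =>
    ⟨by have := hw.1; simp only [hs] at this; linarith [(hd n).1],
      by have := hw.2; simp only [ht] at this; linarith [(hd n).1]⟩
  have hunion : ⋃ n, {w : ℂ | ‖w‖ ∈ Icc (s n) (t n)} = openAnnulus r := by
    refine (iUnion_subset hsub).antisymm fun w hw => mem_iUnion.2 ?_
    exact ((hslim.eventually_le_const hw.1).and (htlim.eventually_const_le hw.2)).exists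
  have hmono : Monotone fun n => {w : ℂ | ‖w‖ ∈ Icc (s n) (t n)} := fun m n hmn w hw =>
    ⟨by have := hw.1; simp only [hs] at this ⊢; linarith [hanti m n hmn],
      by have := hw.2; simp only [ht] at this ⊢; linarith [hanti m n hmn]⟩
  have hL : Tendsto (fun n => ∫ z in {w : ℂ | ‖w‖ ∈ Icc (s n) (t n)}, (‖z‖⁻¹ : ℝ) • W z (z / ‖z‖))
      atTop (𝓝 (∫ z in openAnnulus r, (‖z‖⁻¹ : ℝ) • W z (z / ‖z‖))) := by
    have := tendsto_setIntegral_of_monotone (μ := volume) (fun n => measurableSet_norm_Icc (s n) (t n)) hmono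
      (by rw [hunion]; exact hi)
    rwa [hunion] at this
  have hcirc : ∀ τ ∈ Icc 1 r, ∀ θ, circleMap 0 τ θ ∈ annulus r := fun τ hτ θ => by
    have : ‖circleMap 0 τ θ‖ = τ := by
      rw [norm_circleMap_zero, abs_of_pos (zero_lt_one.trans_le hτ.1)]
    exact ⟨by rw [this]; exact hτ.1, by rw [this]; exact hτ.2⟩
  have hsI : ∀ n, s n ∈ Icc 1 r := fun n => ⟨by simp only [hs]; linarith [(hd n).1],
    by simp only [hs]; linarith [(hd n).2]⟩
  have htI : ∀ n, t n ∈ Icc 1 r := fun n => ⟨by simp only [ht]; linarith [(hd n).2],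
    by simp only [ht]; linarith [(hd n).1]⟩
  have hcc : ∀ τ ∈ Icc 1 r, Continuous fun θ => ψ (circleMap 0 τ θ) := fun τ hτ =>
    hψ.comp_continuous (continuous_circleMap _ _) fun θ => hcirc τ hτ θ
  have hpt : ∀ {u : ℕ → ℝ} {l : ℝ}, (∀ n, u n ∈ Icc 1 r) → l ∈ Icc 1 r → Tendsto u atTop (𝓝 l) →
      ∀ θ, Tendsto (fun n => ψ (circleMap 0 (u n) θ)) atTop (𝓝 (ψ (circleMap 0 l θ))) := by
    intro u l hu hl hul θ
    have h1 : Tendsto (fun n => circleMap 0 (u n) θ) atTop (𝓝[annulus r] (circleMap 0 l θ)) := by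
      refine tendsto_nhdsWithin_iff.2 ⟨?_, .of_forall fun n => hcirc _ (hu n) θ⟩
      have : Continuous fun τ : ℝ => circleMap 0 τ θ := by unfold circleMap; fun_prop
      exact (this.tendsto l).comp hul
    exact (hψ _ (hcirc l hl θ)).tendsto.comp h1
  have hR : Tendsto (fun n => ∫ θ in Ioo (-Real.pi) Real.pi,
      (ψ (circleMap 0 (t n) θ) - ψ (circleMap 0 (s n) θ))) atTop
      (𝓝 (∫ θ in Ioo (-Real.pi) Real.pi, (ψ (circleMap 0 r θ) - ψ (circleMap 0 1 θ)))) := by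
    refine tendsto_integral_of_dominated_convergence (fun _ => M + M) (fun n =>
      ((hcc _ (htI n)).sub (hcc _ (hsI n))).aestronglyMeasurable)
      (integrableOn_const (by simp)) (fun n => .of_forall fun θ => ?_) (.of_forall fun θ => ?_)
    · exact (norm_sub_le _ _).trans (add_le_add (hM _ (hcirc _ (htI n) θ)) (hM _ (hcirc _ (hsI n) θ)))
    · exact (hpt htI ⟨hr.le, le_rfl⟩ htlim θ).sub (hpt hsI ⟨le_rfl, hr.le⟩ hslim θ)
  refine tendsto_nhds_unique hL (hR.congr fun n => ?_)
  refine (h.integral_radial_deriv (hψ.mono (openAnnulus_subset_annulus r))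
    (zero_lt_one.trans_le (hsI n).1) ?_ (hsub n)).symm
  simp only [hs, ht]
  linarith [(hd n).2]

end CombinedEnergy

/-! ### The four terms of a free Lagrangian -/

namespace CombinedEnergy

/-- The differential of the norm at `w`. -/
noncomputable def normDifferential (w : ℂ) : ℂ →L[ℝ] ℝ :=
  Complex.reCLM.comp (ContinuousLinearMap.mul ℝ ℂ (conj w / ‖w‖))

theorem normDifferential_apply (w v : ℂ) : normDifferential w v = (v * (conj w / ‖w‖)).re := by
  simp [normDifferential, mul_comm]

theorem hasFDerivAt_norm_complex {w : ℂ} (hw : w ≠ 0) :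
    HasFDerivAt (fun w : ℂ => ‖w‖) (normDifferential w) w := by
  have h0 : ‖w‖ ≠ 0 := norm_ne_zero_iff.2 hw
  have h1 := ((hasStrictFDerivAt_norm_sq w).hasFDerivAt).sqrt (pow_ne_zero 2 h0)
  simp only [Real.sqrt_sq (norm_nonneg _)] at h1
  refine h1.congr_fderiv ?_
  ext v
  rw [normDifferential_apply]
  rw [← mul_div_assoc, Complex.div_ofReal_re, mul_comm v]
  simp only [smul_apply, innerSL_apply_apply, Complex.inner, smul_eq_mul, nsmul_eq_mul]
  push_cast
  field_simp

theorem norm_normDifferential_le (w : ℂ) : ‖normDifferential w‖ ≤ 1 := by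
  refine ContinuousLinearMap.opNorm_le_bound _ zero_le_one fun v => ?_
  rw [normDifferential_apply, Real.norm_eq_abs]
  refine (Complex.abs_re_le_norm _).trans ?_
  rw [norm_mul, norm_div, RCLike.norm_conj, Complex.norm_real, norm_norm, one_mul]
  exact mul_le_of_le_one_right (norm_nonneg _) (div_self_le_one _)

theorem continuousOn_normDifferential : ContinuousOn normDifferential {w | w ≠ 0} := by
  unfold normDifferential
  refine continuousOn_const.clm_comp ((ContinuousLinearMap.mul ℝ ℂ).continuous.comp_continuousOn ?_)
  refine Complex.continuous_conj.continuousOn.div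
    (Complex.continuous_ofReal.comp continuous_norm).continuousOn fun w hw => ?_
  simpa using hw

/-- If Φ is a primitive of A, then A(|f|) times the real part of the radial component is the radial
derivative of Φ(|f|). On the boundary circles |f| is constant, so each ray contributes Φ(R) - Φ(1).
-/
theorem integrableOn_and_integral_radialComp {r R : ℝ} (hr : 1 < r) (hR : 1 < R) {f : ℂ → ℂ}
    {D : ℂ → ℂ →L[ℝ] ℂ} (hD : HasLimitDeriv (openAnnulus r) f D)
    (hf : ContinuousOn f (annulus r)) (hfm : MapsTo f (annulus r) (annulus R))
    (hin : ∀ z ∈ annulus r, ‖z‖ = 1 → ‖f z‖ = 1) (hout : ∀ z ∈ annulus r, ‖z‖ = r → ‖f z‖ = R)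
    {A : ℝ → ℝ} (hA : ContinuousOn A (Icc 1 R)) :
    IntegrableOn (fun z => A ‖f z‖ * (radialComp (D z) z (f z)).re / ‖z‖) (openAnnulus r) ∧
    ∫ z in openAnnulus r, A ‖f z‖ * (radialComp (D z) z (f z)).re / ‖z‖ =
      2 * Real.pi * ∫ x in (1 : ℝ)..R, A x := by
  have hU := isOpen_openAnnulus r
  have hsub := openAnnulus_subset_annulus r
  -- Extended to the whole line by constants, so that the primitive is C¹ everywhere.
  set A' : ℝ → ℝ := IccExtend hR.le ((Icc 1 R).domRestrict A) with hA'
  have hA'c : Continuous A' := (continuousOn_iff_continuous_domRestrict.1 hA).Icc_extend'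
  have hA'A : ∀ x ∈ Icc 1 R, A' x = A x := fun x hx => IccExtend_of_mem _ _ hx
  set Φ : ℝ → ℝ := fun x => ∫ y in (1 : ℝ)..x, A' y with hΦ
  have hΦd : ∀ x, HasDerivAt Φ (A' x) x := fun x =>
    intervalIntegral.integral_hasDerivAt_right (hA'c.intervalIntegrable _ _)
      (hA'c.stronglyMeasurableAtFilter _ _) hA'c.continuousAt
  have hΦc : Continuous Φ := continuous_iff_continuousAt.2 fun x => (hΦd x).continuousAt
  set DΨ : ℂ × ℂ → ℂ × ℂ →L[ℝ] ℂ := fun x =>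
    Complex.ofRealCLM.comp ((A' ‖x.2‖ • normDifferential x.2).comp (ContinuousLinearMap.snd ℝ ℂ ℂ))
    with hDΨ
  have hV : IsOpen {w : ℂ | w ≠ 0} := isOpen_ne
  have hne : ∀ z ∈ annulus r, f z ≠ 0 := fun z hz h0 => by
    have := (hfm hz).1
    rw [h0, norm_zero] at this
    linarith
  have hfV : MapsTo f (openAnnulus r) {w : ℂ | w ≠ 0} := fun z hz => hne z (hsub hz)
  have hΨd : ∀ x ∈ openAnnulus r ×ˢ {w : ℂ | w ≠ 0},
      HasFDerivAt (fun x : ℂ × ℂ => (Φ ‖x.2‖ : ℂ)) (DΨ x) x := by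
    intro x hx
    have h1 : HasFDerivAt (fun x : ℂ × ℂ => ‖x.2‖)
        ((normDifferential x.2).comp (ContinuousLinearMap.snd ℝ ℂ ℂ)) x :=
      (hasFDerivAt_norm_complex hx.2).comp x hasFDerivAt_snd
    have h2 := (hΦd ‖x.2‖).comp_hasFDerivAt x h1
    exact Complex.ofRealCLM.hasFDerivAt.comp x h2
  have hDΨc : ContinuousOn DΨ (openAnnulus r ×ˢ {w : ℂ | w ≠ 0}) := by
    have h1 : ContinuousOn (fun x : ℂ × ℂ => A' ‖x.2‖ • normDifferential x.2)
        (openAnnulus r ×ˢ {w : ℂ | w ≠ 0}) :=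
      (hA'c.comp (continuous_norm.comp continuous_snd)).continuousOn.smul
        (continuousOn_normDifferential.comp continuousOn_snd fun x hx => hx.2)
    exact continuousOn_const.clm_comp (h1.clm_comp continuousOn_const)
  obtain ⟨M, hM⟩ := (isCompact_Icc (a := (1 : ℝ)) (b := R)).exists_bound_of_continuousOn hA
  set W : ℂ → ℂ →L[ℝ] ℂ := fun z =>
    (DΨ (z, f z)).comp ((ContinuousLinearMap.id ℝ ℂ).prod (D z)) with hW
  have hWv : ∀ z v, W z v = ((A' ‖f z‖ * (D z v * (conj (f z) / ‖f z‖)).re : ℝ) : ℂ) := by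
    intro z v
    rw [← normDifferential_apply]
    rfl
  have hDm := hD.integrableOn.aestronglyMeasurable
  have hi : IntegrableOn W (openAnnulus r) := by
    refine Integrable.mono' (hD.integrableOn.norm.const_mul M) ?_ ?_
    · have h1 : ContinuousOn (fun z => DΨ (z, f z)) (openAnnulus r) :=
        hDΨc.comp (continuousOn_id.prodMk (hf.mono hsub)) fun z hz => ⟨hz, hfV hz⟩
      have h2 : AEStronglyMeasurable (fun z => (ContinuousLinearMap.id ℝ ℂ).prod (D z))
          (volume.restrict (openAnnulus r)) := by
        have h3 : (fun z => (ContinuousLinearMap.id ℝ ℂ).prod (D z)) = fun z =>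
            ContinuousLinearMap.inl ℝ ℂ ℂ + (ContinuousLinearMap.inr ℝ ℂ ℂ).comp (D z) := by
          ext z <;> simp
        rw [h3]
        exact aestronglyMeasurable_const.add ((continuous_const.clm_comp
          continuous_id).comp_aestronglyMeasurable hDm)
      exact (continuous_fst.clm_comp continuous_snd).comp_aestronglyMeasurable
        ((h1.aestronglyMeasurable hU.measurableSet).prodMk h2)
    · filter_upwards [self_mem_ae_restrict hU.measurableSet] with z hz
      have hzI : ‖f z‖ ∈ Icc 1 R := hfm (hsub hz)
      have hM0 : 0 ≤ M := (norm_nonneg _).trans (hM _ hzI)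
      refine ContinuousLinearMap.opNorm_le_bound _ (by positivity) fun v => ?_
      rw [hWv, ← normDifferential_apply, Complex.norm_real, norm_mul, hA'A _ hzI, mul_assoc]
      refine mul_le_mul (hM _ hzI) ?_ (norm_nonneg _) hM0
      refine ((normDifferential _).le_of_opNorm_le (norm_normDifferential_le _) _).trans ?_
      rw [one_mul]
      exact (D z).le_opNorm v
  have hlim : HasLimitDeriv (openAnnulus r) (fun z => (Φ ‖f z‖ : ℂ)) W :=
    hD.comp hV (hf.mono hsub) hfV hΨd hDΨc hi
  have hrad : ∀ z ∈ openAnnulus r, (‖z‖⁻¹ : ℝ) • W z (z / ‖z‖) =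
      ((A ‖f z‖ * (radialComp (D z) z (f z)).re / ‖z‖ : ℝ) : ℂ) := by
    intro z hz
    rw [hWv, hA'A _ (hfm (hsub hz)), radialComp, Complex.real_smul, ← Complex.ofReal_mul]
    congr 1
    ring
  have hint : IntegrableOn (fun z => (‖z‖⁻¹ : ℝ) • W z (z / ‖z‖)) (openAnnulus r) := by
    refine Integrable.mono' hi.norm (measurable_norm.inv.aestronglyMeasurable.smul
      (aestronglyMeasurable_clm_apply hi.aestronglyMeasurable measurable_radial)) ?_
    filter_upwards [self_mem_ae_restrict hU.measurableSet] with z hz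
    rw [norm_smul, norm_inv, norm_norm]
    have h1 := (W z).le_opNorm (z / ‖z‖)
    rw [norm_frame (ne_zero_of_mem_openAnnulus hz), mul_one] at h1
    calc _ ≤ 1 * ‖W z‖ := mul_le_mul (inv_le_one_of_one_le₀ hz.1.le) h1 (norm_nonneg _) zero_le_one
      _ = _ := one_mul _
  have hψc : ContinuousOn (fun z => (Φ ‖f z‖ : ℂ)) (annulus r) :=
    (Complex.continuous_ofReal.comp (hΦc.comp continuous_norm)).comp_continuousOn hf
  have hcong : EqOn (fun z => (‖z‖⁻¹ : ℝ) • W z (z / ‖z‖)) (fun z =>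
      ((A ‖f z‖ * (radialComp (D z) z (f z)).re / ‖z‖ : ℝ) : ℂ)) (openAnnulus r) := hrad
  have hint' : IntegrableOn (fun z => ((A ‖f z‖ * (radialComp (D z) z (f z)).re / ‖z‖ : ℝ) : ℂ))
      (openAnnulus r) := hint.congr_fun hcong hU.measurableSet
  refine ⟨hint'.re.congr (.of_forall fun z => by simp), ?_⟩
  have hmain := hlim.integral_openAnnulus hr hψc hint
  rw [setIntegral_congr_fun hU.measurableSet hcong, integral_complex_ofReal] at hmain
  apply Complex.ofReal_injective
  rw [hmain]
  have hcirc : ∀ τ ∈ Icc 1 r, ∀ θ, circleMap 0 τ θ ∈ annulus r ∧ ‖circleMap 0 τ θ‖ = τ :=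
    fun τ hτ θ => by
      have : ‖circleMap 0 τ θ‖ = τ := by
        rw [norm_circleMap_zero, abs_of_pos (zero_lt_one.trans_le hτ.1)]
      exact ⟨⟨by rw [this]; exact hτ.1, by rw [this]; exact hτ.2⟩, this⟩
  have hconst : ∀ θ : ℝ, ((Φ ‖f (circleMap 0 r θ)‖ : ℂ) - (Φ ‖f (circleMap 0 1 θ)‖ : ℂ)) =
      ((∫ x in (1 : ℝ)..R, A x : ℝ) : ℂ) := by
    intro θ
    obtain ⟨h1, h2⟩ := hcirc r ⟨hr.le, le_rfl⟩ θ
    obtain ⟨h3, h4⟩ := hcirc 1 ⟨le_rfl, hr.le⟩ θ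
    rw [hout _ h1 h2, hin _ h3 h4, ← Complex.ofReal_sub]
    congr 1
    simp only [hΦ, intervalIntegral.integral_same, sub_zero]
    refine intervalIntegral.integral_congr fun x hx => hA'A x ?_
    rwa [uIcc_of_le hR.le] at hx
  simp only [hconst]
  have hpi := Real.pi_pos
  rw [setIntegral_const, measureReal_def, Real.volume_Ioo, ENNReal.toReal_ofReal (by linarith),
    Complex.real_smul]
  push_cast
  ring

/-- The value of the free Lagrangian integral. -/
noncomputable def FreeLagrangian.total (F : FreeLagrangian) (r R : ℝ) : ℝ :=
  2 * Real.pi * (∫ x in (1 : ℝ)..R, F.A x) + 2 * Real.pi * (∫ x in (1 : ℝ)..r, F.B x) +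
    (∫ w in openAnnulus R, F.C ‖w‖) + ∫ z in openAnnulus r, F.D ‖z‖

theorem integrableOn_comp_norm {ρ : ℝ} {C : ℝ → ℝ} (hC : ContinuousOn C (Icc 1 ρ)) :
    IntegrableOn (fun z : ℂ => C ‖z‖) (openAnnulus ρ) :=
  ((hC.comp continuous_norm.continuousOn fun _ hz => ⟨hz.1, hz.2⟩).integrableOn_compact
    (isCompact_annulus ρ)).mono_set (openAnnulus_subset_annulus ρ)

/-- The integral depends on the two annuli only. The B term is the A term of the inverse map,
transported to the domain. -/
theorem IsDeformation.integral_freeLagrangian {r R : ℝ} (hr : 1 < r) (hR : 1 < R)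
    {h : annulus r ≃ₜ annulus R} (hd : IsDeformation h) {Df Dg : ℂ → ℂ →L[ℝ] ℂ}
    (hs : IsSobolevHomeo (openAnnulus r) (openAnnulus R) (toPlane h) (toPlane h.symm) Df Dg)
    {F : FreeLagrangian} (hF : F.IsCont r R) :
    IntegrableOn (fun z => F.evalAt (Df z) z (toPlane h z)) (openAnnulus r) ∧
    ∫ z in openAnnulus r, F.evalAt (Df z) z (toPlane h z) = F.total r R := by
  set U := openAnnulus r with hU
  set f := toPlane h with hf
  have hUm : MeasurableSet U := (isOpen_openAnnulus r).measurableSet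
  have hdet := hs.ae_det_pos hd.orientation
  obtain ⟨iA, eA⟩ := integrableOn_and_integral_radialComp hr hR hs.hasLimitDeriv
    (continuousOn_toPlane h) (fun z hz => toPlane_mem h hz) (fun _ hz => hd.norm_inner hz)
    (fun _ hz => hd.norm_outer hz) hF.A
  obtain ⟨iB, eB⟩ := integrableOn_and_integral_radialComp hR hr hs.symm.hasLimitDeriv
    (continuousOn_toPlane h.symm) (fun z hz => toPlane_mem h.symm hz)
    (fun _ hz => hd.norm_symm_inner hR hz) (fun _ hz => hd.norm_symm_outer hR hz) hF.B
  rw [hs.integral_comp] at eB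
  rw [hs.integrableOn_comp] at iB
  -- By Cramer's rule the determinant times the radial component of the inverse has real part u.
  have hB : (fun z => |(Df z).det| * (F.B ‖toPlane h.symm (f z)‖ *
      (radialComp (Dg (f z)) (f z) (toPlane h.symm (f z))).re / ‖f z‖)) =ᵐ[volume.restrict U]
      fun z => F.B ‖z‖ * (angularComp (Df z) z (f z)).im / ‖f z‖ := by
    filter_upwards [hs.ae_hasFDerivAt, hdet] with z ⟨hz, hz1, hz2⟩ hz3
    obtain ⟨h1, -⟩ := comp_inverse (ne_zero_of_mem_openAnnulus hz)
      (ne_zero_of_mem_openAnnulus (hs.mapsTo hz)) hz2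
    have h2 := congrArg Complex.re h1
    simp only [Complex.re_ofReal_mul, Complex.sub_re, Complex.ofReal_re, Complex.re_ofReal_mul,
      Complex.I_re, mul_zero, sub_zero] at h2
    rw [hs.leftInv z hz, abs_of_pos hz3, ← h2]
    ring
  have iB' := iB.congr hB
  rw [integral_congr_ae hB] at eB
  have iC := integrableOn_comp_norm hF.C
  have eC := hs.integral_comp fun w => F.C ‖w‖
  rw [hs.integrableOn_comp] at iC
  have hC : (fun z => |(Df z).det| * F.C ‖f z‖) =ᵐ[volume.restrict U]
      fun z => F.C ‖f z‖ * ((radialComp (Df z) z (f z)).re * (angularComp (Df z) z (f z)).im -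
        (angularComp (Df z) z (f z)).re * (radialComp (Df z) z (f z)).im) := by
    filter_upwards [self_mem_ae_restrict hUm, hdet] with z hz hz3
    rw [← det_eq_comp (ne_zero_of_mem_openAnnulus hz) (ne_zero_of_mem_openAnnulus (hs.mapsTo hz)),
      abs_of_pos hz3, mul_comm]
  have iC' := iC.congr hC
  rw [integral_congr_ae hC] at eC
  have iD := integrableOn_comp_norm hF.D
  refine ⟨((iA.add iB').add iC').add iD, ?_⟩
  rw [FreeLagrangian.total, ← eA, ← eB, eC]
  exact (integral_add ((iA.add iB').add iC') iD).trans (congrArg (· + _)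
    ((integral_add (iA.add iB') iC').trans (congrArg (· + _) (integral_add iA iB'))))

end CombinedEnergy

namespace CombinedEnergy

/-! ### Radial maps -/

theorem _root_.MeasureTheory.LocallyIntegrableOn.integrable_smul {E : Type*}
    [NormedAddCommGroup E] [NormedSpace ℝ E] {U : Set ℂ} {D : ℂ → E}
    (hD : LocallyIntegrableOn D U) {φ : ℂ → ℝ} (hφ : Continuous φ) (hφs : HasCompactSupport φ)
    (hφU : tsupport φ ⊆ U) : Integrable (fun z => φ z • D z) := by
  have hsupp : Function.support (fun z => φ z • D z) ⊆ U := fun z hz =>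
    hφU (subset_tsupport _ fun h => hz (by simp [h]))
  exact (integrableOn_iff_integrable_of_support_subset hsupp).1 (hD.integrableOn_smul hφ hφs hφU)

theorem hasWeakDeriv_of_hasFDerivAt {U : Set ℂ} (hU : IsOpen U) {f : ℂ → ℂ}
    {D : ℂ → ℂ →L[ℝ] ℂ} (hf : ∀ z ∈ U, HasFDerivAt f (D z) z) (hD : ContinuousOn D U) :
    HasWeakDeriv U f D := by
  have hfc : ContinuousOn f U := fun z hz => (hf z hz).continuousAt.continuousWithinAt
  refine ⟨hfc.locallyIntegrableOn hU.measurableSet, hD.locallyIntegrableOn hU.measurableSet,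
    fun φ hφ hφs hφU v => ?_⟩
  have hφ' : Continuous fun z => fderiv ℝ φ z v :=
    (hφ.continuous_fderiv (by simp)).clm_apply continuous_const
  have hsupp : tsupport (fun z => fderiv ℝ φ z v) ⊆ tsupport φ :=
    closure_minimal (fun z hz => support_fderiv_subset ℝ fun h => hz (by
      simp [show fderiv ℝ φ z = 0 by simpa using h])) (isClosed_tsupport φ)
  have hφ's : HasCompactSupport fun z => fderiv ℝ φ z v := hφs.of_isClosed_subset
    (isClosed_tsupport _) hsupp
  have hz : ∀ z ∉ U, φ z = 0 := fun z hz => image_eq_zero_of_notMem_tsupport fun h => hz (hφU h)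
  have hz' : ∀ z ∉ U, fderiv ℝ φ z v = 0 := fun z hz =>
    image_eq_zero_of_notMem_tsupport (f := fun z => fderiv ℝ φ z v) fun h => hz (hφU (hsupp h))
  rw [setIntegral_eq_integral_of_forall_compl_eq_zero fun z h => by rw [hz' z h, zero_smul],
    setIntegral_eq_integral_of_forall_compl_eq_zero fun z h => by rw [hz z h, zero_smul], eq_comm,
    neg_eq_iff_eq_neg]
  have hDv : ContinuousOn (fun z => D z v) U := hD.clm_apply continuousOn_const
  exact integral_bilinear_hasFDerivAt_right_eq_neg_left_of_integrable
    (B := (ContinuousLinearMap.lsmul ℝ ℝ : ℝ →L[ℝ] ℂ →L[ℝ] ℂ)) (f' := fderiv ℝ φ)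
    ((hfc.locallyIntegrableOn hU.measurableSet).integrable_smul hφ' hφ's (hsupp.trans hφU))
    ((hDv.locallyIntegrableOn hU.measurableSet).integrable_smul hφ.continuous hφs hφU)
    ((hfc.locallyIntegrableOn hU.measurableSet).integrable_smul hφ.continuous hφs hφU)
    (fun z _ => (hφ.differentiable (by simp) z).hasFDerivAt) fun z hz => hf z (hφU hz)

/-- The radial map with profile `H`. -/
noncomputable def radialMap (H : ℝ → ℝ) (z : ℂ) : ℂ := (H ‖z‖ : ℂ) * (z / ‖z‖)

/-- The differential of the radial map with profile `H`, where `H'` is the derivative of `H`. -/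
noncomputable def radialDifferential (H H' : ℝ → ℝ) (z : ℂ) : ℂ →L[ℝ] ℂ :=
  (H' ‖z‖ - H ‖z‖ / ‖z‖) • (ContinuousLinearMap.mul ℝ ℂ (z / ‖z‖)).comp
    (Complex.ofRealCLM.comp (normDifferential z)) + (H ‖z‖ / ‖z‖) • ContinuousLinearMap.id ℝ ℂ

theorem radialDifferential_apply (H H' : ℝ → ℝ) (z v : ℂ) :
    radialDifferential H H' z v = (H' ‖z‖ - H ‖z‖ / ‖z‖ : ℝ) * (z / ‖z‖ * normDifferential z v) +
      (H ‖z‖ / ‖z‖ : ℝ) * v := by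
  simp [radialDifferential]

theorem ne_zero_of_mem_annulus {ρ : ℝ} {z : ℂ} (hz : z ∈ annulus ρ) : z ≠ 0 := by
  rintro rfl
  have := hz.1
  rw [norm_zero] at this
  linarith

namespace IsRadialProfile

variable {r R : ℝ} {H H' : ℝ → ℝ}

theorem norm_radialMap (hH : IsRadialProfile r R H H') {z : ℂ} (hz : z ∈ annulus r) :
    ‖radialMap H z‖ = H ‖z‖ := by
  have h1 : 1 ≤ H ‖z‖ := (hH.mapsTo hz).1
  rw [radialMap, norm_mul, norm_frame (ne_zero_of_mem_annulus hz), mul_one, Complex.norm_real,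
    Real.norm_of_nonneg (by linarith)]

theorem radialMap_mem (hH : IsRadialProfile r R H H') {z : ℂ} (hz : z ∈ annulus r) :
    radialMap H z ∈ annulus R := by
  rw [annulus, mem_ofPred_eq, hH.norm_radialMap hz]
  exact hH.mapsTo hz

theorem radialMap_div_norm (hH : IsRadialProfile r R H H') {z : ℂ} (hz : z ∈ annulus r) :
    radialMap H z / ‖radialMap H z‖ = z / ‖z‖ := by
  have h1 : (1 : ℝ) ≤ H ‖z‖ := (hH.mapsTo hz).1
  have h2 : (H ‖z‖ : ℂ) ≠ 0 := by exact_mod_cast (by linarith : H ‖z‖ ≠ 0)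
  rw [hH.norm_radialMap hz, radialMap, mul_div_cancel_left₀ _ h2]

theorem radialMap_radialMap (hH : IsRadialProfile r R H H') {K : ℝ → ℝ}
    (hK : ∀ t ∈ Icc 1 r, K (H t) = t) {z : ℂ} (hz : z ∈ annulus r) :
    radialMap K (radialMap H z) = z := by
  have h0 : (‖z‖ : ℂ) ≠ 0 := by simpa using ne_zero_of_mem_annulus hz
  conv_lhs => rw [radialMap, hH.radialMap_div_norm hz, hH.norm_radialMap hz, hK _ hz]
  field_simp

theorem continuousOn_radialMap (hH : IsRadialProfile r R H H') :
    ContinuousOn (radialMap H) (annulus r) := by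
  have h1 : ContinuousOn (fun z : ℂ => (H ‖z‖ : ℂ)) (annulus r) :=
    Complex.continuous_ofReal.comp_continuousOn
      (hH.continuousOn.comp continuous_norm.continuousOn fun z hz => hz)
  refine h1.mul (continuousOn_id.div (Complex.continuous_ofReal.comp continuous_norm).continuousOn
    fun z hz => ?_)
  simpa using ne_zero_of_mem_annulus hz

theorem hasFDerivAt_radialMap (hH : IsRadialProfile r R H H') {z : ℂ} (hz : z ∈ openAnnulus r) :
    HasFDerivAt (radialMap H) (radialDifferential H H' z) z := by
  have hz0 := ne_zero_of_mem_openAnnulus hz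
  have hn0 : ‖z‖ ≠ 0 := norm_ne_zero_iff.2 hz0
  have h1 : HasDerivAt H (H' ‖z‖) ‖z‖ :=
    (hH.hasDeriv _ ⟨hz.1.le, hz.2.le⟩).hasDerivAt (Icc_mem_nhds hz.1 hz.2)
  have h2 := (h1.div (hasDerivAt_id ‖z‖) hn0).comp_hasFDerivAt z (hasFDerivAt_norm_complex hz0)
  have h3 := h2.smul (hasFDerivAt_id z)
  have h4 : HasFDerivAt (radialMap H) _ z := h3.congr_of_eventuallyEq (.of_forall fun y => by
    simp only [radialMap, Function.comp_apply, id_eq, Pi.div_apply, Complex.real_smul, Pi.smul_apply',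
      Complex.ofReal_div]
    ring)
  refine h4.congr_fderiv ?_
  ext1 v
  have hc : (‖z‖ : ℂ) ≠ 0 := by exact_mod_cast hn0
  rw [radialDifferential_apply]
  simp only [add_apply, smul_apply, ContinuousLinearMap.smulRight_apply, Function.comp_apply, id_eq,
    Pi.div_apply, ContinuousLinearMap.id_apply, Complex.real_smul, smul_eq_mul]
  push_cast
  field_simp
  ring

theorem continuousOn_radialDifferential (hH : IsRadialProfile r R H H') :
    ContinuousOn (radialDifferential H H') (annulus r) := by
  have hn : ContinuousOn (fun z : ℂ => ‖z‖) (annulus r) := continuous_norm.continuousOn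
  have h0 : ∀ z ∈ annulus r, ‖z‖ ≠ 0 := fun z hz => norm_ne_zero_iff.2 (ne_zero_of_mem_annulus hz)
  have h1 : ContinuousOn (fun z : ℂ => H ‖z‖ / ‖z‖) (annulus r) :=
    (hH.continuousOn.comp hn fun z hz => hz).div hn h0
  have h2 : ContinuousOn (fun z : ℂ => H' ‖z‖ - H ‖z‖ / ‖z‖) (annulus r) :=
    (hH.continuousOn_deriv.comp hn fun z hz => hz).sub h1
  have h3 : ContinuousOn (fun z : ℂ => z / (‖z‖ : ℂ)) (annulus r) :=
    continuousOn_id.div (Complex.continuous_ofReal.comp continuous_norm).continuousOn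
      fun z hz => by simpa using ne_zero_of_mem_annulus hz
  have h4 : ContinuousOn normDifferential (annulus r) :=
    continuousOn_normDifferential.mono fun z hz => ne_zero_of_mem_annulus hz
  exact (h2.smul (((ContinuousLinearMap.mul ℝ ℂ).continuous.comp_continuousOn h3).clm_comp
    (continuousOn_const.clm_comp h4))).add (h1.smul continuousOn_const)

theorem radialComp_radialDifferential (hH : IsRadialProfile r R H H') {z : ℂ}
    (hz : z ∈ annulus r) : radialComp (radialDifferential H H' z) z (radialMap H z) = H' ‖z‖ := by
  have hz0 := ne_zero_of_mem_annulus hz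
  have h1 : conj (radialMap H z) / ‖radialMap H z‖ = conj z / ‖z‖ := by
    have := congrArg conj (hH.radialMap_div_norm hz)
    simpa using this
  have h2 := frame_mul_conj hz0
  rw [radialComp, h1, radialDifferential_apply, normDifferential_apply, h2]
  simp only [Complex.one_re, Complex.ofReal_one]
  push_cast
  linear_combination (H' ‖z‖ : ℂ) * h2

theorem angularComp_radialDifferential (hH : IsRadialProfile r R H H') {z : ℂ}
    (hz : z ∈ annulus r) : angularComp (radialDifferential H H' z) z (radialMap H z) =
      (H ‖z‖ / ‖z‖ : ℝ) * Complex.I := by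
  have hz0 := ne_zero_of_mem_annulus hz
  have h1 : conj (radialMap H z) / ‖radialMap H z‖ = conj z / ‖z‖ := by
    have := congrArg conj (hH.radialMap_div_norm hz)
    simpa using this
  have h2 := frame_mul_conj hz0
  have h3 : Complex.I * z / ‖z‖ * (conj z / ‖z‖) = Complex.I := by
    linear_combination Complex.I * h2
  rw [angularComp, h1, radialDifferential_apply, normDifferential_apply, h3]
  simp only [Complex.I_re, Complex.ofReal_zero]
  linear_combination ((H ‖z‖ / ‖z‖ : ℝ) : ℂ) * h3

section Homeomorph

variable {h : annulus r ≃ₜ annulus R}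

theorem toPlane_eq (hh : ∀ z : annulus r, (h z : ℂ) = radialMap H z) {z : ℂ} (hz : z ∈ annulus r) :
    toPlane h z = radialMap H z := by
  rw [toPlane_apply h hz, hh]

theorem hasFDerivAt_toPlane (hH : IsRadialProfile r R H H')
    (hh : ∀ z : annulus r, (h z : ℂ) = radialMap H z) {z : ℂ} (hz : z ∈ openAnnulus r) :
    HasFDerivAt (toPlane h) (radialDifferential H H' z) z :=
  (hH.hasFDerivAt_radialMap hz).congr_of_eventuallyEq <| by
    filter_upwards [(isOpen_openAnnulus r).mem_nhds hz] with y hy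
    exact toPlane_eq hh (openAnnulus_subset_annulus r hy)

theorem hasWeakDeriv_toPlane (hH : IsRadialProfile r R H H')
    (hh : ∀ z : annulus r, (h z : ℂ) = radialMap H z) :
    HasWeakDeriv (openAnnulus r) (toPlane h) (radialDifferential H H') :=
  hasWeakDeriv_of_hasFDerivAt (isOpen_openAnnulus r) (fun _ hz => hH.hasFDerivAt_toPlane hh hz)
    (hH.continuousOn_radialDifferential.mono (openAnnulus_subset_annulus r))

theorem memW11_toPlane (hH : IsRadialProfile r R H H')
    (hh : ∀ z : annulus r, (h z : ℂ) = radialMap H z) : MemW11 (openAnnulus r) (toPlane h) :=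
  ⟨(integrable_toPlane h).integrableOn, _, hH.hasWeakDeriv_toPlane hh,
    (hH.continuousOn_radialDifferential.integrableOn_compact (isCompact_annulus r)).mono_set
      (openAnnulus_subset_annulus r)⟩

theorem weakDeriv_toPlane (hH : IsRadialProfile r R H H')
    (hh : ∀ z : annulus r, (h z : ℂ) = radialMap H z) : ∀ᵐ z ∂volume.restrict (openAnnulus r),
    weakDeriv (openAnnulus r) (toPlane h) z = radialDifferential H H' z :=
  (hasWeakDeriv_weakDeriv ⟨_, hH.hasWeakDeriv_toPlane hh⟩).ae_eq (isOpen_openAnnulus r)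
    (hH.hasWeakDeriv_toPlane hh)

theorem combinedEnergy_lt_top (hH : IsRadialProfile r R H H') (a b : ℝ)
    (hh : ∀ z : annulus r, (h z : ℂ) = radialMap H z) : combinedEnergy a b h < ⊤ := by
  obtain ⟨M, hM⟩ := (isCompact_annulus r).exists_bound_of_continuousOn
    hH.continuousOn_radialDifferential
  have hb : combinedEnergy a b h ≤ ∫⁻ _ in openAnnulus r,
      ENNReal.ofReal (a ^ 2 * M ^ 2 + b ^ 2 * M ^ 2) := by
    refine lintegral_mono_ae ?_
    filter_upwards [hH.weakDeriv_toPlane hh,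
      self_mem_ae_restrict (isOpen_openAnnulus r).measurableSet] with z hz hzU
    have hn := norm_frame (ne_zero_of_mem_openAnnulus hzU)
    have hMz := hM z (openAnnulus_subset_annulus r hzU)
    have h1 : ‖normalDeriv h z‖ ≤ M := by
      rw [normalDeriv, hz]
      refine ((radialDifferential H H' z).le_opNorm _).trans ?_
      rw [hn, mul_one]
      exact hMz
    have h2 : ‖tangentialDeriv h z‖ ≤ M := by
      rw [tangentialDeriv, hz]
      refine ((radialDifferential H H' z).le_opNorm _).trans ?_
      rw [mul_div_assoc, norm_mul, Complex.norm_I, one_mul, hn, mul_one]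
      exact hMz
    gcongr
  refine hb.trans_lt ?_
  rw [setLIntegral_const]
  exact ENNReal.mul_lt_top ENNReal.ofReal_lt_top (volume_openAnnulus_ne_top r).lt_top

end Homeomorph

theorem det_radialDifferential_pos (hH : IsRadialProfile r R H H') {z : ℂ}
    (hz : z ∈ annulus r) : 0 < (radialDifferential H H' z).det := by
  have hz0 := ne_zero_of_mem_annulus hz
  have h1 : 1 ≤ H ‖z‖ := (hH.mapsTo hz).1
  have h2 := hH.deriv_pos ‖z‖ hz
  have h3 : 0 < ‖z‖ := norm_pos_iff.2 hz0
  rw [det_eq_comp hz0 (ne_zero_of_mem_annulus (hH.radialMap_mem hz)),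
    hH.radialComp_radialDifferential hz, hH.angularComp_radialDifferential hz]
  simp
  positivity

theorem exists_radialHomeomorph (hH : IsRadialProfile r R H H') (hr : 1 < r) :
    ∃ h : annulus r ≃ₜ annulus R, (∀ z : annulus r, (h z : ℂ) = radialMap H z) ∧
      IsDeformation h ∧ ∀ a b α β : ℝ, totalEnergy a b α β h < ⊤ := by
  obtain ⟨K, hK, hKH, hHK⟩ := hH.exists_inverse hr
  let h : annulus r ≃ₜ annulus R :=
    { toFun := fun z => ⟨radialMap H z, hH.radialMap_mem z.2⟩
      invFun := fun w => ⟨radialMap K w, hK.radialMap_mem w.2⟩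
      left_inv := fun z => Subtype.ext (hH.radialMap_radialMap hKH z.2)
      right_inv := fun w => Subtype.ext (hK.radialMap_radialMap hHK w.2)
      continuous_toFun := (continuousOn_iff_continuous_domRestrict.1
        hH.continuousOn_radialMap).subtype_mk _
      continuous_invFun := (continuousOn_iff_continuous_domRestrict.1
        hK.continuousOn_radialMap).subtype_mk _ }
  have hh : ∀ z : annulus r, (h z : ℂ) = radialMap H z := fun _ => rfl
  have hh' : ∀ w : annulus R, (h.symm w : ℂ) = radialMap K w := fun _ => rfl
  refine ⟨h, hh, ⟨fun z hz => ?_, fun z hz => ?_, fun z hz => ?_, hH.memW11_toPlane hh,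
    hK.memW11_toPlane hh'⟩, fun a b α β => ?_⟩
  · rw [hh, hH.norm_radialMap z.2, hz, hH.left]
  · rw [hh, hH.norm_radialMap z.2, hz, hH.right]
  · exact windsOnce_of_det_pos (isOpen_openAnnulus r) hz
      ((continuousOn_toPlane h).mono (openAnnulus_subset_annulus r)) (hH.hasFDerivAt_toPlane hh hz)
      (hH.det_radialDifferential_pos (openAnnulus_subset_annulus r hz))
  · exact ENNReal.add_lt_top.2 ⟨ENNReal.mul_lt_top ENNReal.ofReal_lt_top
      (hH.combinedEnergy_lt_top a b hh), ENNReal.mul_lt_top ENNReal.ofReal_lt_top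
      (hK.combinedEnergy_lt_top b a hh')⟩

end IsRadialProfile

end CombinedEnergy

namespace CombinedEnergy

/-! ### Functions with vanishing derivative -/

/-- The distance to y, on the connected circle about x, takes the values d + s and |d - s| at the
two points of the line through x and y; the triangle inequalities place t between them. -/
theorem exists_mem_sphere_inter {x y : ℂ} {s t : ℝ} (hs : 0 ≤ s) (h₁ : ‖x - y‖ ≤ s + t)
    (h₂ : s ≤ ‖x - y‖ + t) (h₃ : t ≤ ‖x - y‖ + s) :
    ∃ p, p ∈ Metric.sphere x s ∧ p ∈ Metric.sphere y t := by
  obtain ⟨u, hu, hxy⟩ : ∃ u : ℂ, ‖u‖ = 1 ∧ x - y = ‖x - y‖ * u := by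
    by_cases h : x - y = 0
    · exact ⟨1, by simp, by simp [h]⟩
    · refine ⟨_, norm_frame h, ?_⟩
      have : (‖x - y‖ : ℂ) ≠ 0 := by simpa using h
      field_simp
  set d := ‖x - y‖ with hd
  have hd0 : 0 ≤ d := norm_nonneg _
  have hmem : ∀ σ : ℝ, |σ| = s → x + σ * u ∈ Metric.sphere x s := fun σ hσ => by
    simp [hu, hσ]
  have hdist : ∀ σ : ℝ, dist (x + σ * u) y = |d + σ| := fun σ => by
    rw [dist_eq_norm, show x + σ * u - y = ((d + σ : ℝ) : ℂ) * u by
      push_cast; linear_combination hxy, norm_mul, hu, mul_one, Complex.norm_real,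
      Real.norm_eq_abs]
  obtain ⟨p, hp, hpt⟩ := (isPreconnected_sphere (by simp) x s).intermediate_value
    (hmem (-s) (by rw [abs_neg, abs_of_nonneg hs])) (hmem s (abs_of_nonneg hs))
    (f := fun p => dist p y) (by fun_prop) (show t ∈ _ from by
      rw [hdist, hdist]
      exact ⟨abs_le.2 ⟨by linarith, by linarith⟩, by rw [abs_of_nonneg (by linarith)]; linarith⟩)
  exact ⟨p, hp, hpt⟩

/-- As D vanishes almost everywhere, there are circles about any centre with arbitrarily small
oscillation. A chain of such circles along the segment from x to y, each meeting the next, carries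
the value of g from x to y. -/
theorem HasLimitDeriv.eq_of_ae_eq_zero {U : Set ℂ} {g : ℂ → ℂ} {D : ℂ → ℂ →L[ℝ] ℂ}
    (h : HasLimitDeriv U g D) (hg : ContinuousOn g U)
    (hD : ∀ᵐ z ∂volume.restrict U, D z = 0) {z₀ : ℂ} {ε : ℝ}
    (hε : Metric.ball z₀ ε ⊆ U) {x y : ℂ} (hx : x ∈ Metric.ball z₀ ε)
    (hy : y ∈ Metric.ball z₀ ε) : g x = g y := by
  by_cases hxy : x = y
  · rw [hxy]
  set e := ‖y - x‖ with he
  have he0 : 0 < e := norm_pos_iff.2 (sub_ne_zero.2 (Ne.symm hxy))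
  obtain ⟨ρ, hρ0, hρ⟩ : ∃ ρ > 0, ∀ τ ∈ Icc (0 : ℝ) 1,
      Metric.closedBall (x + τ * (y - x)) ρ ⊆ Metric.ball z₀ ε := by
    rw [Metric.mem_ball] at hx hy
    refine ⟨(ε - max (dist x z₀) (dist y z₀)) / 2, by
      have := max_lt hx hy; linarith, fun τ hτ w hw => ?_⟩
    rw [Metric.mem_closedBall] at hw
    have hm : x + τ * (y - x) ∈ Metric.closedBall z₀ (max (dist x z₀) (dist y z₀)) := by
      have := (convex_closedBall z₀ (max (dist x z₀) (dist y z₀))).add_smul_sub_mem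
        (x := x) (y := y) (Metric.mem_closedBall.2 (le_max_left _ _))
        (Metric.mem_closedBall.2 (le_max_right _ _)) hτ
      simpa using this
    rw [Metric.mem_closedBall] at hm
    have := dist_triangle w (x + τ * (y - x)) z₀
    have := max_lt hx hy
    rw [Metric.mem_ball]
    linarith
  by_contra hne
  set η := ‖g x - g y‖ / 4 with hη
  have hη0 : 0 < η := by
    have := norm_pos_iff.2 (sub_ne_zero.2 hne)
    positivity
  have hxU := hε hx
  have hyU := hε hy
  have hUx : U ∈ 𝓝 x := mem_of_superset (Metric.isOpen_ball.mem_nhds hx) hε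
  have hUy : U ∈ 𝓝 y := mem_of_superset (Metric.isOpen_ball.mem_nhds hy) hε
  obtain ⟨δ₁, hδ₁, h1⟩ := Metric.continuousAt_iff.1 (hg.continuousAt hUx) η hη0
  obtain ⟨δ₂, hδ₂, h2⟩ := Metric.continuousAt_iff.1 (hg.continuousAt hUy) η hη0
  obtain ⟨n, hn⟩ := exists_nat_gt (max 1 (2 * e / min ρ (min δ₁ δ₂)))
  have hn0 : (0 : ℝ) < n := zero_lt_one.trans ((le_max_left _ _).trans_lt hn)
  have hm0 : 0 < min ρ (min δ₁ δ₂) := by positivity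
  -- The centres are δ apart and the radii lie in [δ, 2δ], which makes consecutive circles meet; n
  -- is so large that the circles stay in `U` and the first and last are close to x and y.
  set δ := e / n with hδ
  have hδ0 : 0 < δ := by positivity
  have hδm : 2 * δ < min ρ (min δ₁ δ₂) := by
    have := (le_max_right _ _).trans_lt hn
    rw [div_lt_iff₀ hm0] at this
    rw [hδ, ← mul_div_assoc, div_lt_iff₀ hn0]
    linarith
  have hδρ : 2 * δ < ρ := hδm.trans_le (min_le_left _ _)
  have hδ1 : 2 * δ < δ₁ := hδm.trans_le ((min_le_right _ _).trans (min_le_left _ _))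
  have hδ2 : 2 * δ < δ₂ := hδm.trans_le ((min_le_right _ _).trans (min_le_right _ _))
  set c : ℕ → ℂ := fun k => x + ((k / n : ℝ) : ℂ) * (y - x) with hc
  have hosc : ∀ k : ℕ, ∃ s ∈ Icc δ (2 * δ), k ≤ n → ∀ a ∈ Metric.sphere (c k) s,
      ∀ b ∈ Metric.sphere (c k) s, ‖g a - g b‖ ≤ η / n := by
    intro k
    by_cases hk : k ≤ n
    swap
    · exact ⟨δ, ⟨le_rfl, by linarith⟩, fun h => absurd h hk⟩
    have hτ : (k / n : ℝ) ∈ Icc (0 : ℝ) 1 :=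
      ⟨by positivity, div_le_one_of_le₀ (by exact_mod_cast hk) hn0.le⟩
    have hsub : Metric.closedBall (c k) (2 * δ) ⊆ U :=
      (Metric.closedBall_subset_closedBall hδρ.le).trans ((hρ _ hτ).trans hε)
    obtain ⟨s, hs, ho⟩ := h.exists_circle_oscillation_le hδ0 hsub (η := η / n) (by positivity)
    refine ⟨s, hs, fun _ a ha b hb => (ho a ha b hb).trans_eq ?_⟩
    rw [integral_eq_zero_of_ae, zero_div, zero_add]
    filter_upwards [ae_restrict_of_ae_restrict_of_subset hsub hD] with w hw
    simp [hw]
  choose s hs ho using hosc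
  have hcd : ∀ k, ‖c k - c (k + 1)‖ = δ := fun k => by
    have : c k - c (k + 1) = ((-(1 / n) : ℝ) : ℂ) * (y - x) := by
      simp only [hc]; push_cast; ring
    rw [this, norm_mul, Complex.norm_real, Real.norm_eq_abs, abs_neg, abs_of_pos (by positivity),
      ← he, hδ]
    ring
  have hp : ∀ k, ∃ p, p ∈ Metric.sphere (c k) (s k) ∧ p ∈ Metric.sphere (c (k + 1)) (s (k + 1)) :=
    fun k => by
      have a1 := hs k
      have a2 := hs (k + 1)
      refine exists_mem_sphere_inter (hδ0.le.trans a1.1) ?_ ?_ ?_ <;> rw [hcd] <;>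
        linarith [a1.1, a1.2, a2.1, a2.2]
  choose p hp1 hp2 using hp
  have hchain : ∀ k ≤ n, ‖g (p 0) - g (p k)‖ ≤ k * (η / n) := by
    intro k
    induction k with
    | zero => intro _; simp
    | succ k ih =>
      intro hk
      have e1 := ih (by omega)
      have e2 := ho (k + 1) hk _ (hp2 k) _ (hp1 (k + 1))
      have e3 := norm_sub_le_norm_sub_add_norm_sub (g (p 0)) (g (p k)) (g (p (k + 1)))
      push_cast
      linarith
  have e1 := hchain n le_rfl
  rw [mul_div_cancel₀ _ hn0.ne'] at e1
  have hc0 : c 0 = x := by simp [hc]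
  have hcn : c n = y := by
    simp only [hc, div_self hn0.ne', Complex.ofReal_one, one_mul, add_sub_cancel]
  have e2 : ‖g (p 0) - g x‖ < η := by
    rw [← dist_eq_norm]
    refine h1 ?_
    have := hp1 0
    rw [Metric.mem_sphere, hc0] at this
    rw [this]
    linarith [(hs 0).2]
  have e3 : ‖g (p n) - g y‖ < η := by
    rw [← dist_eq_norm]
    refine h2 ?_
    have := hp1 n
    rw [Metric.mem_sphere, hcn] at this
    rw [this]
    linarith [(hs n).2]
  have e4 : g x - g y = -(g (p 0) - g x) + (g (p 0) - g (p n)) + (g (p n) - g y) := by ring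
  have e5 : ‖g x - g y‖ ≤ ‖g (p 0) - g x‖ + ‖g (p 0) - g (p n)‖ + ‖g (p n) - g y‖ := by
    rw [e4]
    refine (norm_add₃_le).trans_eq ?_
    rw [norm_neg]
  linarith

theorem HasLimitDeriv.exists_eq_const {U : Set ℂ} (hU : IsOpen U) (hUc : IsPreconnected U)
    {g : ℂ → ℂ} {D : ℂ → ℂ →L[ℝ] ℂ} (h : HasLimitDeriv U g D) (hg : ContinuousOn g U)
    (hD : ∀ᵐ z ∂volume.restrict U, D z = 0) : ∃ a, ∀ z ∈ U, g z = a := by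
  have hloc : ∀ z ∈ U, HasFDerivAt g (0 : ℂ →L[ℝ] ℂ) z := fun z hz => by
    obtain ⟨ε, hε, hball⟩ := Metric.isOpen_iff.1 hU z hz
    refine (hasFDerivAt_const (g z) z).congr_of_eventuallyEq ?_
    filter_upwards [Metric.ball_mem_nhds z hε] with y hy
    exact h.eq_of_ae_eq_zero hg hD hball hy (Metric.mem_ball_self hε)
  exact hU.exists_is_const_of_fderiv_eq_zero hUc
    (fun z hz => (hloc z hz).differentiableAt.differentiableWithinAt) fun z hz => (hloc z hz).fderiv

theorem isPreconnected_openAnnulus (r : ℝ) : IsPreconnected (openAnnulus r) := by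
  have h : openAnnulus r = (fun p : ℝ × ℝ => circleMap 0 p.1 p.2) '' (Ioo 1 r ×ˢ univ) := by
    ext z
    constructor
    · intro hz
      refine ⟨(‖z‖, z.arg), ⟨hz, mem_univ _⟩, ?_⟩
      simp [circleMap, Complex.norm_mul_exp_arg_mul_I]
    · rintro ⟨p, ⟨hp, -⟩, rfl⟩
      have : (0 : ℝ) < p.1 := zero_lt_one.trans hp.1
      simp only [openAnnulus, mem_ofPred_eq, norm_circleMap_zero, abs_of_pos this]
      exact hp
  rw [h]
  exact (isPreconnected_Ioo.prod isPreconnected_univ).image _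
    (continuous_circleMap_uncurry 0).continuousOn

end CombinedEnergy

namespace CombinedEnergy

/-! ### Rotated radial maps -/

theorem radialMap_mul (H : ℝ → ℝ) {u z : ℂ} (hu : ‖u‖ = 1) :
    radialMap H (u * z) = u * radialMap H z := by
  simp only [radialMap, norm_mul, hu, one_mul]
  ring

namespace IsRadialProfile

variable {r R : ℝ} {H H' : ℝ → ℝ} {h : annulus r ≃ₜ annulus R} {u : ℂ}

theorem weakDeriv_rotation (hH : IsRadialProfile r R H H')
    (hh : ∀ z : annulus r, (h z : ℂ) = u * radialMap H z) : ∀ᵐ z ∂volume.restrict (openAnnulus r),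
    weakDeriv (openAnnulus r) (toPlane h) z = u • radialDifferential H H' z := by
  have h1 : HasWeakDeriv (openAnnulus r) (toPlane h) fun z => u • radialDifferential H H' z := by
    refine hasWeakDeriv_of_hasFDerivAt (isOpen_openAnnulus r) (fun z hz => ?_)
      ((hH.continuousOn_radialDifferential.mono (openAnnulus_subset_annulus r)).const_smul u)
    refine ((hH.hasFDerivAt_radialMap hz).const_smul u).congr_of_eventuallyEq ?_
    filter_upwards [(isOpen_openAnnulus r).mem_nhds hz] with y hy
    rw [toPlane_apply h (openAnnulus_subset_annulus r hy), hh, Pi.smul_apply, smul_eq_mul]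
  exact (hasWeakDeriv_weakDeriv ⟨_, h1⟩).ae_eq (isOpen_openAnnulus r) h1

theorem combinedEnergy_rotation (hH : IsRadialProfile r R H H') (a b : ℝ) (hu : ‖u‖ = 1)
    (hh : ∀ z : annulus r, (h z : ℂ) = u * radialMap H z) :
    combinedEnergy a b h = ∫⁻ z in openAnnulus r,
      ENNReal.ofReal (a ^ 2 * ‖radialDifferential H H' z (z / ‖z‖)‖ ^ 2 +
        b ^ 2 * ‖radialDifferential H H' z (Complex.I * z / ‖z‖)‖ ^ 2) := by
  refine lintegral_congr_ae ?_
  filter_upwards [hH.weakDeriv_rotation hh] with z hz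
  rw [normalDeriv, tangentialDeriv, hz]
  simp [hu]

theorem totalEnergy_rotation (hH : IsRadialProfile r R H H') (hr : 1 < r) (a b α β : ℝ)
    {h₀ : annulus r ≃ₜ annulus R} (hh₀ : ∀ z : annulus r, (h₀ z : ℂ) = radialMap H z)
    (hu : ‖u‖ = 1) (hh : ∀ z : annulus r, (h z : ℂ) = u * radialMap H z) :
    totalEnergy a b α β h = totalEnergy a b α β h₀ := by
  obtain ⟨K, hK, hKH, hHK⟩ := hH.exists_inverse hr
  have hu0 : u ≠ 0 := fun h0 => by simp [h0] at hu
  have hu' : ‖u⁻¹‖ = 1 := by rw [norm_inv, hu, inv_one]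
  have key : ∀ {v : ℂ} {f : annulus r ≃ₜ annulus R}, ‖v‖ = 1 →
      (∀ z : annulus r, (f z : ℂ) = v * radialMap H z) →
      ∀ w : annulus R, (f.symm w : ℂ) = v⁻¹ * radialMap K w := by
    intro v f hv hf w
    have hv0 : v ≠ 0 := fun h0 => by simp [h0] at hv
    obtain ⟨z, rfl⟩ := f.surjective w
    rw [f.symm_apply_apply, hf, radialMap_mul K hv, hH.radialMap_radialMap hKH z.2,
      inv_mul_cancel_left₀ hv0]
  have hh₀' : ∀ z : annulus r, (h₀ z : ℂ) = 1 * radialMap H z := fun z => by rw [hh₀, one_mul]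
  rw [totalEnergy, totalEnergy, hH.combinedEnergy_rotation a b hu hh,
    hH.combinedEnergy_rotation a b norm_one hh₀', hK.combinedEnergy_rotation b a hu' (key hu hh),
    hK.combinedEnergy_rotation b a (by simp) (key norm_one hh₀')]

end IsRadialProfile

/-! ### Calibrated radial maps are minimizers -/

theorem lagrangian_pos {c γ p q s u : ℝ} (hc : 0 < c) (hγ : 0 < γ) (hJ : 0 < p * u - q * s) :
    0 < lagrangian c γ p q s u := by
  have h : 0 < p ^ 2 + q ^ 2 := by
    by_contra hn
    have hp : p = 0 := by nlinarith [sq_nonneg p, sq_nonneg q]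
    have hq : q = 0 := by nlinarith [sq_nonneg p, sq_nonneg q]
    simp [hp, hq] at hJ
  rw [lagrangian]
  have h1 : 0 ≤ γ * (c ^ 2 * (p ^ 2 + s ^ 2) + (q ^ 2 + u ^ 2)) := by positivity
  have h2 : 0 < (c ^ 2 * (p ^ 2 + q ^ 2) + (u ^ 2 + s ^ 2)) / (p * u - q * s) :=
    div_pos (by positivity) hJ
  linarith

/-- No sign is required of f: a free Lagrangian may be negative somewhere, and truncation at zero
only increases the integral. -/
theorem ofReal_integral_le_lintegral_ofReal {X : Type*} [MeasurableSpace X] {μ : Measure X}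
    {f : X → ℝ} (hf : Integrable f μ) :
    ENNReal.ofReal (∫ x, f x ∂μ) ≤ ∫⁻ x, ENNReal.ofReal (f x) ∂μ := by
  rw [integral_eq_lintegral_pos_part_sub_lintegral_neg_part hf]
  refine (ENNReal.ofReal_le_ofReal (sub_le_self _ ENNReal.toReal_nonneg)).trans ?_
  exact ENNReal.ofReal_toReal_le

variable {r R : ℝ} {H H' : ℝ → ℝ} {F G : FreeLagrangian}

theorem aemeasurable_lagrangianAt {c γ : ℝ} {U : Set ℂ} {D : ℂ → ℂ →L[ℝ] ℂ} {f : ℂ → ℂ}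
    (hD : AEStronglyMeasurable D (volume.restrict U)) (hf : Measurable f) :
    AEMeasurable (fun z => lagrangianAt c γ (D z) z (f z)) (volume.restrict U) := by
  have hw : AEMeasurable (fun z => conj (f z) / (‖f z‖ : ℂ)) (volume.restrict U) :=
    (((Complex.continuous_conj.measurable.comp hf).div
      (Complex.measurable_ofReal.comp hf.norm))).aemeasurable
  have hP : AEMeasurable (fun z => radialComp (D z) z (f z)) (volume.restrict U) :=
    (aestronglyMeasurable_clm_apply hD measurable_radial).aemeasurable.mul hw
  have hQ : AEMeasurable (fun z => angularComp (D z) z (f z)) (volume.restrict U) :=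
    (aestronglyMeasurable_clm_apply hD measurable_angular).aemeasurable.mul hw
  have p := Complex.measurable_re.comp_aemeasurable hP
  have s := Complex.measurable_im.comp_aemeasurable hP
  have q := Complex.measurable_re.comp_aemeasurable hQ
  have u := Complex.measurable_im.comp_aemeasurable hQ
  exact ((((p.pow_const 2).add (s.pow_const 2)).const_mul _).add
    ((q.pow_const 2).add (u.pow_const 2)) |>.const_mul _).add
    (((((p.pow_const 2).add (q.pow_const 2)).const_mul _).add
      ((u.pow_const 2).add (s.pow_const 2))).div ((p.mul u).sub (q.mul s)))

/-- A differential with the components of `(w / f₀) • D₀`, where `D₀` is the differential of the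
radial map `f₀`. -/
theorem IsRadialProfile.eq_smul_radialDifferential (hH : IsRadialProfile r R H H')
    {L : ℂ →L[ℝ] ℂ} {z w : ℂ} (hz : z ∈ annulus r) (hw : w ≠ 0)
    (hp : (radialComp L z w).re * H ‖z‖ = H' ‖z‖ * ‖w‖) (hq : (angularComp L z w).re = 0)
    (hs : (radialComp L z w).im = 0) (hu : (angularComp L z w).im * ‖z‖ = ‖w‖) :
    L = (w / radialMap H z) • radialDifferential H H' z := by
  have hz0 := ne_zero_of_mem_annulus hz
  have hm := hH.radialMap_mem hz
  have hm0 := ne_zero_of_mem_annulus hm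
  have hH1 : (1 : ℝ) ≤ H ‖z‖ := (hH.mapsTo hz).1
  have hHc : (H ‖z‖ : ℂ) ≠ 0 := by exact_mod_cast (by linarith : H ‖z‖ ≠ 0)
  have hzc : (‖z‖ : ℂ) ≠ 0 := by simpa using hz0
  have hwc : (‖w‖ : ℂ) ≠ 0 := by simpa using hw
  have hP : radialComp L z w * H ‖z‖ = H' ‖z‖ * ‖w‖ := by
    rw [← Complex.re_add_im (radialComp L z w), hs]
    simp only [Complex.ofReal_zero, zero_mul, add_zero]
    exact_mod_cast hp
  have hQ : angularComp L z w * ‖z‖ = Complex.I * ‖w‖ := by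
    rw [← Complex.re_add_im (angularComp L z w), hq]
    simp only [Complex.ofReal_zero, zero_add]
    rw [← hu]
    push_cast
    ring
  have hrad : radialMap H z / ‖radialMap H z‖ = z / ‖z‖ := hH.radialMap_div_norm hz
  have e1 : L (z / ‖z‖) = w / radialMap H z * radialDifferential H H' z (z / ‖z‖) := by
    rw [apply_eq_radialComp_mul hw, apply_eq_radialComp_mul (w := radialMap H z) hm0,
      hH.radialComp_radialDifferential hz, hrad, radialMap]
    have : radialComp L z w = H' ‖z‖ * ‖w‖ / H ‖z‖ := by rw [← hP]; field_simp
    rw [this]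
    field_simp
  have e2 : L (Complex.I * z / ‖z‖) =
      w / radialMap H z * radialDifferential H H' z (Complex.I * z / ‖z‖) := by
    rw [apply_eq_angularComp_mul hw, apply_eq_angularComp_mul (w := radialMap H z) hm0,
      hH.angularComp_radialDifferential hz, hrad, radialMap]
    have : angularComp L z w = Complex.I * ‖w‖ / ‖z‖ := by rw [← hQ]; field_simp
    rw [this]
    push_cast
    field_simp
  ext1 v
  have hv : v = v * (conj z / ‖z‖) * (z / ‖z‖) := by
    have := frame_mul_conj hz0
    linear_combination (-v) * this
  rw [smul_apply, hv, apply_mul, apply_mul (radialDifferential H H' z), ← mul_div_assoc Complex.I,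
    e1, e2, smul_eq_mul]
  ring

theorem annulus_subset_closure {r : ℝ} (hr : 1 < r) : annulus r ⊆ closure (openAnnulus r) := by
  intro z hz
  have hz0 := ne_zero_of_mem_annulus hz
  have h1 : z = (‖z‖ : ℂ) * (z / ‖z‖) := by
    have : (‖z‖ : ℂ) ≠ 0 := by simpa using hz0
    field_simp
  have h2 : ‖z‖ ∈ closure (Ioo 1 r) := by
    rw [closure_Ioo hr.ne]
    exact hz
  have h3 : Continuous fun t : ℝ => (t : ℂ) * (z / ‖z‖) := by fun_prop
  rw [h1]
  refine closure_mono ?_ (image_closure_subset_closure_image h3 (mem_image_of_mem _ h2))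
  rintro _ ⟨t, ht, rfl⟩
  rw [openAnnulus, mem_ofPred_eq, norm_mul, norm_frame hz0, mul_one, Complex.norm_real,
    Real.norm_of_nonneg (by linarith [ht.1])]
  exact ht

/-- A deformation whose differential is the one of the radial map, up to the ratio of the two maps,
is a rotation of the radial map. -/
theorem IsRadialProfile.exists_eq_rotation (hH : IsRadialProfile r R H H') (hr : 1 < r)
    {h : annulus r ≃ₜ annulus R} (hd : IsDeformation h) {D : ℂ → ℂ →L[ℝ] ℂ}
    (hD : HasLimitDeriv (openAnnulus r) (toPlane h) D)
    (hrig : ∀ᵐ z ∂volume.restrict (openAnnulus r),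
      D z = (toPlane h z / radialMap H z) • radialDifferential H H' z) :
    ∃ φ : ℝ, ∀ z : annulus r, (h z : ℂ) = Complex.exp (φ * Complex.I) * radialMap H z := by
  have hf0 : ∀ z ∈ annulus r, radialMap H z ≠ 0 := fun z hz =>
    ne_zero_of_mem_annulus (hH.radialMap_mem hz)
  have hsub := openAnnulus_subset_annulus r
  have hfc := continuousOn_toPlane h
  -- The differential of (z, w) ↦ w / h₀(z). Along the graph of `h` it vanishes by the quotient
  -- rule, since the differential of `h` is that of the radial map times their quotient.
  set DΨ : ℂ × ℂ → ℂ × ℂ →L[ℝ] ℂ := fun x => (radialMap H x.1)⁻¹ • ContinuousLinearMap.snd ℝ ℂ ℂ -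
    (x.2 / radialMap H x.1 ^ 2) • (radialDifferential H H' x.1).comp
      (ContinuousLinearMap.fst ℝ ℂ ℂ) with hDΨ
  have hzero : ∀ᵐ z ∂volume.restrict (openAnnulus r), (DΨ (z, toPlane h z)).comp
      ((ContinuousLinearMap.id ℝ ℂ).prod (D z)) = 0 := by
    filter_upwards [hrig, self_mem_ae_restrict (isOpen_openAnnulus r).measurableSet] with z hz hzU
    have h0 := hf0 z (hsub hzU)
    ext1 v
    simp only [hDΨ, hz, ContinuousLinearMap.comp_apply, sub_apply, smul_apply,
      ContinuousLinearMap.prod_apply, ContinuousLinearMap.coe_fst', ContinuousLinearMap.coe_snd',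
      ContinuousLinearMap.id_apply, smul_eq_mul, zero_apply]
    field_simp
    ring
  have hg := hD.comp isOpen_univ (hfc.mono hsub) (mapsTo_univ _ _)
    (Ψ := fun x => x.2 * (radialMap H x.1)⁻¹) (DΨ := DΨ) (fun x hx => ?_) ?_
    ((hD.integrableOn.sub hD.integrableOn).congr (hzero.mono fun z hz => by
      simp only [hz, Pi.sub_apply, sub_self]))
  rotate_left
  · have h1 : HasFDerivAt (fun x : ℂ × ℂ => radialMap H x.1)
        ((radialDifferential H H' x.1).comp (ContinuousLinearMap.fst ℝ ℂ ℂ)) x :=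
      (hH.hasFDerivAt_radialMap hx.1).comp x hasFDerivAt_fst
    refine (hasFDerivAt_snd.mul ((hasFDerivAt_inv' (hf0 _ (hsub hx.1))).comp x h1)).congr_fderiv ?_
    have h0 := hf0 _ (hsub hx.1)
    refine ContinuousLinearMap.ext fun v => ?_
    simp [hDΨ]
    field_simp
    ring
  · have h1 : ContinuousOn (fun x : ℂ × ℂ => radialMap H x.1) (openAnnulus r ×ˢ univ) :=
      (hH.continuousOn_radialMap.mono hsub).comp continuousOn_fst fun x hx => hx.1
    have h2 : ContinuousOn (fun x : ℂ × ℂ => radialDifferential H H' x.1)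
        (openAnnulus r ×ˢ univ) :=
      (hH.continuousOn_radialDifferential.mono hsub).comp continuousOn_fst fun x hx => hx.1
    have h3 : ∀ x ∈ openAnnulus r ×ˢ (univ : Set ℂ), radialMap H x.1 ≠ 0 :=
      fun x hx => hf0 _ (hsub hx.1)
    have h4 : ContinuousOn (fun x : ℂ × ℂ => x.2 / radialMap H x.1 ^ 2) (openAnnulus r ×ˢ univ) :=
      continuousOn_snd.div (h1.pow 2) fun x hx => pow_ne_zero 2 (h3 x hx)
    exact ((h1.inv₀ h3).smul continuousOn_const).sub (h4.smul (h2.clm_comp continuousOn_const))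
  -- The quotient is constant on the connected open annulus; continuity carries this to the closed
  -- one, and the inner circle shows that the constant has modulus one.
  obtain ⟨u, hu⟩ := hg.exists_eq_const (isOpen_openAnnulus r) (isPreconnected_openAnnulus r)
    ((hfc.mono hsub).mul ((hH.continuousOn_radialMap.mono hsub).inv₀ fun z hz => hf0 z (hsub hz)))
    hzero
  have heq : EqOn (toPlane h) (fun z => u * radialMap H z) (annulus r) := by
    refine EqOn.of_subset_closure (s := openAnnulus r) (fun z hz => ?_) hfc
      (continuousOn_const.mul hH.continuousOn_radialMap) hsub (annulus_subset_closure hr)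
    have h0 := hf0 z (hsub hz)
    rw [← hu z hz]
    field_simp
  have h1A : (1 : ℂ) ∈ annulus r := by simp [annulus, hr.le]
  have hu1 : ‖u‖ = 1 := by
    have e1 := heq h1A
    have e2 := hd.inner_circle ⟨1, h1A⟩ (by simp)
    rw [toPlane_apply h h1A] at e1
    rw [e1] at e2
    simpa [radialMap, hH.left] using e2
  obtain ⟨φ, hφ⟩ := (Complex.norm_eq_one_iff u).1 hu1
  exact ⟨φ, fun z => by rw [hφ, ← toPlane_apply h z.2]; exact heq z.2⟩

/-- The calibration argument: E(h) ≥ β b² ∫ F = E(h₀), because the integral of F is the same for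
both maps. Equality forces F = L almost everywhere; then G is nonnegative with integral zero, so it
vanishes too, and the rigidity clause determines the differential. -/
theorem IsCalibration.isRadialMinimizer {a b α β : ℝ} (ha : 0 < a) (hb : 0 < b) (hα : 0 < α)
    (hβ : 0 < β) (hr : 1 < r) (hR : 1 < R) (hH : IsRadialProfile r R H H')
    (hF : IsCalibration (a / b) (α / β) r R H H' F G) : IsRadialMinimizer a b α β r R H := by
  obtain ⟨h₀, hh₀, hd₀, hfin₀⟩ := hH.exists_radialHomeomorph hr
  set κ := β * b ^ 2 with hκ
  have hκ0 : 0 < κ := by positivity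
  have hc0 : 0 < a / b := by positivity
  have hγ0 : 0 < α / β := by positivity
  have hUm := (isOpen_openAnnulus r).measurableSet
  have hs₀ := hd₀.isSobolevHomeo ha hb hα hβ (hfin₀ a b α β)
  obtain ⟨iF₀, tF₀⟩ := hd₀.integral_freeLagrangian hr hR hs₀ hF.cont
  obtain ⟨iG₀, tG₀⟩ := hd₀.integral_freeLagrangian hr hR hs₀ hF.cont'
  have hcomp : ∀ᵐ z ∂volume.restrict (openAnnulus r), ∀ E : FreeLagrangian,
      E.evalAt (weakDeriv (openAnnulus r) (toPlane h₀) z) z (toPlane h₀ z) =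
        E.eval ‖z‖ (H ‖z‖) (H' ‖z‖) 0 0 (H ‖z‖ / ‖z‖) ∧
      lagrangianAt (a / b) (α / β) (weakDeriv (openAnnulus r) (toPlane h₀) z) z (toPlane h₀ z) =
        lagrangian (a / b) (α / β) (H' ‖z‖) 0 0 (H ‖z‖ / ‖z‖) := by
    filter_upwards [hH.weakDeriv_toPlane hh₀, self_mem_ae_restrict hUm] with z hz hzU E
    have hzA := openAnnulus_subset_annulus r hzU
    rw [hz, IsRadialProfile.toPlane_eq hh₀ hzA, FreeLagrangian.evalAt, lagrangianAt,
      hH.radialComp_radialDifferential hzA, hH.angularComp_radialDifferential hzA,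
      hH.norm_radialMap hzA]
    simp
  have hG0 : G.total r R = 0 := by
    rw [← tG₀, integral_eq_zero_of_ae]
    filter_upwards [hcomp, self_mem_ae_restrict hUm] with z hz hzU
    rw [(hz G).1]
    exact hF.eq' _ ⟨hzU.1.le, hzU.2.le⟩
  have hpt : ∀ {h : annulus r ≃ₜ annulus R}, IsDeformation h → totalEnergy a b α β h < ⊤ →
      ∀ᵐ z ∂volume.restrict (openAnnulus r), z ∈ openAnnulus r ∧ toPlane h z ∈ openAnnulus R ∧
        0 < (radialComp (weakDeriv (openAnnulus r) (toPlane h) z) z (toPlane h z)).re *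
          (angularComp (weakDeriv (openAnnulus r) (toPlane h) z) z (toPlane h z)).im -
          (angularComp (weakDeriv (openAnnulus r) (toPlane h) z) z (toPlane h z)).re *
          (radialComp (weakDeriv (openAnnulus r) (toPlane h) z) z (toPlane h z)).im := by
    intro h hd hfin
    have hs := hd.isSobolevHomeo ha hb hα hβ hfin
    filter_upwards [hs.ae_det_pos hd.orientation, self_mem_ae_restrict hUm] with z hz hzU
    have hw := hs.mapsTo hzU
    refine ⟨hzU, hw, ?_⟩
    rwa [← det_eq_comp (ne_zero_of_mem_openAnnulus hzU) (ne_zero_of_mem_openAnnulus hw)]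
  have hE₀ : totalEnergy a b α β h₀ = ENNReal.ofReal (κ * F.total r R) := by
    rw [hd₀.totalEnergy_eq ha hb hα hβ (hfin₀ a b α β), ← tF₀, ← integral_const_mul,
      ofReal_integral_eq_lintegral_ofReal (iF₀.const_mul κ)]
    · refine lintegral_congr_ae ?_
      filter_upwards [hcomp, self_mem_ae_restrict hUm] with z hz hzU
      rw [(hz F).1, (hz F).2, hF.eq _ ⟨hzU.1.le, hzU.2.le⟩]
    · filter_upwards [hcomp, hpt hd₀ (hfin₀ a b α β)] with z hz ⟨hzU, _, hJ⟩
      rw [(hz F).1, hF.eq _ ⟨hzU.1.le, hzU.2.le⟩, ← (hz F).2]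
      exact mul_nonneg hκ0.le (lagrangian_pos hc0 hγ0 hJ).le
  have hlow : ∀ {h : annulus r ≃ₜ annulus R}, IsDeformation h → totalEnergy a b α β h < ⊤ →
      totalEnergy a b α β h₀ ≤ ∫⁻ z in openAnnulus r, ENNReal.ofReal
        (κ * F.evalAt (weakDeriv (openAnnulus r) (toPlane h) z) z (toPlane h z)) := by
    intro h hd hfin
    obtain ⟨iF, tF⟩ := hd.integral_freeLagrangian hr hR (hd.isSobolevHomeo ha hb hα hβ hfin) hF.cont
    rw [hE₀, ← tF, ← integral_const_mul]
    exact ofReal_integral_le_lintegral_ofReal (iF.const_mul κ)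
  have hle : ∀ {h : annulus r ≃ₜ annulus R}, IsDeformation h → totalEnergy a b α β h < ⊤ →
      (fun z => ENNReal.ofReal
        (κ * F.evalAt (weakDeriv (openAnnulus r) (toPlane h) z) z (toPlane h z)))
      ≤ᵐ[volume.restrict (openAnnulus r)] fun z => ENNReal.ofReal (κ * lagrangianAt (a / b) (α / β)
        (weakDeriv (openAnnulus r) (toPlane h) z) z (toPlane h z)) := by
    intro h hd hfin
    filter_upwards [hpt hd hfin] with z ⟨hzU, hw, hJ⟩
    refine ENNReal.ofReal_le_ofReal (mul_le_mul_of_nonneg_left ?_ hκ0.le)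
    exact hF.le _ ⟨hzU.1.le, hzU.2.le⟩ _ ⟨hw.1.le, hw.2.le⟩ _ _ _ _ hJ
  refine ⟨h₀, hh₀, hd₀, hfin₀ a b α β, fun h hd => ?_, fun h hd => ⟨fun he => ?_, ?_⟩⟩
  · by_cases hfin : totalEnergy a b α β h < ⊤
    · rw [hd.totalEnergy_eq ha hb hα hβ hfin]
      exact (hlow hd hfin).trans (lintegral_mono_ae (hle hd hfin))
    · rw [not_lt_top_iff.1 hfin]
      exact le_top
  · have hfin : totalEnergy a b α β h < ⊤ := he ▸ hfin₀ a b α β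
    have hs := hd.isSobolevHomeo ha hb hα hβ hfin
    have hL := hd.totalEnergy_eq ha hb hα hβ hfin
    set D := weakDeriv (openAnnulus r) (toPlane h) with hD
    have hfm : Measurable (toPlane h) := measurable_toPlane h
    have hne : ∫⁻ z in openAnnulus r, ENNReal.ofReal (κ * F.evalAt (D z) z (toPlane h z)) ≠ ⊤ :=
      ((lintegral_mono_ae (hle hd hfin)).trans_lt (hL ▸ hfin)).ne
    have hae := ae_eq_of_ae_le_of_lintegral_le (hle hd hfin) hne
      (((aemeasurable_lagrangianAt hs.weakDeriv.locallyIntegrable_deriv.aestronglyMeasurable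
        hfm).const_mul κ).ennreal_ofReal) ((hL.symm.trans he).le.trans (hlow hd hfin))
    -- Equality is known only after truncation at zero; as L > 0, the truncation is not active.
    have heq : ∀ᵐ z ∂volume.restrict (openAnnulus r),
        F.evalAt (D z) z (toPlane h z) = lagrangianAt (a / b) (α / β) (D z) z (toPlane h z) := by
      filter_upwards [hae, hpt hd hfin] with z hz ⟨_, _, hJ⟩
      have hLp := lagrangian_pos hc0 hγ0 hJ
      have h1 : 0 < κ * lagrangianAt (a / b) (α / β) (D z) z (toPlane h z) := mul_pos hκ0 hLp
      have h2 : 0 < κ * F.evalAt (D z) z (toPlane h z) := by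
        rw [← ENNReal.ofReal_pos, hz]
        exact ENNReal.ofReal_pos.2 h1
      rw [ENNReal.ofReal_eq_ofReal_iff h2.le h1.le] at hz
      exact mul_left_cancel₀ hκ0.ne' hz
    obtain ⟨iG, tG⟩ := hd.integral_freeLagrangian hr hR hs hF.cont'
    rw [hG0] at tG
    have hGz := (setIntegral_eq_zero_iff_of_nonneg_ae (by
      filter_upwards [heq, hpt hd hfin] with z hz ⟨hzU, hw, hJ⟩
      exact hF.nonneg _ ⟨hzU.1.le, hzU.2.le⟩ _ ⟨hw.1.le, hw.2.le⟩ _ _ _ _ hJ hz) iG).1 tG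
    have hrig : ∀ᵐ z ∂volume.restrict (openAnnulus r),
        D z = (toPlane h z / radialMap H z) • radialDifferential H H' z := by
      filter_upwards [heq, hGz, hpt hd hfin] with z hz hGz ⟨hzU, hw, hJ⟩
      obtain ⟨e1, e2, e3, e4⟩ := hF.rigid _ ⟨hzU.1.le, hzU.2.le⟩ _ ⟨hw.1.le, hw.2.le⟩ _ _ _ _ hJ hz hGz
      exact hH.eq_smul_radialDifferential (openAnnulus_subset_annulus r hzU)
        (ne_zero_of_mem_openAnnulus hw) e1 e2 e3 e4
    obtain ⟨φ, hφ⟩ := hH.exists_eq_rotation hr hd hs.hasLimitDeriv hrig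
    exact ⟨φ, fun z => by rw [hφ, hh₀]⟩
  · rintro ⟨φ, hφ⟩
    refine hH.totalEnergy_rotation hr a b α β hh₀ (u := Complex.exp (φ * Complex.I))
      (Complex.norm_exp_ofReal_mul_I φ) fun z => ?_
    rw [hφ, hh₀]

end CombinedEnergy

namespace CombinedEnergy

/-! ### Slope systems and minimizers -/

namespace IsSlopeSystem

variable {a b α β r R : ℝ} {H k : ℝ → ℝ}

theorem isRadialMinimizer_of_slope_eq_one (h : IsSlopeSystem (a / b) (α / β) r R H k) (ha : 0 < a)
    (hb : 0 < b) (hα : 0 < α) (hβ : 0 < β) (hr : 1 < r) (hR : 1 < R)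
    (hk : ∀ t ∈ Icc 1 r, k t = 1) : IsRadialMinimizer a b α β r R H := by
  obtain ⟨F, G, hF⟩ := h.exists_calibration_of_slope_eq_one (by positivity) (by positivity) hk
  exact hF.isRadialMinimizer ha hb hα hβ hr hR (h.isRadialProfile (by positivity))

theorem isRadialMinimizer_of_slope_le_one (h : IsSlopeSystem (a / b) (α / β) r R H k) (ha : 0 < a)
    (hb : 0 < b) (hα : 0 < α) (hβ : 0 < β) (hr : 1 < r) (hR : 1 < R) (hc : 1 / 2 ≤ a / b)
    (hk : ∀ t ∈ Icc 1 r, k t ≤ 1) : IsRadialMinimizer a b α β r R H := by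
  rcases h.slope_eq_one_or_lt_one hr (by positivity) (by positivity) hk with h1 | h1
  · exact h.isRadialMinimizer_of_slope_eq_one ha hb hα hβ hr hR h1
  · obtain ⟨F, hF⟩ := h.exists_strictCalibration hr hc (by positivity) h1
    exact hF.isCalibration.isRadialMinimizer ha hb hα hβ hr hR (h.isRadialProfile (by positivity))

/-- The inverse profile has slope 1/k ≤ 1 and parameter b/a ≥ 1/2. Its calibration is carried back
by `IsStrictCalibration.of_inverse`. -/
theorem isRadialMinimizer_of_one_le_slope (h : IsSlopeSystem (a / b) (α / β) r R H k) (ha : 0 < a)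
    (hb : 0 < b) (hα : 0 < α) (hβ : 0 < β) (hr : 1 < r) (hR : 1 < R) (hc : a / b ≤ 2)
    (hk : ∀ t ∈ Icc 1 r, 1 ≤ k t) : IsRadialMinimizer a b α β r R H := by
  have hc0 : 0 < a / b := by positivity
  have hγ0 : 0 < α / β := by positivity
  have hp := h.isRadialProfile hc0
  obtain ⟨K, hK, hKH, hHK⟩ := h.inverse hr hc0 hγ0
  have hm : MapsTo K (Icc 1 R) (Icc 1 r) := (hK.isRadialProfile (by positivity)).mapsTo
  rcases hK.slope_eq_one_or_lt_one hR (by positivity) (by positivity)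
    (fun ρ hρ => inv_le_one_of_one_le₀ (hk _ (hm hρ))) with h1 | h1
  · refine h.isRadialMinimizer_of_slope_eq_one ha hb hα hβ hr hR fun t ht => ?_
    have := h1 (H t) (hp.mapsTo ht)
    rwa [hKH t ht, inv_eq_one] at this
  · obtain ⟨F, hF⟩ := hK.exists_strictCalibration hR
      (by rw [← inv_inv (1 / 2 : ℝ)]; exact inv_anti₀ hc0 (by linarith)) (by positivity) h1
    refine (hF.of_inverse hc0 hγ0 hp.mapsTo hp.deriv_pos hKH hHK fun t ht => ?_)
      |>.isCalibration.isRadialMinimizer ha hb hα hβ hr hR hp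
    rw [hKH t ht]
    field_simp

end IsSlopeSystem

end CombinedEnergy
-- The theorem
theorem mainTheorem1 (r R : ℝ) (hr : 1 < r) (hR : 1 < R) :
    -- concavity or convexity condition on the radial solution
    (∀ a b α β : ℝ, 0 < a → 0 < b → 0 < α → 0 < β →
      ∀ H : ℝ → ℝ, CombinedEnergy.IsRadialSolution (a / b) (α / β) r R H →
        (CombinedEnergy.ConcavityCondition (a / b) r H ∨
          CombinedEnergy.ConvexityCondition (a / b) r H) →
        CombinedEnergy.IsRadialMinimizer a b α β r R H) ∧
    -- balanced case
    (∀ a b α β : ℝ, 0 < a → 0 < b → 0 < α → 0 < β →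
      R = r ^ (1 / (a / b)) →
        CombinedEnergy.IsRadialMinimizer a b α β r R (fun t => t ^ (1 / (a / b)))) ∧
    -- the version for `c` close to `1`
    (∃ ε : ℝ, 0 ≤ ε ∧
      (CombinedEnergy.modulus r / CombinedEnergy.modulus R ≠ 1 → 0 < ε) ∧
      ∀ a b α β : ℝ, 0 < a → 0 < b → 0 < α → 0 < β → |a / b - 1| ≤ ε →
        ∃ H : ℝ → ℝ, CombinedEnergy.IsRadialSolution (a / b) (α / β) r R H ∧
          CombinedEnergy.IsRadialMinimizer a b α β r R H) := by
  refine ⟨fun a b α β ha hb hα hβ H hH hcc => ?_, fun a b α β ha hb hα hβ hRr => ?_,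
    -- The constant does not depend on the annuli: |c - 1| ≤ 1/2 gives 1/2 ≤ c ≤ 2, which is what
    -- the two slope criteria require.
    1 / 2, by norm_num, fun _ => by norm_num, fun a b α β ha hb hα hβ hε => ?_⟩
  · have hc : 0 < a / b := by positivity
    have hs := hH.isSlopeSystem hr hc (by positivity)
    have hpos : ∀ t ∈ Set.Icc 1 r, 0 < t ∧ 0 < H t := fun t ht =>
      ⟨zero_lt_one.trans_le ht.1, hs.pos t ht⟩
    rcases hcc with ⟨hc1, hk⟩ | ⟨hc1, hk⟩
    -- As c ≤ 1, c t H' ≥ c² t H' ≥ H, that is, k ≥ 1. The convexity condition is dual.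
    · refine hs.isRadialMinimizer_of_one_le_slope ha hb hα hβ hr hR (by linarith) fun t ht => ?_
      obtain ⟨ht0, hH0⟩ := hpos t ht
      have hd := hH.deriv_pos t ht
      rw [le_div_iff₀ hH0, one_mul]
      refine (hk t ht).trans ?_
      have : (a / b) ^ 2 ≤ a / b := by nlinarith
      gcongr
    · refine hs.isRadialMinimizer_of_slope_le_one ha hb hα hβ hr hR (by linarith) fun t ht => ?_
      obtain ⟨ht0, hH0⟩ := hpos t ht
      have hd := hH.deriv_pos t ht
      rw [div_le_one hH0]
      refine le_trans ?_ (hk t ht)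
      have : a / b ≤ (a / b) ^ 2 := by nlinarith
      gcongr
  · subst hRr
    exact (CombinedEnergy.isSlopeSystem_rpow (α / β)
      (by positivity)).isRadialMinimizer_of_slope_eq_one ha hb hα hβ hr hR fun _ _ => rfl
  · have hc : 0 < a / b := by positivity
    have hγ : 0 < α / β := by positivity
    obtain ⟨h1, h2⟩ := abs_le.1 hε
    -- Shooting covers R ≤ r^(1/c). In the opposite case r ≤ R^c, so shooting applies to the inverse
    -- problem, with c and γ replaced by their reciprocals, and the solution is inverted.
    rcases le_total R (r ^ (1 / (a / b))) with hRr | hRr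
    · obtain ⟨H, k, hs, hk⟩ := CombinedEnergy.exists_slopeSystem hc hγ hr hR hRr
      exact ⟨H, hs.isRadialSolution hr hc hγ,
        hs.isRadialMinimizer_of_slope_le_one ha hb hα hβ hr hR (by linarith) hk⟩
    · have hrR : r ≤ R ^ (1 / (a / b)⁻¹) := by
        have h0 := Real.rpow_le_rpow (by positivity) hRr hc.le
        rwa [← Real.rpow_mul (by linarith), one_div_mul_cancel hc.ne', Real.rpow_one,
          ← one_div_one_div (a / b), ← inv_eq_one_div (a / b)] at h0
      obtain ⟨K, k, hs, hk⟩ := CombinedEnergy.exists_slopeSystem (inv_pos.2 hc) (inv_pos.2 hγ)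
        hR hr hrR
      obtain ⟨H, hs', -, -⟩ := hs.inverse hR (inv_pos.2 hc) (inv_pos.2 hγ)
      rw [inv_inv, inv_inv] at hs'
      have hm := (hs'.isRadialProfile hc).mapsTo
      exact ⟨H, hs'.isRadialSolution hr hc hγ,
        hs'.isRadialMinimizer_of_one_le_slope ha hb hα hβ hr hR (by linarith) fun t ht =>
          one_le_inv₀ (hs.slope_pos _ (hm ht)) |>.2 (hk _ (hm ht))⟩
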